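/- Let $(\Omega,\Sigma,\mu)$ and $(S,\mathcal F,m)$ be finite measure spaces with $\mu\neq 0$ and $L_2(S)$ infinite-dimensional. Let $L_0=L_0(\Omega)$ be the algebra of classes of complex measurable functions on $\Omega$, $L_0^h$ its real-valued part, and $L_{2,2}(\Omega\times S)$ the Hilbert space of measurable $f$ with $\|f\|_{2,2}^2=\int_\Omega\int_S|f|^2\,dm\,d\mu<\infty$. Let $E_0=L_0(\Omega,L_2(S))$ be the Kaplansky–Hilbert module over $L_0$ of classes of measurable $f(\omega,s)$ with $f(\omega,\cdot)\in L_2(S)$ for a.e. $\omega$, with the $L_0$-valued inner product $\langle x,y\rangle(\omega)=\int_S x(\omega,s)\overline{y(\omega,s)}\,dm(s)$ and norm $\|x\|=\sqrt{\langle x,x\rangle}$; it contains $L_{2,2}(\Omega\times S)$. Let $$(Tf)(\omega,t)=\int_S k(\omega,t,s)f(\omega,s)\,dm(s),$$ acting on $L_{2,2}(\Omega\times S)$ and on $E_0$, where $k\in L_\infty(\Omega\times S^2)$, $k(\omega,t,s)=\overline{k(\omega,s,t)}$ a.e., and $\int_S\int_S k(\omega,t,s)x(\omega,s)\overline{x(\omega,t)}\,dm(s)\,dm(t)\ge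 0$ for a.e. $\omega$, for all $x\in L_{2,2}(\Omega\times S)$. (Such $T$ is a self-adjoint, cyclically compact partially integral operator.) Let $\mathbf m=\inf\{\langle Tx,x\rangle:\ x\in E_0,\ \|x\|=\mathbf 1\}$ and $M=\sup\{\langle Tx,x\rangle:\ x\in E_0,\ \|x\|=\mathbf 1\}$. Then $\mathbf m$ and $M$ exist in $L_0^h$, and there are $\lambda_n\in L_0^h$ and $x_n\in E_0$ ($n\ge1$) such that the following hold. 1. $Tx_n=\lambda_nx_n$, $\langle x_i,x_j\rangle=\delta_{ij}\mathbf 1$, $\lambda_n(\omega)\to0$ for a.e. $\omega$, and $Tf=\sum_{n=1}^\infty\lambda_n\langle f,x_n\rangle x_n$ for all $f\in L_{2,2}(\Omega\times S)$, with convergence in the norm of $L_{2,2}$. If $L_2(S)$ is separable, then moreover $f=\sum_n\langle f,x_n\rangle x_n$ in $L_{2,2}$ for all $f\in L_{2,2}(\Omega\times S)$. 2. For every $\lambda\in L_0^h$ and $f\in L_{2,2}(\Omega\times S)$ the series $$E_\lambda f=\sum_{n}\chi_{\{\lambda_n\le\lambda\}}\langle f,x_n\rangle x_n+\chi_{\{\lambda\ge0\}}\Big(f-\sum_n\langle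 f,x_n\rangle x_n\Big)$$ converge in $L_{2,2}$ (the last term vanishes if $L_2(S)$ is separable), $E_\lambda$ is an orthogonal projection in $L_{2,2}(\Omega\times S)$, and for every $\varepsilon>0$ $$T=\int_{\mathbf m}^{M+\varepsilon\mathbf 1}\lambda\,dE_\lambda .$$ 3. For every $\varepsilon>0$ and every $f:\mathbb R\to\mathbb C$ that is continuous on $[\mathbf m(\omega),M(\omega)+\varepsilon]$ for a.e. $\omega$, $$f(T)=\int_{\mathbf m}^{M+\varepsilon\mathbf 1}f(\lambda)\,dE_\lambda ,$$ where $f(T)$ is given by the continuous functional calculus of the self-adjoint operator $T$ on the Hilbert space $L_{2,2}(\Omega\times S)$. In 2 and 3 the integral over the closed order interval $[a,b]\subset L_0^h$ is the limit, in the strong operator topology of $L_{2,2}(\Omega\times S)$, of the Riemann–Stieltjes sums $$f(a)E_a+\sum_{i=1}^{n}f(\xi_i)(E_{p_i}-E_{p_{i-1}}),\qquad a=p_0\le\xi_1\le p_1\le\dots\le\xi_n\le p_n=b,\quad p_i,\xi_i\in L_0^h,$$ as $\delta\to0$, where $p_i-p_{i-1}\le\delta\mathbf 1$ for all $i$. 4.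 Let $B$ be the algebra of $L_0$-linear $L_0$-bounded operators on $E_0$. Let $\operatorname{spm}(T)$ be the set of $\lambda\in L_0$ such that $T-\lambda I$ is not invertible in $B$ and $\pi(T-\lambda I)$ is not invertible in $\pi B$ for any nonzero idempotent $\pi$ of $L_0$, and let $\operatorname{spm}_{\mathrm{disc}}(T)$ be the set of $\lambda\in\operatorname{spm}(T)$ with $\lambda(\omega)\ne0$ for a.e. $\omega$. For each $\lambda\in\operatorname{spm}_{\mathrm{disc}}(T)$ the $L_0$-module $\ker(\lambda I-T)\subset E_0$ is $\sigma$-finitely generated: there is a countable measurable partition $(A_n)$ of $\Omega$ such that each $\chi_{A_n}\ker(\lambda I-T)$ is finitely generated over $L_0$. 5. With $\tilde\lambda_0=0$ and $\tilde\lambda_n=\lambda_n$ for $n\ge1$, $$\operatorname{spm}(T)=\operatorname{mix}\Big\{\sum_{n=0}^\infty\chi_{A_n}\tilde\lambda_n:\ A_n\in\Sigma,\ A_n\cap A_m=\varnothing\ (n\ne m)\Big\},$$ where $\operatorname{mix}K$ is the set of all $\sum_n\chi_{B_n}u_n$ with $u_n\in K$ and $(B_n)$ a countable measurable partition of $\Omega$.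 -/

import Mathlib

open MeasureTheory Filter Topology Set
open scoped ENNReal ComplexOrder ComplexConjugate

set_option linter.unusedSectionVars false

namespace PartInt

noncomputable section

/-! ### The algebra `L₀(Ω)` and the Kaplansky-Hilbert module `L₀(Ω, L₂(S))` -/

/-- `L₀(Ω)`: classes of complex measurable functions. -/
abbrev L0 {Ω : Type*} [MeasurableSpace Ω] (μ : Measure Ω) : Type _ := Ω →ₘ[μ] ℂ

/-- `L₀ʰ(Ω)`: classes of real measurable functions. -/
abbrev L0h {Ω : Type*} [MeasurableSpace Ω] (μ : Measure Ω) : Type _ := Ω →ₘ[μ] ℝ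

/-- The pointwise (a.e.) ring structure; it extends the additive and multiplicative structures
of Mathlib. -/
instance instCommRingL0 {α : Type*} [MeasurableSpace α] (ν : Measure α) :
    CommRing (α →ₘ[ν] ℂ) where
  __ := (AEEqFun.instAddCommGroup : AddCommGroup (α →ₘ[ν] ℂ))
  __ := (AEEqFun.instCommMonoid : CommMonoid (α →ₘ[ν] ℂ))
  left_distrib a b c := by
    apply AEEqFun.ext
    filter_upwards [AEEqFun.coeFn_mul a (b + c), AEEqFun.coeFn_add b c,
      AEEqFun.coeFn_add (a * b) (a * c), AEEqFun.coeFn_mul a b, AEEqFun.coeFn_mul a c]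
      with x h1 h2 h3 h4 h5
    simp only [h1, h2, h3, h4, h5, Pi.mul_apply, Pi.add_apply, mul_add]
  right_distrib a b c := by
    apply AEEqFun.ext
    filter_upwards [AEEqFun.coeFn_mul (a + b) c, AEEqFun.coeFn_add a b,
      AEEqFun.coeFn_add (a * c) (b * c), AEEqFun.coeFn_mul a c, AEEqFun.coeFn_mul b c]
      with x h1 h2 h3 h4 h5
    simp only [h1, h2, h3, h4, h5, Pi.mul_apply, Pi.add_apply, add_mul]
  zero_mul a := by
    apply AEEqFun.ext
    filter_upwards [AEEqFun.coeFn_mul 0 a, (AEEqFun.coeFn_zero : ⇑(0 : α →ₘ[ν] ℂ) =ᵐ[ν] 0)]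
      with x h1 h2
    simp only [h1, h2, Pi.mul_apply, Pi.zero_apply, zero_mul]
  mul_zero a := by
    apply AEEqFun.ext
    filter_upwards [AEEqFun.coeFn_mul a 0, (AEEqFun.coeFn_zero : ⇑(0 : α →ₘ[ν] ℂ) =ᵐ[ν] 0)]
      with x h1 h2
    simp only [h1, h2, Pi.mul_apply, Pi.zero_apply, mul_zero]

variable {Ω S : Type*} [MeasurableSpace Ω] [MeasurableSpace S]
variable {μ : Measure Ω} {m : Measure S}

/-- A function of `ω` read as a function of `(ω, s)`. -/
def pull (μ : Measure Ω) (m : Measure S) : L0 μ →+* (Ω × S →ₘ[μ.prod m] ℂ) where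
  toFun a := a.compQuasiMeasurePreserving Prod.fst Measure.quasiMeasurePreserving_fst
  map_one' := rfl
  map_zero' := rfl
  map_mul' a b := by
    induction a using AEEqFun.induction_on
    induction b using AEEqFun.induction_on
    rfl
  map_add' a b := by
    induction a using AEEqFun.induction_on
    induction b using AEEqFun.induction_on
    rfl

theorem coeFn_pull (a : L0 μ) : pull μ m a =ᵐ[μ.prod m] fun p => a p.1 :=
  AEEqFun.coeFn_compQuasiMeasurePreserving a Measure.quasiMeasurePreserving_fst

/-- `L₀(Ω)` acts on measurable functions of `(ω, s)` by `(a • f)(ω, s) = a(ω) f(ω, s)`. -/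
instance instModuleL0 : Module (L0 μ) (Ω × S →ₘ[μ.prod m] ℂ) := Module.compHom _ (pull μ m)

theorem coeFn_L0_smul (a : L0 μ) (f : Ω × S →ₘ[μ.prod m] ℂ) :
    ⇑(a • f) =ᵐ[μ.prod m] fun p => a p.1 * f p := by
  filter_upwards [AEEqFun.coeFn_mul (pull μ m a) f, coeFn_pull (m := m) a] with p h1 h2
  rw [← h2]
  exact h1

/-- The Kaplansky-Hilbert module `L₀(Ω, L₂(S))` over `L₀(Ω)`, realised by functions of two
variables: classes of measurable `f(ω, s)` with `f(ω, ·) ∈ L₂(S)` for almost every `ω`.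
It contains `L_{2,2}(Ω × S)` and is the module that `L_{2,2}(Ω × S)` generates over `L₀(Ω)`. -/
def KH (μ : Measure Ω) (m : Measure S) [SFinite m] :
    Submodule (L0 μ) (Ω × S →ₘ[μ.prod m] ℂ) where
  carrier := {f | ∀ᵐ ω ∂μ, MemLp (fun s => f (ω, s)) 2 m}
  zero_mem' := by
    filter_upwards [Measure.ae_ae_of_ae_prod
      (AEEqFun.coeFn_zero : ⇑(0 : Ω × S →ₘ[μ.prod m] ℂ) =ᵐ[μ.prod m] 0)] with ω h
    exact (memLp_congr_ae h).2 MemLp.zero'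
  add_mem' {f g} hf hg := by
    filter_upwards [hf, hg, Measure.ae_ae_of_ae_prod (AEEqFun.coeFn_add f g)] with ω h1 h2 h3
    exact (memLp_congr_ae h3).2 (h1.add h2)
  smul_mem' a f hf := by
    filter_upwards [hf, Measure.ae_ae_of_ae_prod (coeFn_L0_smul a f)] with ω h1 h2
    exact (memLp_congr_ae h2).2 (h1.const_mul (a ω))

/-- `L_{2,2}(Ω × S)`, with its norm `(∫∫ |f|² dm dμ)^{1/2}`. -/
abbrev L22 (μ : Measure Ω) (m : Measure S) : Type _ := Lp ℂ 2 (μ.prod m)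

theorem sections_memLp [SFinite μ] [SFinite m] (f : L22 μ m) :
    ∀ᵐ ω ∂μ, MemLp (fun s => f (ω, s)) 2 m := by
  have h0 : ∫⁻ p, ‖f p‖ₑ ^ (2 : ℝ) ∂(μ.prod m) < ∞ := by
    have := lintegral_rpow_enorm_lt_top_of_eLpNorm_lt_top (p := 2) (by norm_num) (by norm_num)
      (Lp.memLp f).2
    simpa using this
  have hm : AEMeasurable (fun p => ‖f p‖ₑ ^ (2 : ℝ)) (μ.prod m) :=
    (Lp.aestronglyMeasurable f).enorm.pow_const _
  rw [lintegral_prod _ hm] at h0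
  filter_upwards [ae_lt_top' hm.lintegral_prod_right' h0.ne,
    (Lp.aestronglyMeasurable f).prodMk_left] with ω h1 h2
  refine ⟨h2, ?_⟩
  rw [eLpNorm_lt_top_iff_lintegral_rpow_enorm_lt_top (by norm_num) (by norm_num)]
  simpa using h1

/-- The inclusion of `L_{2,2}(Ω × S)` into `L₀(Ω, L₂(S))`. -/
def toKH [SFinite μ] [SFinite m] (f : L22 μ m) : KH μ m := ⟨f.1, sections_memLp f⟩

/-- The norm of `L_{2,2}(Ω × S)`, with the value `∞` off this space. -/
def norm22 [SFinite m] (u : KH μ m) : ℝ≥0∞ := eLpNorm (u : Ω × S →ₘ[μ.prod m] ℂ) 2 (μ.prod m)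

/-- The `L₀`-valued inner product `⟨x, y⟩(ω) = ∫ x(ω, s) conj (y(ω, s)) dm(s)`. -/
def inner0 [SFinite m] (x y : KH μ m) : L0 μ :=
  AEEqFun.mk (fun ω => ∫ s, x.1 (ω, s) * conj (y.1 (ω, s)) ∂m)
    (AEStronglyMeasurable.integral_prod_right' (f := fun p => x.1 p * conj (y.1 p))
      (x.1.aestronglyMeasurable.mul
        (Complex.continuous_conj.comp_aestronglyMeasurable y.1.aestronglyMeasurable)))

/-- The `L₀`-valued norm `‖x‖ = √⟨x, x⟩`. -/
def norm0 [SFinite m] (x : KH μ m) : L0h μ :=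
  AEEqFun.comp (fun z : ℂ => Real.sqrt z.re) (by fun_prop) (inner0 x x)

/-- A real function as an element of `L₀(Ω)`. -/
def ofReal0 (a : L0h μ) : L0 μ := AEEqFun.comp (fun r : ℝ => (r : ℂ)) (by fun_prop) a

/-- The idempotent `χ_A` of `L₀(Ω)` given by a measurable set `A`. -/
def chi (μ : Measure Ω) (A : Set Ω) (hA : MeasurableSet A) : L0 μ :=
  AEEqFun.mk (A.indicator 1) (stronglyMeasurable_one.indicator hA).aestronglyMeasurable

/-- The idempotent `χ_{a ≤ b}` of `L₀(Ω)`. -/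
def chiLe (a b : L0h μ) : L0 μ :=
  chi μ {ω | a ω ≤ b ω} (measurableSet_le a.measurable b.measurable)

/-! ### The partially integral operator -/

theorem quasi_sections [SFinite μ] [SFinite m] :
    Measure.QuasiMeasurePreserving (fun q : (Ω × S) × S => (q.1.1, q.2))
      ((μ.prod m).prod m) (μ.prod m) := by
  refine ⟨by fun_prop, Measure.AbsolutelyContinuous.mk fun s hs h => ?_⟩
  rw [Measure.map_apply (by fun_prop) hs,
    Measure.measure_prod_null (hs.preimage (by fun_prop))]
  exact Measure.quasiMeasurePreserving_fst.ae (Measure.measure_ae_null_of_prod_null h)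

section Operator

variable [IsFiniteMeasure μ] [IsFiniteMeasure m]

/-- Bounded kernels `k(ω, t, s)`, that is, the elements of `L_∞(Ω × S²)`. -/
abbrev Kernel (μ : Measure Ω) (m : Measure S) : Type _ := Lp ℂ ∞ (μ.prod (m.prod m))

theorem kernel_measurable (k : Kernel μ m) (f : Ω × S →ₘ[μ.prod m] ℂ) :
    AEStronglyMeasurable (fun q : (Ω × S) × S => k (q.1.1, q.1.2, q.2) * f (q.1.1, q.2))
      ((μ.prod m).prod m) :=
  ((Lp.aestronglyMeasurable k).comp_measurePreserving (measurePreserving_prodAssoc μ m m)).mul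
    (f.aestronglyMeasurable.comp_quasiMeasurePreserving quasi_sections)

/-- `(T f)(ω, t) = ∫ k(ω, t, s) f(ω, s) dm(s)`. -/
def integralOp (k : Kernel μ m) (f : Ω × S →ₘ[μ.prod m] ℂ) : Ω × S →ₘ[μ.prod m] ℂ :=
  AEEqFun.mk (fun p => ∫ s, k (p.1, p.2, s) * f (p.1, s) ∂m)
    (kernel_measurable k f).integral_prod_right'

theorem coeFn_integralOp (k : Kernel μ m) (f : Ω × S →ₘ[μ.prod m] ℂ) :
    ∀ᵐ ω ∂μ, ∀ᵐ t ∂m, integralOp k f (ω, t) = ∫ s, k (ω, t, s) * f (ω, s) ∂m :=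
  Measure.ae_ae_of_ae_prod (AEEqFun.coeFn_mk _ _)

theorem kernel_bound (k : Kernel μ m) :
    ∀ᵐ ω ∂μ, ∀ᵐ t ∂m, ∀ᵐ s ∂m, ‖k (ω, t, s)‖ₑ ≤ ‖k‖ₑ := by
  have h : ∀ᵐ z ∂(μ.prod (m.prod m)), ‖k z‖ₑ ≤ ‖k‖ₑ := by
    rw [Lp.enorm_def, eLpNorm_exponent_top]
    exact ae_le_eLpNormEssSup
  filter_upwards [Measure.ae_ae_of_ae_prod h] with ω h1
  exact Measure.ae_ae_of_ae_prod h1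

theorem kernel_sections (k : Kernel μ m) :
    ∀ᵐ ω ∂μ, ∀ᵐ t ∂m, AEStronglyMeasurable (fun s => k (ω, t, s)) m := by
  filter_upwards [(Lp.aestronglyMeasurable k).prodMk_left] with ω h1
  exact h1.prodMk_left

theorem integrable_kernel_mul (k : Kernel μ m) {f : Ω × S →ₘ[μ.prod m] ℂ} (hf : f ∈ KH μ m) :
    ∀ᵐ ω ∂μ, ∀ᵐ t ∂m, Integrable (fun s => k (ω, t, s) * f (ω, s)) m := by
  filter_upwards [hf, kernel_bound k, kernel_sections k] with ω h1 h2 h3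
  filter_upwards [h2, h3] with t h4 h5
  refine (h1.integrable (by norm_num)).bdd_mul (c := ‖k‖) h5 ?_
  filter_upwards [h4] with s h6
  exact enorm_le_iff_norm_le.1 h6

theorem enorm_integral_le (k : Kernel μ m) (f : Ω × S →ₘ[μ.prod m] ℂ) :
    ∀ᵐ ω ∂μ, ∀ᵐ t ∂m, ‖integralOp k f (ω, t)‖ₑ ≤
      ‖k‖ₑ * eLpNorm (fun s => f (ω, s)) 1 m := by
  filter_upwards [coeFn_integralOp k f, kernel_bound k, f.aestronglyMeasurable.prodMk_left]
    with ω h1 h2 h3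
  filter_upwards [h1, h2] with t h4 h5
  rw [h4, eLpNorm_one_eq_lintegral_enorm, ← lintegral_const_mul'' _ h3.enorm]
  refine (enorm_integral_le_lintegral_enorm _).trans (lintegral_mono_ae ?_)
  filter_upwards [h5] with s h6
  rw [enorm_mul]
  gcongr

theorem integralOp_mem (k : Kernel μ m) {f : Ω × S →ₘ[μ.prod m] ℂ} (hf : f ∈ KH μ m) :
    integralOp k f ∈ KH μ m := by
  filter_upwards [hf, enorm_integral_le k f, (integralOp k f).aestronglyMeasurable.prodMk_left]
    with ω h1 h2 h3
  have hfin : ‖k‖ₑ * eLpNorm (fun s => f (ω, s)) 1 m ≠ ∞ :=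
    ENNReal.mul_ne_top enorm_ne_top (h1.mono_exponent (by norm_num)).2.ne
  refine MemLp.of_bound h3 (‖k‖ₑ * eLpNorm (fun s => f (ω, s)) 1 m).toReal ?_
  filter_upwards [h2] with t h4
  rw [← toReal_enorm]
  exact ENNReal.toReal_mono hfin h4

theorem ext_sections {F G : Ω × S →ₘ[μ.prod m] ℂ} (h : ∀ᵐ ω ∂μ, ∀ᵐ t ∂m, F (ω, t) = G (ω, t)) :
    F = G :=
  AEEqFun.ext ((Measure.ae_prod_iff_ae_ae (p := fun p => F p = G p)
    (measurableSet_eq_fun F.measurable G.measurable)).2 h)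

theorem integralOp_add (k : Kernel μ m) {f g : Ω × S →ₘ[μ.prod m] ℂ}
    (hf : f ∈ KH μ m) (hg : g ∈ KH μ m) :
    integralOp k (f + g) = integralOp k f + integralOp k g := by
  apply ext_sections
  filter_upwards [coeFn_integralOp k f, coeFn_integralOp k g, coeFn_integralOp k (f + g),
    integrable_kernel_mul k hf, integrable_kernel_mul k hg,
    Measure.ae_ae_of_ae_prod (AEEqFun.coeFn_add f g),
    Measure.ae_ae_of_ae_prod (AEEqFun.coeFn_add (integralOp k f) (integralOp k g))]
    with ω h1 h2 h3 h4 h5 h6 h7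
  filter_upwards [h1, h2, h3, h4, h5, h7] with t g1 g2 g3 g4 g5 g7
  rw [g3, g7, Pi.add_apply, g1, g2, ← integral_add g4 g5]
  refine integral_congr_ae ?_
  filter_upwards [h6] with s h
  rw [h, Pi.add_apply, mul_add]

theorem integralOp_smul (k : Kernel μ m) (a : L0 μ) (f : Ω × S →ₘ[μ.prod m] ℂ) :
    integralOp k (a • f) = a • integralOp k f := by
  apply ext_sections
  filter_upwards [coeFn_integralOp k f, coeFn_integralOp k (a • f),
    Measure.ae_ae_of_ae_prod (coeFn_L0_smul a f),
    Measure.ae_ae_of_ae_prod (coeFn_L0_smul a (integralOp k f))] with ω h1 h2 h3 h4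
  filter_upwards [h1, h2, h4] with t g1 g2 g4
  rw [g2, g4, g1, ← integral_const_mul]
  refine integral_congr_ae ?_
  filter_upwards [h3] with s h
  rw [h]
  ring

theorem integralOp_const_smul (k : Kernel μ m) (c : ℂ) (f : Ω × S →ₘ[μ.prod m] ℂ) :
    integralOp k (c • f) = c • integralOp k f := by
  apply ext_sections
  filter_upwards [coeFn_integralOp k f, coeFn_integralOp k (c • f),
    Measure.ae_ae_of_ae_prod (AEEqFun.coeFn_smul c f),
    Measure.ae_ae_of_ae_prod (AEEqFun.coeFn_smul c (integralOp k f))] with ω h1 h2 h3 h4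
  filter_upwards [h1, h2, h4] with t g1 g2 g4
  rw [g2, g4, Pi.smul_apply, g1, smul_eq_mul, ← integral_const_mul]
  refine integral_congr_ae ?_
  filter_upwards [h3] with s h
  rw [h, Pi.smul_apply, smul_eq_mul]
  ring

theorem eLpNorm_integralOp_le (k : Kernel μ m) (f : Ω × S →ₘ[μ.prod m] ℂ) :
    eLpNorm (integralOp k f) 2 (μ.prod m) ≤ ‖k‖ₑ * m univ * eLpNorm f 2 (μ.prod m) := by
  have key : ∀ᵐ ω ∂μ, ∫⁻ t, ‖integralOp k f (ω, t)‖ₑ ^ (2 : ℝ) ∂m ≤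
      (‖k‖ₑ * m univ) ^ (2 : ℝ) * ∫⁻ t, ‖f (ω, t)‖ₑ ^ (2 : ℝ) ∂m := by
    filter_upwards [enorm_integral_le k f, f.aestronglyMeasurable.prodMk_left] with ω h1 h2
    have h3 := eLpNorm_le_eLpNorm_mul_rpow_measure_univ (p := 1) (q := 2) (by norm_num) h2
    have h4 : eLpNorm (fun s => f (ω, s)) 2 m ^ (2 : ℝ) = ∫⁻ t, ‖f (ω, t)‖ₑ ^ (2 : ℝ) ∂m := by
      rw [eLpNorm_eq_lintegral_rpow_enorm_toReal (by norm_num) (by norm_num), ← ENNReal.rpow_mul]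
      norm_num
    have h5 : (m univ ^ (1 / (1 : ℝ≥0∞).toReal - 1 / (2 : ℝ≥0∞).toReal)) ^ (2 : ℝ) = m univ := by
      rw [← ENNReal.rpow_mul]
      norm_num
    calc ∫⁻ t, ‖integralOp k f (ω, t)‖ₑ ^ (2 : ℝ) ∂m
        ≤ ∫⁻ _, (‖k‖ₑ * eLpNorm (fun s => f (ω, s)) 1 m) ^ (2 : ℝ) ∂m := by
          refine lintegral_mono_ae ?_
          filter_upwards [h1] with t h
          gcongr
      _ = (‖k‖ₑ * eLpNorm (fun s => f (ω, s)) 1 m) ^ (2 : ℝ) * m univ := lintegral_const _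
      _ ≤ (‖k‖ₑ * (eLpNorm (fun s => f (ω, s)) 2 m *
            m univ ^ (1 / (1 : ℝ≥0∞).toReal - 1 / (2 : ℝ≥0∞).toReal))) ^ (2 : ℝ) * m univ := by
          gcongr
      _ = (‖k‖ₑ * m univ) ^ (2 : ℝ) * ∫⁻ t, ‖f (ω, t)‖ₑ ^ (2 : ℝ) ∂m := by
          rw [ENNReal.mul_rpow_of_nonneg _ _ (by norm_num),
            ENNReal.mul_rpow_of_nonneg _ _ (by norm_num), h5, h4,
            ENNReal.mul_rpow_of_nonneg _ _ (by norm_num), ENNReal.rpow_two (m univ)]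
          ring
  have hm1 : AEMeasurable (fun p => ‖f p‖ₑ ^ (2 : ℝ)) (μ.prod m) :=
    f.aestronglyMeasurable.enorm.pow_const _
  have hm2 : AEMeasurable (fun p => ‖integralOp k f p‖ₑ ^ (2 : ℝ)) (μ.prod m) :=
    (integralOp k f).aestronglyMeasurable.enorm.pow_const _
  rw [← ENNReal.rpow_le_rpow_iff (z := 2) (by norm_num),
    ENNReal.mul_rpow_of_nonneg _ _ (by norm_num)]
  have h2 : ∀ g : Ω × S → ℂ, eLpNorm g 2 (μ.prod m) ^ (2 : ℝ) =
      ∫⁻ p, ‖g p‖ₑ ^ (2 : ℝ) ∂(μ.prod m) := by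
    intro g
    rw [eLpNorm_eq_lintegral_rpow_enorm_toReal (by norm_num) (by norm_num), ← ENNReal.rpow_mul]
    norm_num
  rw [h2, h2, lintegral_prod _ hm1, lintegral_prod _ hm2,
    ← lintegral_const_mul'' _ hm1.lintegral_prod_right']
  exact lintegral_mono_ae key

/-- The partially integral operator with kernel `k` on `L₀(Ω, L₂(S))`. -/
def opKH (k : Kernel μ m) : KH μ m →ₗ[L0 μ] KH μ m where
  toFun u := ⟨integralOp k u.1, integralOp_mem k u.2⟩
  map_add' u v := Subtype.ext (integralOp_add k u.2 v.2)
  map_smul' a u := Subtype.ext (integralOp_smul k a u.1)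

theorem integralOp_memLp (k : Kernel μ m) (f : L22 μ m) :
    integralOp k f.1 ∈ Lp ℂ 2 (μ.prod m) :=
  Lp.mem_Lp_iff_eLpNorm_lt_top.2 ((eLpNorm_integralOp_le k f.1).trans_lt
    (ENNReal.mul_lt_top (ENNReal.mul_lt_top enorm_lt_top (measure_lt_top m univ))
      (Lp.eLpNorm_lt_top f)))

/-- The partially integral operator with kernel `k` on `L_{2,2}(Ω × S)`. -/
def op22 (k : Kernel μ m) : L22 μ m →L[ℂ] L22 μ m :=
  LinearMap.mkContinuous
    { toFun := fun f => ⟨integralOp k f.1, integralOp_memLp k f⟩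
      map_add' := fun f g => Subtype.ext
        (integralOp_add k (sections_memLp f) (sections_memLp g))
      map_smul' := fun c f => Subtype.ext (integralOp_const_smul k c f.1) }
    (‖k‖ * (m univ).toReal) (by
      intro f
      have h := ENNReal.toReal_mono (ENNReal.mul_ne_top
        (ENNReal.mul_ne_top enorm_ne_top (measure_ne_top m univ)) (Lp.eLpNorm_ne_top f))
        (eLpNorm_integralOp_le k f.1)
      rw [ENNReal.toReal_mul, ENNReal.toReal_mul, toReal_enorm] at h
      exact h)

/-- The kernel is Hermitian: `k(ω, t, s) = conj (k(ω, s, t))`. -/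
def IsHermitianKernel (k : Kernel μ m) : Prop :=
  ∀ᵐ z ∂(μ.prod (m.prod m)), k (z.1, z.2.1, z.2.2) = conj (k (z.1, z.2.2, z.2.1))

/-- The kernel is positive semidefinite: for all `x ∈ L_{2,2}(Ω × S)`, for almost every `ω`,
`∫∫ k(ω, t, s) x(ω, s) conj (x(ω, t)) dm(s) dm(t) ≥ 0`. -/
def IsPosSemidefKernel (k : Kernel μ m) : Prop :=
  ∀ x : L22 μ m, ∀ᵐ ω ∂μ,
    0 ≤ ∫ t, ∫ s, k (ω, t, s) * x (ω, s) * conj (x (ω, t)) ∂m ∂m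

/-- The values `⟨T x, x⟩` for `‖x‖ = 1`. -/
def numericalRange (k : Kernel μ m) : Set (L0h μ) :=
  {a | ∃ x : KH μ m, norm0 x = 1 ∧ ofReal0 a = inner0 (opKH k x) x}

/-! ### Expansions in eigenfunctions -/

/-- `λ_n ∈ L₀ʰ(Ω)` and `x_n` are eigenvalues and eigenfunctions of `T`, the `x_n(ω, ·)` are
orthonormal in `L₂(S)`, and `λ_n(ω) → 0`. -/
structure IsEigenSystem (k : Kernel μ m) (lam : ℕ → L0h μ) (x : ℕ → KH μ m) : Prop where
  eigen : ∀ n, opKH k (x n) = ofReal0 (lam n) • x n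
  orthonormal : ∀ i j, inner0 (x i) (x j) = if i = j then 1 else 0
  tendsto : ∀ᵐ ω ∂μ, Tendsto (fun n => lam n ω) atTop (𝓝 0)

/-- The partial sum `∑_{n < N} ⟨f, x_n⟩ x_n`. -/
def fourierSum (x : ℕ → KH μ m) (N : ℕ) (f : L22 μ m) : KH μ m :=
  ∑ n ∈ Finset.range N, inner0 (toKH f) (x n) • x n

/-- `T f = ∑ λ_n ⟨f, x_n⟩ x_n` with convergence in the norm of `L_{2,2}(Ω × S)`. -/
def HasEigenExpansion (k : Kernel μ m) (lam : ℕ → L0h μ) (x : ℕ → KH μ m) : Prop :=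
  ∀ f : L22 μ m, Tendsto (fun N => norm22 (toKH (op22 k f) -
    ∑ n ∈ Finset.range N, ofReal0 (lam n) • inner0 (toKH f) (x n) • x n)) atTop (𝓝 0)

/-- The eigenfunctions are complete in `L_{2,2}(Ω × S)`. -/
def IsCompleteSystem (x : ℕ → KH μ m) : Prop :=
  ∀ f : L22 μ m, Tendsto (fun N => norm22 (toKH f - fourierSum x N f)) atTop (𝓝 0)

/-- The family of orthogonal projections
`E_λ f = ∑_{n : λ_n(ω) ≤ λ(ω)} ⟨f, x_n⟩ x_n + χ_{0 ≤ λ} (f - ∑_n ⟨f, x_n⟩ x_n)`, `λ ∈ L₀ʰ(Ω)`.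
The last term vanishes if the `x_n` are complete; otherwise it accounts for the part of the
kernel of `T` that is orthogonal to all `x_n`. -/
def IsSpectralFamily (lam : ℕ → L0h μ) (x : ℕ → KH μ m)
    (E : L0h μ → L22 μ m →L[ℂ] L22 μ m) : Prop :=
  ∀ l : L0h μ, IsStarProjection (E l) ∧
    ∀ f : L22 μ m, Tendsto (fun N => norm22 (toKH (E l f) -
      ((∑ n ∈ Finset.range N, chiLe (lam n) l • inner0 (toKH f) (x n) • x n) +
        chiLe 0 l • (toKH f - fourierSum x N f)))) atTop (𝓝 0)

/-! ### Integrals with respect to a spectral family -/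

/-- `a = p 0 ≤ ξ 0 ≤ p 1 ≤ ξ 1 ≤ ... ≤ p n = b` is a tagged partition of the order interval
`[a, b]` in `L₀ʰ(Ω)` whose mesh is at most `δ`. -/
def IsTaggedPartition (a b : L0h μ) (δ : ℝ) (n : ℕ) (p ξ : ℕ → L0h μ) : Prop :=
  p 0 = a ∧ p n = b ∧
    ∀ i < n, p i ≤ ξ i ∧ ξ i ≤ p (i + 1) ∧ p (i + 1) ≤ p i + AEEqFun.const Ω δ

/-- The Riemann-Stieltjes sum `f(a) E_a g + ∑_i f(ξ_i) (E_{p (i+1)} - E_{p i}) g` over the closed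
order interval; the first term is the jump of the spectral family at the left end point `a`. -/
def stieltjesSum (f : ℝ → ℂ) (E : L0h μ → L22 μ m →L[ℂ] L22 μ m) (n : ℕ) (p ξ : ℕ → L0h μ)
    (g : L22 μ m) (z : Ω × S) : ℂ :=
  f (p 0 z.1) * E (p 0) g z +
    ∑ i ∈ Finset.range n, f (ξ i z.1) * (E (p (i + 1)) g - E (p i) g : L22 μ m) z

/-- `A = ∫_a^b f(λ) dE_λ`, as a limit of Riemann-Stieltjes sums in the strong operator topology
of `L_{2,2}(Ω × S)`. -/
def HasSpectralIntegral (f : ℝ → ℂ) (E : L0h μ → L22 μ m →L[ℂ] L22 μ m) (a b : L0h μ)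
    (A : L22 μ m →L[ℂ] L22 μ m) : Prop :=
  ∀ g : L22 μ m, ∀ η : ℝ, 0 < η → ∃ δ : ℝ, 0 < δ ∧
    ∀ (n : ℕ) (p ξ : ℕ → L0h μ), IsTaggedPartition a b δ n p ξ →
      eLpNorm (fun z => stieltjesSum f E n p ξ g z - A g z) 2 (μ.prod m) ≤ ENNReal.ofReal η

/-! ### Modular spectra -/

/-- `R` is `L₀`-bounded: `‖R u‖ ≤ c ‖u‖` for some `c ∈ L₀ʰ(Ω)`. -/
def IsL0Bounded (R : KH μ m →ₗ[L0 μ] KH μ m) : Prop :=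
  ∃ c : L0h μ, ∀ u, norm0 (R u) ≤ c * norm0 u

/-- `π A` is invertible in `π B`, where `B` is the algebra of `L₀`-linear `L₀`-bounded operators
and `π` is an idempotent of `L₀(Ω)`. -/
def IsInvertibleOn (π : L0 μ) (A : KH μ m →ₗ[L0 μ] KH μ m) : Prop :=
  ∃ R : KH μ m →ₗ[L0 μ] KH μ m, IsL0Bounded R ∧
    (π • A) ∘ₗ (π • R) = π • LinearMap.id ∧ (π • R) ∘ₗ (π • A) = π • LinearMap.id

/-- The modular spectrum `sp(A)`: all `λ ∈ L₀(Ω)` such that `A - λ I` is not invertible. -/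
def modularSpectrum (A : KH μ m →ₗ[L0 μ] KH μ m) : Set (L0 μ) :=
  {l | ¬ IsInvertibleOn 1 (A - l • LinearMap.id)}

/-- The cyclic modular spectrum `spm(A)`: all `λ ∈ sp(A)` such that `π (A - λ I)` is not
invertible in `π B` for any nonzero idempotent `π` of `L₀(Ω)`. -/
def cyclicSpectrum (A : KH μ m →ₗ[L0 μ] KH μ m) : Set (L0 μ) :=
  {l | l ∈ modularSpectrum A ∧
    ∀ π : L0 μ, IsIdempotentElem π → π ≠ 0 → ¬ IsInvertibleOn π (A - l • LinearMap.id)}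

/-- The discrete part of `spm(A)`, for a cyclically compact `A`: the `λ ∈ spm(A)` with
`λ(ω) ≠ 0` for almost every `ω`. -/
def discreteCyclicSpectrum (A : KH μ m →ₗ[L0 μ] KH μ m) : Set (L0 μ) :=
  {l | l ∈ cyclicSpectrum A ∧ ∀ᵐ ω ∂μ, l ω ≠ 0}

/-- Measurable partitions of `Ω` into countably many sets. -/
structure IsPartition (A : ℕ → Set Ω) : Prop where
  measurable : ∀ n, MeasurableSet (A n)
  disjoint : Pairwise (Function.onFun Disjoint A)
  cover : ⋃ n, A n = univ

/-- A submodule `N` is `σ`-finitely generated: there is a countable partition of unity `χ_{A n}`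
such that every `χ_{A n} N` is finitely generated over `L₀(Ω)`. -/
def IsSigmaFG (N : Submodule (L0 μ) (KH μ m)) : Prop :=
  ∃ (A : ℕ → Set Ω) (hA : IsPartition A),
    ∀ n, (N.map (LinearMap.lsmul (L0 μ) (KH μ m) (chi μ (A n) (hA.measurable n)))).FG

/-- All mixings `∑ χ_{A n} u_n` of elements `u_n ∈ K` with respect to partitions of unity
(which are countable, since the measure is finite). -/
def mix (K : Set (L0 μ)) : Set (L0 μ) :=
  {v | ∃ (A : ℕ → Set Ω) (u : ℕ → L0 μ), IsPartition A ∧ (∀ n, u n ∈ K) ∧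
    ∀ n, ∀ᵐ ω ∂μ, ω ∈ A n → v ω = u n ω}

/-- The functions `λ̃_0 = 0` and `λ̃_n = λ_n`, `n ≥ 1`. -/
def withZero (lam : ℕ → L0h μ) : ℕ → L0 μ
  | 0 => 0
  | n + 1 => ofReal0 (lam n)

/-- All sums `∑ χ_{A n} λ̃_n` with measurable and pairwise disjoint `A n`. -/
def disjointSums (v : ℕ → L0 μ) : Set (L0 μ) :=
  {u | ∃ A : ℕ → Set Ω, (∀ n, MeasurableSet (A n)) ∧ Pairwise (Function.onFun Disjoint A) ∧
    ∀ᵐ ω ∂μ, u ω = ∑' n, (A n).indicator (v n) ω}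

end Operator

end

end PartInt

/-! The module is studied through its fibers. A field `u` has fibers `fib u ω` in L₂(S), identities
between fields hold as soon as they hold in almost every fiber, and `T` acts on fibers by integral
operators `fibOp k ω`. Their Hilbert–Schmidt norms are bounded uniformly in `ω`, and they are
symmetric for almost every `ω`. The two difficulties are to choose eigenvectors measurably in `ω`
and to do so without separability of L₂(S).

Measurability comes from power iteration rather than from a selection theorem. For a symmetric
compact operator and `T f ≠ 0`, the normalized even iterates of `f` converge, along the full
sequence, to an eigenvector of `T²` (`tendsto_power_iteration`). Performed in all fibers at once
this is a sequence of fields, and its fiberwise limit is again a field (`exists_fib_limit`).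
Positivity of the kernel turns it into an eigenfield of `T` (`exists_eigenfield`). Its fibers have
norm zero or one, since `T f` may vanish on part of Ω.

Zorn's lemma yields a maximal orthogonal family of such eigenfields. It is countable because Bessel
and Hilbert–Schmidt sums, integrated over Ω, are finite (`countable_of_sum_le`). To keep the kernel
of `T` from contributing uncountably many fields, only fields orthogonal to the part of the kernel
not seen by a sequence of constant test fields are admitted. Infinite-dimensional span of the test
fields forces infinitely many nonzero fibers at almost every `ω`, so reading off the n-th nonzero
one gives honest orthonormal fields (`exists_eigen_basis`). When L₂(S) is separable the test fields
are dense and the system is complete.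

All the rest is calculus of diagonal operators. The relation `IsDiag` says that a vector arises from
another by multiplying the n-th coordinate by `a n` and the part orthogonal to the system by `c`; it
determines the vector and bounds its norm by the largest coefficient. The operator `T`, its
polynomials, the projections `E l`, the Riemann–Stieltjes sums and the inverses of `T - l` are all
of this kind, so each claim becomes a scalar statement about the numbers `lam n ω` and `0`. Since
`lam n ω → 0`, the infimum of the numerical range is `0`, the value `0` always belongs to the
spectrum, and a nonzero value is attained by finitely many `n` only. -/

namespace PartInt

/-! ### Hilbert–Schmidt compactness and power iteration. -/

section Hilbert

variable {H : Type*} [NormedAddCommGroup H] [InnerProductSpace ℂ H]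

/-- A pairwise orthogonal family of vectors of norm zero or one. -/
structure PartialOrthonormal {ι : Type*} (v : ι → H) : Prop where
  norm_eq : ∀ i, ‖v i‖ = 0 ∨ ‖v i‖ = 1
  inner_eq : Pairwise fun i j => inner ℂ (v i) (v j) = 0

theorem PartialOrthonormal.sum_sq_inner_le {ι : Type*} {v : ι → H} (hv : PartialOrthonormal v)
    (s : Finset ι) (x : H) : ∑ i ∈ s, ‖inner ℂ (v i) x‖ ^ 2 ≤ ‖x‖ ^ 2 := by
  classical
  let w : {i // ‖v i‖ = 1} → H := fun i => v i
  have hw : Orthonormal ℂ w :=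
    ⟨fun i => i.2, fun i j hij => hv.inner_eq fun h => hij (Subtype.ext h)⟩
  refine le_trans (le_of_eq ?_) (hw.sum_inner_products_le x (s := s.subtype fun i => ‖v i‖ = 1))
  rw [Finset.sum_subtype_eq_sum_filter (f := fun i => ‖inner ℂ (v i) x‖ ^ 2),
    Finset.sum_filter_of_ne]
  intro i _ hi
  refine (hv.norm_eq i).resolve_left fun h => hi ?_
  rw [norm_eq_zero.1 h]
  simp

/-- Take a finite orthonormal set `s` whose sum is within `ε ^ 2` of the supremum. A unit vector
orthogonal to `s` with a larger image than `ε` could be added to `s` and would exceed the supremum.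
Hence `T` composed with the projection onto the span of `s` is a finite-rank operator within `ε` of
`T`. No orthonormal basis enters. -/
theorem isCompactOperator_of_sum_sq_le [CompleteSpace H] (T : H →L[ℂ] H) (C : ℝ)
    (hT : ∀ s : Finset H, Orthonormal ℂ (Subtype.val : s → H) → ∑ v ∈ s, ‖T v‖ ^ 2 ≤ C) :
    IsCompactOperator T := by
  classical
  have key : ∀ ε : ℝ, 0 < ε → ∃ F : H →L[ℂ] H, IsCompactOperator F ∧ ‖T - F‖ ≤ ε := by
    intro ε hε
    let A : Set ℝ := {r | ∃ s : Finset H, Orthonormal ℂ (fun v : s => (v : H)) ∧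
      r = ∑ v ∈ s, ‖T v‖ ^ 2}
    have hA : BddAbove A := ⟨C, by rintro _ ⟨s, hs, rfl⟩; exact hT s hs⟩
    have hA0 : A.Nonempty := ⟨_, ∅, Orthonormal.of_isEmpty _, rfl⟩
    obtain ⟨_, ⟨s, hs, rfl⟩, hlt⟩ := exists_lt_of_lt_csSup hA0
      (show sSup A - ε ^ 2 < sSup A by linarith [pow_pos hε 2])
    have hunit : ∀ x : H, ‖x‖ = 1 → (∀ v ∈ s, inner ℂ v x = 0) → ‖T x‖ ≤ ε := by
      intro x hx hxs
      have hxn : x ∉ s := fun h => by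
        have := hxs x h
        rw [inner_self_eq_norm_sq_to_K, hx] at this
        norm_num at this
      have ho : Orthonormal ℂ (fun v : ↥(insert x s) => (v : H)) := by
        refine ⟨fun ⟨v, hv⟩ => ?_, fun ⟨v, hv⟩ ⟨w, hw⟩ hvw => ?_⟩
        · rcases Finset.mem_insert.1 hv with rfl | hv
          · exact hx
          · exact hs.1 ⟨v, hv⟩
        · have hvw' : v ≠ w := fun h => hvw (Subtype.ext h)
          change inner ℂ v w = 0
          rcases Finset.mem_insert.1 hv with rfl | hv1 <;>
            rcases Finset.mem_insert.1 hw with rfl | hw1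
          · exact absurd rfl hvw'
          · rw [← inner_conj_symm, hxs w hw1, map_zero]
          · exact hxs v hv1
          · exact hs.2 (i := ⟨v, hv1⟩) (j := ⟨w, hw1⟩) fun h => hvw' (congrArg Subtype.val h)
      have := le_csSup hA ⟨_, ho, rfl⟩
      rw [Finset.sum_insert hxn] at this
      exact abs_le_of_sq_le_sq' (by linarith) hε.le |>.2
    let U : Submodule ℂ H := Submodule.span ℂ (s : Set H)
    have : FiniteDimensional ℂ U := FiniteDimensional.span_finset ℂ s
    have hbound : ∀ x : H, (∀ v ∈ s, inner ℂ v x = 0) → ‖T x‖ ≤ ε * ‖x‖ := by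
      intro x hx
      by_cases h0 : x = 0
      · simp [h0]
      have h1 : ‖x‖ ≠ 0 := norm_ne_zero_iff.2 h0
      have := hunit ((‖x‖⁻¹ : ℂ) • x) (by rw [norm_smul]; simp [h1]) fun v hv => by
        rw [inner_smul_right, hx v hv, mul_zero]
      rw [map_smul, norm_smul] at this
      simp only [norm_inv, Complex.norm_real, norm_norm] at this
      rw [inv_mul_le_iff₀ (by positivity)] at this
      linarith
    refine ⟨T.comp U.starProjection, ?_, ?_⟩
    · have : ProperSpace U := FiniteDimensional.proper ℂ U
      have h1 : IsCompactOperator U.orthogonalProjectionOnto :=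
        isCompactOperator_of_locallyCompactSpace_dom _
      exact h1.clm_comp (T.comp U.subtypeL)
    · refine ContinuousLinearMap.opNorm_le_bound _ hε.le fun x => ?_
      have h1 : (T - T.comp U.starProjection) x = T (x - U.starProjection x) := by simp
      rw [h1]
      have h2 : ‖x - U.starProjection x‖ ≤ ‖x‖ := by
        have h4 : x - U.starProjection x = Uᗮ.starProjection x := by
          rw [Submodule.starProjection_orthogonal']; rfl
        rw [h4]
        exact Submodule.norm_starProjection_apply_le _ _
      refine (hbound _ fun v hv => ?_).trans (mul_le_mul_of_nonneg_left h2 hε.le)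
      exact (Submodule.mem_orthogonal _ _).1 (Submodule.sub_starProjection_mem_orthogonal x) v
        (Submodule.subset_span hv)
  choose F hF1 hF2 using fun n : ℕ => key (1 / ((n : ℝ) + 1)) (by positivity)
  refine isCompactOperator_of_tendsto (l := atTop) (F := F) ?_ (Eventually.of_forall hF1)
  rw [tendsto_iff_norm_sub_tendsto_zero]
  refine squeeze_zero (fun _ => norm_nonneg _) (fun n => ?_) tendsto_one_div_add_atTop_nhds_zero_nat
  rw [norm_sub_rev]
  exact hF2 n

/-- Power iteration for a compact symmetric operator. -/
theorem tendsto_power_iteration [CompleteSpace H] {T : H →L[ℂ] H}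
    (hsym : ∀ x y, inner ℂ (T x) y = inner ℂ x (T y)) (hcomp : IsCompactOperator T) {f : H}
    (hf : T f ≠ 0) :
    ∃ r : ℝ, 0 < r ∧ ∃ u : H, ‖u‖ = 1 ∧ T (T u) = ((r : ℂ) ^ 2) • u ∧
      Tendsto (fun n : ℕ => ((‖T^[2 * n] f‖⁻¹ : ℝ) : ℂ) • T^[2 * n] f) atTop (𝓝 u) := by
  let t : ℕ → ℝ := fun k => ‖T^[k] f‖
  have hit : ∀ k, T (T^[k] f) = T^[k + 1] f := fun k =>
    (Function.iterate_succ_apply' (⇑T) k f).symm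
  -- Log-convexity of the norms of the iterates, from symmetry and Cauchy–Schwarz. It makes the
  -- ratios `q` increasing and prevents any iterate from vanishing.
  have hstep : ∀ k, t (k + 1) ^ 2 ≤ t k * t (k + 2) := by
    intro k
    have h1 : inner ℂ (T^[k + 1] f) (T^[k + 1] f) = inner ℂ (T^[k] f) (T^[k + 2] f) := by
      conv_lhs => rw [← hit k, hsym, hit k, hit (k + 1)]
    have h2 := norm_inner_le_norm (𝕜 := ℂ) (T^[k] f) (T^[k + 2] f)
    rw [← h1, inner_self_eq_norm_sq_to_K] at h2
    simpa [t] using h2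
  have ht1 : 0 < t 1 := norm_pos_iff.2 hf
  have ht0 : 0 < t 0 := norm_pos_iff.2 fun h => hf (by
    have h' : f = 0 := h
    rw [h', map_zero])
  have hpos' : ∀ k, 0 < t k ∧ 0 < t (k + 1) := by
    intro k
    induction k with
    | zero => exact ⟨ht0, ht1⟩
    | succ k ih =>
      refine ⟨ih.2, ?_⟩
      have := hstep k
      by_contra! h
      have h3 : t k * t (k + 2) ≤ 0 := mul_nonpos_of_nonneg_of_nonpos ih.1.le h
      nlinarith [pow_pos ih.2 2]
  have hpos : ∀ k, 0 < t k := fun k => (hpos' k).1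
  let q : ℕ → ℝ := fun k => t (k + 1) / t k
  have hq0 : ∀ k, 0 < q k := fun k => div_pos (hpos _) (hpos _)
  have hqmono : Monotone q := monotone_nat_of_le_succ fun k => by
    rw [div_le_div_iff₀ (hpos _) (hpos _)]
    nlinarith [hstep k]
  have hqb : ∀ k, q k ≤ ‖T‖ := fun k => by
    rw [div_le_iff₀ (hpos _)]
    have := T.le_opNorm (T^[k] f)
    rwa [hit] at this
  have hqlim := tendsto_atTop_ciSup hqmono ⟨‖T‖, by rintro _ ⟨k, rfl⟩; exact hqb k⟩
  set r : ℝ := ⨆ k, q k with hr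
  have hqr : ∀ k, q k ≤ r := fun k => hqmono.ge_of_tendsto hqlim k
  have hr0 : 0 < r := (hq0 0).trans_le (hqr 0)
  let u : ℕ → H := fun n => ((‖T^[2 * n] f‖⁻¹ : ℝ) : ℂ) • T^[2 * n] f
  have hu1 : ∀ n, ‖u n‖ = 1 := fun n => by
    simp only [u, norm_smul, Complex.norm_real, norm_inv, norm_norm]
    exact inv_mul_cancel₀ (hpos (2 * n)).ne'
  have hTu : ∀ n, ‖T (u n)‖ = q (2 * n) := fun n => by
    simp only [u, map_smul, norm_smul, Complex.norm_real, norm_inv, norm_norm, hit, q, t]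
    rw [div_eq_inv_mul]
  have hTTu : ∀ n, ‖T (T (u n))‖ = q (2 * n) * q (2 * n + 1) := fun n => by
    simp only [u, map_smul, norm_smul, Complex.norm_real, norm_inv, norm_norm, hit, q]
    have h1 := (hpos (2 * n)).ne'
    have h2 := (hpos (2 * n + 1)).ne'
    simp only [t] at *
    field_simp
  have hq2 : Tendsto (fun n => q (2 * n)) atTop (𝓝 r) :=
    hqlim.comp (tendsto_id.const_mul_atTop' (by norm_num : (0 : ℕ) < 2))
  have hq3 : Tendsto (fun n => q (2 * n + 1)) atTop (𝓝 r) :=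
    (tendsto_add_atTop_iff_nat 1).2 hqlim |>.comp
      (tendsto_id.const_mul_atTop' (by norm_num : (0 : ℕ) < 2))
  -- The squared norm is an expression in the ratios with limit `r⁴ - 2r⁴ + r⁴ = 0`. Even iterates
  -- and `T²` are used because `T` is not assumed positive here and may have both eigenvalues `r`
  -- and `-r`.
  have hdiff : Tendsto (fun n => T (T (u n)) - ((r : ℂ) ^ 2) • u n) atTop (𝓝 0) := by
    have hsq : ∀ n, ‖T (T (u n)) - ((r : ℂ) ^ 2) • u n‖ ^ 2 =
        (q (2 * n) * q (2 * n + 1)) ^ 2 - 2 * (r ^ 2 * q (2 * n) ^ 2) + r ^ 4 := fun n => by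
      rw [@norm_sub_sq ℂ, hTTu, inner_smul_right, hsym, inner_self_eq_norm_sq_to_K, hTu, norm_smul,
        hu1]
      have : RCLike.re ((r : ℂ) ^ 2 * (((q (2 * n) : ℝ) : ℂ)) ^ 2) = r ^ 2 * q (2 * n) ^ 2 := by
        rw [← Complex.ofReal_pow, ← Complex.ofReal_pow, ← Complex.ofReal_mul]
        exact Complex.ofReal_re _
      erw [this]
      simp
      ring
    have h1 : Tendsto (fun n => ‖T (T (u n)) - ((r : ℂ) ^ 2) • u n‖ ^ 2) atTop (𝓝 0) := by
      simp_rw [hsq]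
      have := (((hq2.mul hq3).pow 2).sub (((hq2.pow 2).const_mul (r ^ 2)).const_mul 2)).add_const
        (r ^ 4)
      convert this using 2
      ring
    rw [tendsto_zero_iff_norm_tendsto_zero]
    have h2 := h1.sqrt
    simpa [Real.sqrt_sq (norm_nonneg _)] using h2
  obtain ⟨K, hK, hKsub⟩ := hcomp.image_closedBall_subset_compact (f := (T : H →ₗ[ℂ] H)) ‖T‖
  obtain ⟨v, -, φ, hφ, hv⟩ := hK.tendsto_subseq (x := fun n => T (T (u n))) fun n =>
    hKsub ⟨T (u n), by
      rw [mem_closedBall_zero_iff]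
      have := T.le_opNorm (u n)
      rwa [hu1, mul_one] at this, rfl⟩
  have hr2 : ((r : ℂ) ^ 2) ≠ 0 := pow_ne_zero _ (Complex.ofReal_ne_zero.2 hr0.ne')
  set w : H := ((r : ℂ) ^ 2)⁻¹ • v with hw
  have huw : Tendsto (fun n => u (φ n)) atTop (𝓝 w) := by
    have h1 := (hv.sub (hdiff.comp hφ.tendsto_atTop)).const_smul ((r : ℂ) ^ 2)⁻¹
    rw [sub_zero] at h1
    refine h1.congr fun n => ?_
    simp [smul_smul, hr2]
  have hw1 : ‖w‖ = 1 := tendsto_nhds_unique huw.norm (by simp [hu1])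
  have hTTw : T (T w) = ((r : ℂ) ^ 2) • w := by
    have h1 : Tendsto (fun n => T (T (u (φ n)))) atTop (𝓝 (T (T w))) :=
      ((T.continuous.comp T.continuous).tendsto w).comp huw
    rw [tendsto_nhds_unique h1 hv, hw, smul_smul, mul_inv_cancel₀ hr2, one_smul]
  have hinner : ∀ n, inner ℂ (T^[2 * n] f) w = (r : ℂ) ^ (2 * n) * inner ℂ f w := by
    intro n
    induction n with
    | zero => simp
    | succ n ih =>
      have h1 : T^[2 * (n + 1)] f = T (T (T^[2 * n] f)) := by rw [hit, hit]; rfl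
      rw [h1, hsym, hsym, hTTw, inner_smul_right, ih]
      ring
  -- Compactness has given convergence along a subsequence only, which in the application would
  -- depend on the fiber. Since `⟨u n, w⟩ = s n ⟨f, w⟩` with `s` monotone, the limit along the
  -- subsequence is the limit along the whole sequence.
  let s : ℕ → ℝ := fun n => r ^ (2 * n) / t (2 * n)
  have hsmono : Monotone s := monotone_nat_of_le_succ fun n => by
    have h1 : t (2 * n + 2) ≤ r ^ 2 * t (2 * n) := by
      have e1 := (div_le_iff₀ (hpos (2 * n))).1 (hqr (2 * n))
      have e2 := (div_le_iff₀ (hpos (2 * n + 1))).1 (hqr (2 * n + 1))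
      calc t (2 * n + 2) ≤ r * t (2 * n + 1) := e2
        _ ≤ r * (r * t (2 * n)) := by gcongr
        _ = _ := by ring
    rw [div_le_div_iff₀ (hpos _) (hpos _)]
    calc r ^ (2 * n) * t (2 * (n + 1)) ≤ r ^ (2 * n) * (r ^ 2 * t (2 * n)) := by
          gcongr
          exact h1
      _ = r ^ (2 * (n + 1)) * t (2 * n) := by ring
  have huin : ∀ n, inner ℂ (u n) w = (s n : ℂ) * inner ℂ f w := fun n => by
    simp only [u, inner_smul_left, hinner, s, t]
    rw [Complex.conj_ofReal]
    push_cast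
    ring
  have hsub : Tendsto (fun n => (s (φ n) : ℂ) * inner ℂ f w) atTop (𝓝 1) := by
    have := huw.inner (tendsto_const_nhds (x := w)) (𝕜 := ℂ)
    simp only [huin] at this
    rw [inner_self_eq_norm_sq_to_K, hw1] at this
    simpa using this
  have hfw : inner ℂ f w ≠ 0 := fun h => by
    rw [h] at hsub
    simp at hsub
  have hs1 : Tendsto s atTop (𝓝 (‖inner ℂ f w‖⁻¹)) := by
    rw [tendsto_iff_tendsto_subseq_of_monotone hsmono hφ.tendsto_atTop]
    have := hsub.norm.mul_const (‖inner ℂ f w‖⁻¹)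
    rw [norm_one, one_mul] at this
    refine this.congr fun n => ?_
    have h0 : 0 ≤ s (φ n) := div_nonneg (by positivity) (hpos _).le
    rw [norm_mul, Complex.norm_real, Real.norm_of_nonneg h0, mul_assoc,
      mul_inv_cancel₀ (norm_ne_zero_iff.2 hfw), mul_one]
    rfl
  have hs2 : Tendsto (fun n => inner ℂ (u n) w) atTop (𝓝 1) := by
    simp_rw [huin]
    have h1 : Tendsto (fun n => (s n : ℂ) * inner ℂ f w) atTop _ :=
      ((Complex.continuous_ofReal.tendsto _).comp hs1).mul_const _
    rwa [tendsto_nhds_unique hsub (h1.comp hφ.tendsto_atTop)]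
  refine ⟨r, hr0, w, hw1, hTTw, ?_⟩
  rw [tendsto_iff_norm_sub_tendsto_zero]
  have h1 : Tendsto (fun n => ‖u n - w‖ ^ 2) atTop (𝓝 0) := by
    have h2 : ∀ n, ‖u n - w‖ ^ 2 = 2 - 2 * Complex.re (inner ℂ (u n) w) := fun n => by
      rw [@norm_sub_sq ℂ, hu1, hw1]
      simp only [RCLike.re_eq_complex_re]
      ring
    simp_rw [h2]
    have := (((Complex.continuous_re.tendsto _).comp hs2).const_mul 2).const_sub 2
    simpa using this
  have h2 := h1.sqrt
  simp only [Real.sqrt_sq (norm_nonneg _), Real.sqrt_zero] at h2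
  exact h2

end Hilbert

end PartInt

namespace PartInt

/-! ### Diagonal operators with respect to an orthonormal sequence, and step functions. -/

section Diagonal

variable {H : Type*} [NormedAddCommGroup H] [InnerProductSpace ℂ H]

/-- `y` is the image of `h` under the operator with eigenvectors `v n`, eigenvalues `a n`, that is
multiplication by `c` on the orthogonal complement of the `v n`. -/
structure IsDiag (v : ℕ → H) (a : ℕ → ℂ) (c : ℂ) (h y : H) : Prop where
  inner_eq : ∀ n, inner ℂ (v n) y = a n * inner ℂ (v n) h
  inner_perp : ∀ w, (∀ n, inner ℂ (v n) w = 0) → inner ℂ w y = c * inner ℂ w h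

variable {v : ℕ → H} {a b : ℕ → ℂ} {c d : ℂ} {h h' y y' : H}

/-- The difference is orthogonal to every `v n`, so it may be used as the test vector `w` and is
then orthogonal to itself. -/
theorem IsDiag.unique (hy : IsDiag v a c h y) (hy' : IsDiag v a c h y') : y = y' := by
  have h1 : ∀ n, inner ℂ (v n) (y - y') = 0 := fun n => by
    rw [inner_sub_right, hy.inner_eq, hy'.inner_eq, sub_self]
  have h2 : inner ℂ (y - y') (y - y') = 0 := by
    rw [inner_sub_right (y - y') y y', hy.inner_perp _ h1, hy'.inner_perp _ h1, sub_self]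
  exact sub_eq_zero.1 (inner_self_eq_zero.1 h2)

theorem IsDiag.add (hy : IsDiag v a c h y) (hy' : IsDiag v a c h' y') :
    IsDiag v a c (h + h') (y + y') where
  inner_eq n := by rw [inner_add_right, inner_add_right, hy.inner_eq, hy'.inner_eq, mul_add]
  inner_perp w hw := by
    rw [inner_add_right, inner_add_right, hy.inner_perp w hw, hy'.inner_perp w hw, mul_add]

theorem IsDiag.smul (z : ℂ) (hy : IsDiag v a c h y) : IsDiag v a c (z • h) (z • y) where
  inner_eq n := by rw [inner_smul_right, inner_smul_right, hy.inner_eq]; ring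
  inner_perp w hw := by rw [inner_smul_right, inner_smul_right, hy.inner_perp w hw]; ring

theorem IsDiag.add_coeff (hy : IsDiag v a c h y) (hy' : IsDiag v b d h y') :
    IsDiag v (fun n => a n + b n) (c + d) h (y + y') where
  inner_eq n := by rw [inner_add_right, hy.inner_eq, hy'.inner_eq, add_mul]
  inner_perp w hw := by rw [inner_add_right, hy.inner_perp w hw, hy'.inner_perp w hw, add_mul]

theorem IsDiag.smul_coeff (z : ℂ) (hy : IsDiag v a c h y) :
    IsDiag v (fun n => z * a n) (z * c) h (z • y) where
  inner_eq n := by rw [inner_smul_right, hy.inner_eq, mul_assoc]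
  inner_perp w hw := by rw [inner_smul_right, hy.inner_perp w hw, mul_assoc]

theorem IsDiag.sub_coeff (hy : IsDiag v a c h y) (hy' : IsDiag v b d h y') :
    IsDiag v (fun n => a n - b n) (c - d) h (y - y') where
  inner_eq n := by rw [inner_sub_right, hy.inner_eq, hy'.inner_eq, sub_mul]
  inner_perp w hw := by rw [inner_sub_right, hy.inner_perp w hw, hy'.inner_perp w hw, sub_mul]

theorem isDiag_self (z : ℂ) : IsDiag v (fun _ => z) z h (z • h) where
  inner_eq n := by rw [inner_smul_right]
  inner_perp w hw := by rw [inner_smul_right]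

theorem IsDiag.comp (hy : IsDiag v a c h y) (hy' : IsDiag v b d y y') :
    IsDiag v (fun n => b n * a n) (d * c) h y' where
  inner_eq n := by rw [hy'.inner_eq, hy.inner_eq, mul_assoc]
  inner_perp w hw := by rw [hy'.inner_perp w hw, hy.inner_perp w hw, mul_assoc]

theorem IsDiag.congr (hy : IsDiag v a c h y) (hab : ∀ n, a n = b n) (hcd : c = d) :
    IsDiag v b d h y := by
  rw [← hcd, ← funext hab]
  exact hy

theorem isDiag_sum {ι : Type*} (s : Finset ι) (A : ι → ℕ → ℂ) (C : ι → ℂ) (Y : ι → H)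
    (hY : ∀ i ∈ s, IsDiag v (A i) (C i) h (Y i)) :
    IsDiag v (fun n => ∑ i ∈ s, A i n) (∑ i ∈ s, C i) h (∑ i ∈ s, Y i) where
  inner_eq n := by
    rw [inner_sum, Finset.sum_mul]
    exact Finset.sum_congr rfl fun i hi => (hY i hi).inner_eq n
  inner_perp w hw := by
    rw [inner_sum, Finset.sum_mul]
    exact Finset.sum_congr rfl fun i hi => (hY i hi).inner_perp w hw

/-- The partial sums of the expansion of a diagonal operator. -/
noncomputable def diagSum (v : ℕ → H) (a : ℕ → ℂ) (c : ℂ) (h : H) (N : ℕ) : H :=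
  (∑ n ∈ Finset.range N, (a n * inner ℂ (v n) h) • v n) +
    c • (h - ∑ n ∈ Finset.range N, inner ℂ (v n) h • v n)

/-- A truncated expansion is itself diagonal, with `a n` replaced by `c` from `N` on. General facts
about diagonal operators therefore apply to partial sums, in particular the norm bound needed for
dominated convergence. -/
theorem isDiag_diagSum (hv : Orthonormal ℂ v) (a : ℕ → ℂ) (c : ℂ) (h : H) (N : ℕ) :
    IsDiag v (fun n => if n < N then a n else c) c h (diagSum v a c h N) where
  inner_eq n := by
    have h1 : ∀ b : ℕ → ℂ, inner ℂ (v n) (∑ i ∈ Finset.range N, b i • v i) =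
        if n < N then b n else 0 := fun b => by
      split_ifs with hn
      · exact hv.inner_right_sum b (Finset.mem_range.2 hn)
      · rw [inner_sum]
        refine Finset.sum_eq_zero fun i hi => ?_
        rw [inner_smul_right, hv.inner_eq_zero, mul_zero]
        rintro rfl
        exact hn (Finset.mem_range.1 hi)
    rw [diagSum, inner_add_right, h1 (fun i => a i * inner ℂ (v i) h), inner_smul_right,
      inner_sub_right, h1 (fun i => inner ℂ (v i) h)]
    split_ifs <;> ring
  inner_perp w hw := by
    have h1 : ∀ b : ℕ → ℂ, inner ℂ w (∑ i ∈ Finset.range N, b i • v i) = 0 := fun b => by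
      rw [inner_sum]
      refine Finset.sum_eq_zero fun i hi => ?_
      rw [inner_smul_right, ← inner_conj_symm, hw, map_zero, mul_zero]
    rw [diagSum, inner_add_right, h1 (fun i => a i * inner ℂ (v i) h), inner_smul_right,
      inner_sub_right, h1 (fun i => inner ℂ (v i) h)]
    ring

theorem diagSum_eq (v : ℕ → H) (a : ℕ → ℂ) (c : ℂ) (h : H) (N : ℕ) :
    diagSum v a c h N =
      c • h + ∑ n ∈ Finset.range N, ((a n - c) * inner ℂ (v n) h) • v n := by
  simp only [diagSum, sub_mul, sub_smul, Finset.sum_sub_distrib, smul_sub, Finset.smul_sum,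
    smul_smul]
  abel

variable [CompleteSpace H]

theorem summable_smul_of_orthonormal (hv : Orthonormal ℂ v) {C : ℝ} (ha : ∀ n, ‖a n‖ ≤ C) (h : H) :
    Summable fun n => (a n * inner ℂ (v n) h) • v n := by
  have h1 := hv.orthogonalFamily.summable_iff_norm_sq_summable (fun n => a n * inner ℂ (v n) h)
  refine h1.2 (Summable.of_nonneg_of_le (fun _ => by positivity) (fun n => ?_)
    ((hv.inner_products_summable h).mul_left (C ^ 2)))
  rw [norm_mul, mul_pow]
  gcongr
  exact ha n

theorem exists_tendsto_diagSum (hv : Orthonormal ℂ v) {C : ℝ} (ha : ∀ n, ‖a n‖ ≤ C) (c : ℂ)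
    (h : H) : ∃ y, IsDiag v a c h y ∧ Tendsto (diagSum v a c h) atTop (𝓝 y) := by
  have hs := summable_smul_of_orthonormal hv (a := fun n => a n - c) (C := C + ‖c‖)
    (fun n => (norm_sub_le _ _).trans (by gcongr; exact ha n)) h
  have ht : Tendsto (diagSum v a c h) atTop
      (𝓝 (c • h + ∑' n, ((a n - c) * inner ℂ (v n) h) • v n)) := by
    refine (hs.hasSum.tendsto_sum_nat.const_add (c • h)).congr fun N => ?_
    rw [diagSum_eq]
  refine ⟨_, ⟨fun n => ?_, fun w hw => ?_⟩, ht⟩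
  · refine tendsto_nhds_unique ((tendsto_const_nhds (x := v n)).inner ht) ?_
    refine tendsto_const_nhds.congr' ?_
    filter_upwards [eventually_gt_atTop n] with N hN
    rw [(isDiag_diagSum hv a c h N).inner_eq, if_pos hN]
  · refine tendsto_nhds_unique ((tendsto_const_nhds (x := w)).inner ht) ?_
    refine tendsto_const_nhds.congr fun N => ?_
    rw [(isDiag_diagSum hv a c h N).inner_perp w hw]

theorem IsDiag.tendsto (hv : Orthonormal ℂ v) {C : ℝ} (ha : ∀ n, ‖a n‖ ≤ C)
    (hy : IsDiag v a c h y) : Tendsto (diagSum v a c h) atTop (𝓝 y) := by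
  obtain ⟨y', h1, h2⟩ := exists_tendsto_diagSum hv ha c h
  rwa [hy.unique h1]

/-- The adjoint of a diagonal operator has the conjugate coefficients: this is visible on partial
sums and passes to the limit. For real coefficients it is self-adjointness. -/
theorem IsDiag.inner_symm (hv : Orthonormal ℂ v) {C : ℝ} (ha : ∀ n, ‖a n‖ ≤ C)
    (hy : IsDiag v a c h y) (hy' : IsDiag v (fun n => conj (a n)) (conj c) h' y') :
    inner ℂ y' h = inner ℂ h' y := by
  have h1 := (hy.tendsto hv ha).inner (tendsto_const_nhds (x := h')) (𝕜 := ℂ)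
  have h2 := (tendsto_const_nhds (x := h)).inner
    (hy'.tendsto hv (C := C) fun n => by rw [RCLike.norm_conj]; exact ha n) (𝕜 := ℂ)
  have h3 := tendsto_nhds_unique h1 (h2.congr fun N => ?_)
  · rw [← inner_conj_symm, ← h3, inner_conj_symm]
  · simp only [diagSum_eq, inner_add_left, inner_add_right, inner_sum, sum_inner,
      inner_smul_left, inner_smul_right, map_mul, map_sub]
    congr 1
    refine Finset.sum_congr rfl fun n _ => ?_
    rw [inner_conj_symm]
    ring

/-- By Pythagoras, `h` and its partial sum split along the same mutually orthogonal pieces, each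
scaled by a factor of modulus at most `C`. Operator estimates over Ω are reduced to this bound in
each fiber. -/
theorem IsDiag.norm_le (hv : Orthonormal ℂ v) {C : ℝ} (ha : ∀ n, ‖a n‖ ≤ C) (hc : ‖c‖ ≤ C)
    (hy : IsDiag v a c h y) : ‖y‖ ≤ C * ‖h‖ := by
  have hC : 0 ≤ C := (norm_nonneg c).trans hc
  refine le_of_tendsto (hy.tendsto hv ha).norm (Eventually.of_forall fun N => ?_)
  have hpy : ∀ (b : ℕ → ℂ) (w : H), (∀ n, n < N → inner ℂ (v n) w = 0) →
      ‖(∑ n ∈ Finset.range N, b n • v n) + w‖ ^ 2 =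
        ∑ n ∈ Finset.range N, ‖b n‖ ^ 2 + ‖w‖ ^ 2 := fun b w hw => by
    have h0 : inner ℂ (∑ n ∈ Finset.range N, b n • v n) w = 0 := by
      rw [sum_inner]
      refine Finset.sum_eq_zero fun n hn => ?_
      rw [inner_smul_left, hw n (Finset.mem_range.1 hn), mul_zero]
    have h1 := norm_add_sq_eq_norm_sq_add_norm_sq_of_inner_eq_zero _ _ h0
    rw [sq, h1, ← sq, ← sq]
    congr 1
    have h2 := hv.inner_sum b b (Finset.range N)
    rw [inner_self_eq_norm_sq_to_K] at h2
    have h3 : ((‖∑ n ∈ Finset.range N, b n • v n‖ ^ 2 : ℝ) : ℂ) =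
        ((∑ n ∈ Finset.range N, ‖b n‖ ^ 2 : ℝ) : ℂ) := by
      push_cast
      refine h2.trans (Finset.sum_congr rfl fun n _ => ?_)
      exact RCLike.conj_mul (b n)
    exact_mod_cast h3
  set w : H := h - ∑ n ∈ Finset.range N, inner ℂ (v n) h • v n with hw
  have hw0 : ∀ n, n < N → inner ℂ (v n) w = 0 := fun n hn => by
    rw [hw, inner_sub_right, hv.inner_right_sum _ (Finset.mem_range.2 hn), sub_self]
  have e1 := hpy (fun n => a n * inner ℂ (v n) h) (c • w) fun n hn => by
    rw [inner_smul_right, hw0 n hn, mul_zero]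
  have e2 := hpy (fun n => inner ℂ (v n) h) w hw0
  have e3 : (∑ n ∈ Finset.range N, inner ℂ (v n) h • v n) + w = h := by
    rw [hw]
    abel
  rw [e3] at e2
  refine abs_le_of_sq_le_sq' ?_ (by positivity) |>.2
  rw [diagSum, e1, mul_pow, e2, mul_add, Finset.mul_sum]
  refine add_le_add (Finset.sum_le_sum fun n _ => ?_) ?_
  · rw [norm_mul, mul_pow]
    gcongr
    exact ha n
  · rw [norm_smul, mul_pow]
    gcongr

theorem norm_diagSum_le (hv : Orthonormal ℂ v) {C : ℝ} (ha : ∀ n, ‖a n‖ ≤ C) (hc : ‖c‖ ≤ C)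
    (h : H) (N : ℕ) : ‖diagSum v a c h N‖ ≤ C * ‖h‖ :=
  (isDiag_diagSum hv a c h N).norm_le hv (fun n => by split_ifs; exacts [ha n, hc]) hc

end Diagonal

/-- A step function that interpolates `F` with tags in a fine partition is close to `F`. -/
theorem norm_step_sub_le (F : ℝ → ℂ) {η δ : ℝ} (hF : ∀ s t, |s - t| ≤ δ → ‖F s - F t‖ ≤ η)
    (hδ : 0 ≤ δ) (n : ℕ) (p ξ : ℕ → ℝ)
    (hp : ∀ i < n, p i ≤ ξ i ∧ ξ i ≤ p (i + 1) ∧ p (i + 1) ≤ p i + δ) (t : ℝ) (h0 : p 0 ≤ t)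
    (hn : t ≤ p n) :
    ‖F (p 0) * (if t ≤ p 0 then 1 else 0) +
      ∑ i ∈ Finset.range n, F (ξ i) * ((if t ≤ p (i + 1) then 1 else 0) -
        (if t ≤ p i then 1 else 0)) - F t‖ ≤ η := by
  -- Before the partition passes `t` the partial sum is exactly zero; the one cell containing `t`
  -- contributes `F` at its tag; later cells contribute nothing. The bound in the induction is `0`
  -- before that cell and `η` after it, so errors do not accumulate.
  have key : ∀ k ≤ n, ‖F (p 0) * (if t ≤ p 0 then 1 else 0) +
      ∑ i ∈ Finset.range k, F (ξ i) * ((if t ≤ p (i + 1) then 1 else 0) -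
        (if t ≤ p i then 1 else 0)) - F t * (if t ≤ p k then 1 else 0)‖ ≤
        if t ≤ p k then η else 0 := by
    intro k
    induction k with
    | zero =>
      intro _
      rw [Finset.sum_range_zero, add_zero, ← sub_mul]
      split_ifs with h
      · rw [mul_one]
        exact hF _ _ (by rw [le_antisymm h h0, sub_self, abs_zero]; exact hδ)
      · simp
    | succ k ih =>
      intro hk
      have ih' := ih (by omega)
      obtain ⟨h1, h2, h3⟩ := hp k (by omega)
      rw [Finset.sum_range_succ]
      by_cases hA : t ≤ p k
      · have hB : t ≤ p (k + 1) := by linarith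
        simp only [hA, hB, if_true, mul_one, sub_self, mul_zero, add_zero] at ih' ⊢
        exact ih'
      · by_cases hB : t ≤ p (k + 1)
        · simp only [hA, hB, if_true, if_false, mul_one, mul_zero, sub_zero] at ih' ⊢
          have h4 := norm_le_zero_iff.1 ih'
          rw [← add_assoc, h4, zero_add]
          refine hF _ _ (abs_le.2 ⟨?_, ?_⟩) <;> linarith [not_le.1 hA]
        · simp only [hA, hB, if_false, mul_zero, sub_self, add_zero, sub_zero] at ih' ⊢
          exact ih'
  have := key n le_rfl
  rwa [if_pos hn, if_pos hn, mul_one] at this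

end PartInt

namespace PartInt

noncomputable section

variable {Ω S : Type*} [MeasurableSpace Ω] [MeasurableSpace S]
variable {μ : Measure Ω} {m : Measure S} [IsFiniteMeasure μ] [IsFiniteMeasure m]

/-! ### Fibers -/

open Classical in
/-- The fiber `u(ω, ·)` as an element of `L₂(S)`. -/
def fib (u : KH μ m) (ω : Ω) : Lp ℂ 2 m :=
  if h : MemLp (fun s => u.1 (ω, s)) 2 m then h.toLp _ else 0

theorem coeFn_fib (u : KH μ m) : ∀ᵐ ω ∂μ, ∀ᵐ s ∂m, fib u ω s = u.1 (ω, s) := by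
  filter_upwards [u.2] with ω h
  rw [fib, dif_pos h]
  exact h.coeFn_toLp

theorem KH_ext {u v : KH μ m} (h : ∀ᵐ ω ∂μ, fib u ω = fib v ω) : u = v := by
  apply Subtype.ext
  apply ext_sections
  filter_upwards [h, coeFn_fib u, coeFn_fib v] with ω h1 h2 h3
  filter_upwards [h2, h3] with s h4 h5
  rw [← h4, ← h5, h1]

/-- No measurability of `g` in `ω` is asked for, so a fiber may be identified with the result of any
construction made separately for each `ω`. -/
theorem fib_congr {u : KH μ m} {g : Ω → Lp ℂ 2 m} (h : ∀ᵐ ω ∂μ, ∀ᵐ s ∂m, u.1 (ω, s) = g ω s) :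
    ∀ᵐ ω ∂μ, fib u ω = g ω := by
  filter_upwards [h, coeFn_fib u] with ω h1 h2
  apply Lp.ext
  filter_upwards [h1, h2] with s h3 h4
  rw [h4, h3]

theorem fib_zero : ∀ᵐ ω ∂μ, fib (0 : KH μ m) ω = 0 := by
  apply fib_congr (g := fun _ => 0)
  filter_upwards [Measure.ae_ae_of_ae_prod
    (AEEqFun.coeFn_zero : ⇑(0 : Ω × S →ₘ[μ.prod m] ℂ) =ᵐ[μ.prod m] 0)] with ω h
  filter_upwards [h, Lp.coeFn_zero ℂ 2 m] with s h1 h2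
  rw [h2]
  exact h1

theorem fib_add (u v : KH μ m) : ∀ᵐ ω ∂μ, fib (u + v) ω = fib u ω + fib v ω := by
  apply fib_congr
  filter_upwards [Measure.ae_ae_of_ae_prod (AEEqFun.coeFn_add u.1 v.1), coeFn_fib u,
    coeFn_fib v] with ω h1 h2 h3
  filter_upwards [h1, h2, h3, Lp.coeFn_add (fib u ω) (fib v ω)] with s g1 g2 g3 g4
  rw [g4, Pi.add_apply, g2, g3]
  exact g1

theorem fib_smul (a : L0 μ) (u : KH μ m) : ∀ᵐ ω ∂μ, fib (a • u) ω = a ω • fib u ω := by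
  apply fib_congr (g := fun ω => a ω • fib u ω)
  filter_upwards [Measure.ae_ae_of_ae_prod (coeFn_L0_smul a u.1), coeFn_fib u] with ω h1 h2
  filter_upwards [h1, h2, Lp.coeFn_smul (a ω) (fib u ω)] with s g1 g2 g3
  rw [g3, Pi.smul_apply, g2, smul_eq_mul]
  exact g1

theorem fib_sub (u v : KH μ m) : ∀ᵐ ω ∂μ, fib (u - v) ω = fib u ω - fib v ω := by
  apply fib_congr
  filter_upwards [Measure.ae_ae_of_ae_prod (AEEqFun.coeFn_sub u.1 v.1), coeFn_fib u,
    coeFn_fib v] with ω h1 h2 h3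
  filter_upwards [h1, h2, h3, Lp.coeFn_sub (fib u ω) (fib v ω)] with s g1 g2 g3 g4
  rw [g4, Pi.sub_apply, g2, g3]
  exact g1

theorem fib_sum {ι : Type*} (s : Finset ι) (u : ι → KH μ m) :
    ∀ᵐ ω ∂μ, fib (∑ i ∈ s, u i) ω = ∑ i ∈ s, fib (u i) ω := by
  classical
  induction s using Finset.induction_on with
  | empty => simpa using fib_zero
  | insert i s hi ih =>
    rw [Finset.sum_insert hi]
    filter_upwards [fib_add (u i) (∑ j ∈ s, u j), ih] with ω h1 h2
    rw [h1, h2, Finset.sum_insert hi]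

theorem inner0_apply (x y : KH μ m) :
    ∀ᵐ ω ∂μ, inner0 x y ω = inner ℂ (fib y ω) (fib x ω) := by
  have h0 := AEEqFun.coeFn_mk (μ := μ) (fun ω => ∫ s, x.1 (ω, s) * conj (y.1 (ω, s)) ∂m)
    (AEStronglyMeasurable.integral_prod_right' (f := fun p => x.1 p * conj (y.1 p))
      (x.1.aestronglyMeasurable.mul
        (Complex.continuous_conj.comp_aestronglyMeasurable y.1.aestronglyMeasurable)))
  filter_upwards [h0, coeFn_fib x, coeFn_fib y] with ω h1 h2 h3
  refine h1.trans ?_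
  rw [L2.inner_def]
  refine integral_congr_ae ?_
  filter_upwards [h2, h3] with s h4 h5
  rw [← h4, ← h5]
  rfl

theorem norm0_apply (x : KH μ m) : ∀ᵐ ω ∂μ, norm0 x ω = ‖fib x ω‖ := by
  filter_upwards [inner0_apply x x, AEEqFun.coeFn_comp (fun z : ℂ => Real.sqrt z.re)
    (by fun_prop) (inner0 x x)] with ω h1 h2
  refine h2.trans ?_
  rw [Function.comp_apply, h1, inner_self_eq_norm_sq_to_K]
  have : (((‖fib x ω‖ : ℝ) : ℂ) ^ 2).re = ‖fib x ω‖ ^ 2 := by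
    rw [← Complex.ofReal_pow, Complex.ofReal_re]
  erw [this]
  exact Real.sqrt_sq (norm_nonneg _)

theorem ofReal0_apply (a : L0h μ) : ∀ᵐ ω ∂μ, ofReal0 a ω = (a ω : ℂ) :=
  AEEqFun.coeFn_comp (fun r : ℝ => (r : ℂ)) (by fun_prop) a

theorem chi_apply (A : Set Ω) (hA : MeasurableSet A) :
    ∀ᵐ ω ∂μ, chi μ A hA ω = A.indicator 1 ω :=
  AEEqFun.coeFn_mk _ _

/-- Read off from `norm0 u`. Measurability of `fib u` as a vector-valued function is never used,
which matters because L₂(S) may be nonseparable. -/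
theorem aemeasurable_enorm_fib (u : KH μ m) : AEMeasurable (fun ω => ‖fib u ω‖ₑ) μ := by
  refine (norm0 u).aestronglyMeasurable.aemeasurable.ennreal_ofReal.congr ?_
  filter_upwards [norm0_apply u] with ω h
  rw [h, ofReal_norm]

theorem eLpNorm_two_sq {α : Type*} [MeasurableSpace α] (ν : Measure α) (g : α → ℂ) :
    eLpNorm g 2 ν ^ 2 = ∫⁻ p, ‖g p‖ₑ ^ 2 ∂ν := by
  rw [eLpNorm_eq_lintegral_rpow_enorm_toReal (by norm_num) (by norm_num), ← ENNReal.rpow_natCast,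
    ← ENNReal.rpow_mul]
  norm_num

theorem norm22_sq (u : KH μ m) : norm22 u ^ 2 = ∫⁻ ω, ‖fib u ω‖ₑ ^ 2 ∂μ := by
  rw [norm22, eLpNorm_two_sq, lintegral_prod _ (u.1.aestronglyMeasurable.enorm.pow_const _)]
  refine lintegral_congr_ae ?_
  filter_upwards [coeFn_fib u] with ω h
  rw [Lp.enorm_def, eLpNorm_two_sq]
  refine lintegral_congr_ae ?_
  filter_upwards [h] with s hs
  rw [hs]

theorem exists_L22_of_norm22 (u : KH μ m) (h : norm22 u ≠ ∞) : ∃ f : L22 μ m, toKH f = u :=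
  ⟨⟨u.1, Lp.mem_Lp_iff_eLpNorm_lt_top.2 (lt_top_iff_ne_top.2 h)⟩, rfl⟩

theorem norm22_toKH (f : L22 μ m) : norm22 (toKH f) = ‖f‖ₑ := (Lp.enorm_def f).symm

theorem norm22_le_of_fib_le {u v : KH μ m} {C : ℝ} (hC : 0 ≤ C)
    (h : ∀ᵐ ω ∂μ, ‖fib u ω‖ ≤ C * ‖fib v ω‖) : norm22 u ≤ ENNReal.ofReal C * norm22 v := by
  rw [← ENNReal.pow_le_pow_left_iff (n := 2) (by norm_num), mul_pow, norm22_sq, norm22_sq,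
    ← lintegral_const_mul'' _ ((aemeasurable_enorm_fib v).pow_const 2)]
  refine lintegral_mono_ae ?_
  filter_upwards [h] with ω hω
  rw [← mul_pow, ← ofReal_norm, ← ofReal_norm, ← ENNReal.ofReal_mul hC]
  gcongr

theorem exists_L22_of_fib_le {u : KH μ m} {C : ℝ} (hC : 0 ≤ C) (f : L22 μ m)
    (h : ∀ᵐ ω ∂μ, ‖fib u ω‖ ≤ C * ‖fib (toKH f) ω‖) : ∃ g : L22 μ m, toKH g = u := by
  refine exists_L22_of_norm22 u ((norm22_le_of_fib_le hC h).trans_lt ?_).ne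
  rw [norm22_toKH]
  exact ENNReal.mul_lt_top ENNReal.ofReal_lt_top enorm_lt_top

theorem exists_L22_of_fib_bounded {u : KH μ m} {C : ℝ} (h : ∀ᵐ ω ∂μ, ‖fib u ω‖ ≤ C) :
    ∃ g : L22 μ m, toKH g = u := by
  refine exists_L22_of_norm22 u fun h0 => ?_
  have h1 : norm22 u ^ 2 ≤ ∫⁻ _, ENNReal.ofReal C ^ 2 ∂μ := by
    rw [norm22_sq]
    refine lintegral_mono_ae ?_
    filter_upwards [h] with ω hω
    rw [← ofReal_norm]
    gcongr
  rw [h0, lintegral_const] at h1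
  have h2 : ENNReal.ofReal C ^ 2 * μ univ < ∞ :=
    ENNReal.mul_lt_top (ENNReal.pow_lt_top ENNReal.ofReal_lt_top) (measure_lt_top μ univ)
  simp at h1
  exact h2.ne h1

/-- A measurable function as an element of `L₀(Ω)`. -/
def toL0 (μ : Measure Ω) (g : Ω → ℂ) (hg : Measurable g) : L0 μ :=
  AEEqFun.mk g hg.aestronglyMeasurable

theorem toL0_apply (g : Ω → ℂ) (hg : Measurable g) : ∀ᵐ ω ∂μ, toL0 μ g hg ω = g ω :=
  AEEqFun.coeFn_mk _ _

/-- Each element of the module is a multiple of an element whose fibers have norm at most one. -/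
theorem exists_scaled_L22 (u : KH μ m) : ∃ (a : L0 μ) (r : Ω → ℝ) (f : L22 μ m),
    (∀ ω, 0 < r ω) ∧ (∀ᵐ ω ∂μ, a ω = r ω) ∧ toKH f = a • u := by
  let r : Ω → ℝ := fun ω => (1 + |norm0 u ω|)⁻¹
  have hr : Measurable r := by
    have := (norm0 u).measurable
    fun_prop
  have hr0 : ∀ ω, 0 < r ω := fun ω => by positivity
  have ha := toL0_apply (μ := μ) (fun ω => (r ω : ℂ)) (by fun_prop)
  obtain ⟨f, hf⟩ := exists_L22_of_fib_bounded (u := toL0 μ (fun ω => (r ω : ℂ)) (by fun_prop) • u)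
    (C := 1) (by
      filter_upwards [ha, fib_smul (toL0 μ (fun ω => (r ω : ℂ)) (by fun_prop)) u, norm0_apply u]
        with ω h1 h2 h3
      rw [h2, h1, norm_smul, Complex.norm_real, Real.norm_of_nonneg (hr0 ω).le]
      simp only [r, h3, abs_norm]
      rw [inv_mul_le_iff₀ (by positivity)]
      linarith [norm_nonneg (fib u ω)])
  exact ⟨_, r, f, hr0, ha, hf⟩

end

end PartInt

namespace PartInt

noncomputable section

variable {S : Type*} [MeasurableSpace S] {m : Measure S} [IsFiniteMeasure m]

/-! ### Integral operators with bounded kernels -/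

section BoundedKernel

variable {κ : S × S → ℂ} {C : ℝ}

theorem memLp_row (hκ : StronglyMeasurable κ) (hC : ∀ z, ‖κ z‖ ≤ C) (t : S) :
    MemLp (fun s => conj (κ (t, s))) 2 m :=
  MemLp.of_bound (Complex.continuous_conj.comp_stronglyMeasurable
    (hκ.comp_measurable measurable_prodMk_left)).aestronglyMeasurable C
    (Eventually.of_forall fun s => by rw [RCLike.norm_conj]; exact hC _)

/-- The conjugate of the row `κ(t, ·)` of a bounded kernel. -/
def kernelRow (m : Measure S) [IsFiniteMeasure m] (hκ : StronglyMeasurable κ)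
    (hC : ∀ z, ‖κ z‖ ≤ C) (t : S) : Lp ℂ 2 m :=
  (memLp_row hκ hC t).toLp _

variable (hκ : StronglyMeasurable κ) (hC : ∀ z, ‖κ z‖ ≤ C)

/-- The bound `C √(m S)` on the rows of a kernel that is bounded by `C`. -/
def rowBound (m : Measure S) (C : ℝ) : ℝ :=
  (measureUnivNNReal m : ℝ) ^ ((2 : ℝ≥0∞).toReal⁻¹) * C

theorem rowBound_nonneg [Nonempty S] {κ : S × S → ℂ} (hC : ∀ z, ‖κ z‖ ≤ C) : 0 ≤ rowBound m C :=
  mul_nonneg (by positivity) ((norm_nonneg _).trans (hC (Classical.arbitrary _)))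

theorem norm_kernelRow_le (t : S) : ‖kernelRow m hκ hC t‖ ≤ rowBound m C := by
  refine Lp.norm_le_of_ae_bound ((norm_nonneg _).trans (hC (t, t))) ?_
  filter_upwards [(memLp_row (m := m) hκ hC t).coeFn_toLp] with s hs
  rw [kernelRow, hs, RCLike.norm_conj]
  exact hC _

theorem inner_kernelRow (t : S) (g : Lp ℂ 2 m) :
    inner ℂ (kernelRow m hκ hC t) g = ∫ s, κ (t, s) * g s ∂m := by
  rw [L2.inner_def]
  refine integral_congr_ae ?_
  filter_upwards [(memLp_row (m := m) hκ hC t).coeFn_toLp] with s hs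
  rw [kernelRow, hs]
  simp [mul_comm]

theorem stronglyMeasurable_inner_kernelRow (g : Lp ℂ 2 m) :
    StronglyMeasurable fun t => inner ℂ (kernelRow m hκ hC t) g := by
  simp_rw [inner_kernelRow]
  exact StronglyMeasurable.integral_prod_right' (f := fun p : S × S => κ p * g p.2)
    (hκ.mul ((Lp.stronglyMeasurable g).comp_measurable measurable_snd))

theorem norm_inner_kernelRow_le (g : Lp ℂ 2 m) (t : S) :
    ‖inner ℂ (kernelRow m hκ hC t) g‖ ≤ rowBound m C * ‖g‖ :=
  (norm_inner_le_norm _ _).trans (by gcongr; exact norm_kernelRow_le hκ hC t)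

theorem memLp_inner_kernelRow (g : Lp ℂ 2 m) :
    MemLp (fun t => inner ℂ (kernelRow m hκ hC t) g) 2 m :=
  MemLp.of_bound (stronglyMeasurable_inner_kernelRow hκ hC g).aestronglyMeasurable _
    (Eventually.of_forall (norm_inner_kernelRow_le hκ hC g))

/-- The integral operator on `L₂(S)` with a bounded kernel. -/
def kernelOp (m : Measure S) [IsFiniteMeasure m] (hκ : StronglyMeasurable κ)
    (hC : ∀ z, ‖κ z‖ ≤ C) : Lp ℂ 2 m →L[ℂ] Lp ℂ 2 m :=
  LinearMap.mkContinuous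
    { toFun := fun g => (memLp_inner_kernelRow hκ hC g).toLp _
      map_add' := fun f g => by
        rw [← MemLp.toLp_add]
        exact MemLp.toLp_congr _ _ (Eventually.of_forall fun t => inner_add_right _ _ _)
      map_smul' := fun c g => by
        rw [RingHom.id_apply, ← MemLp.toLp_const_smul]
        exact MemLp.toLp_congr _ _ (Eventually.of_forall fun t => inner_smul_right _ _ _) }
    ((measureUnivNNReal m : ℝ) ^ ((2 : ℝ≥0∞).toReal⁻¹) * rowBound m C) (fun g => by
      rw [mul_assoc]
      -- The bound `C` is known to be nonnegative only once the kernel has a value; for empty `S`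
      -- both sides vanish.
      rcases isEmpty_or_nonempty S with hS | hS
      · have : m = 0 := Measure.eq_zero_of_isEmpty m
        refine (le_of_eq ?_).trans (mul_nonneg (by positivity) (?_ : 0 ≤ rowBound m C * ‖g‖))
        · subst this
          exact norm_eq_zero.2 (Lp.ext (by simp [Filter.EventuallyEq]))
        · subst this
          have : measureUnivNNReal (0 : Measure S) = 0 := by simp
          rw [rowBound, this]
          norm_num
      refine Lp.norm_le_of_ae_bound (mul_nonneg (rowBound_nonneg hC) (norm_nonneg _)) ?_
      filter_upwards [(memLp_inner_kernelRow hκ hC g).coeFn_toLp] with t ht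
      refine (congrArg norm ht).trans_le (norm_inner_kernelRow_le hκ hC g t))

theorem coeFn_kernelOp (g : Lp ℂ 2 m) :
    ∀ᵐ t ∂m, kernelOp m hκ hC g t = inner ℂ (kernelRow m hκ hC t) g :=
  (memLp_inner_kernelRow hκ hC g).coeFn_toLp

/-- The Hilbert-Schmidt bound. -/
theorem sum_sq_kernelOp_le {ι : Type*} {v : ι → Lp ℂ 2 m} (hv : PartialOrthonormal v)
    (s : Finset ι) :
    ∑ i ∈ s, ‖kernelOp m hκ hC (v i)‖ ^ 2 ≤ rowBound m C ^ 2 * m.real univ := by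
  have h1 : ∀ i, ‖kernelOp m hκ hC (v i)‖ ^ 2 =
      ∫ t, ‖inner ℂ (kernelRow m hκ hC t) (v i)‖ ^ 2 ∂m := fun i => by
    have h2 := @inner_self_eq_norm_sq_to_K ℂ _ _ _ _ (kernelOp m hκ hC (v i))
    rw [L2.inner_def] at h2
    have h3 : (∫ t, inner ℂ (kernelOp m hκ hC (v i) t) (kernelOp m hκ hC (v i) t) ∂m : ℂ) =
        ((∫ t, ‖inner ℂ (kernelRow m hκ hC t) (v i)‖ ^ 2 ∂m : ℝ) : ℂ) := by
      rw [← integral_complex_ofReal]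
      refine integral_congr_ae ?_
      filter_upwards [coeFn_kernelOp hκ hC (v i)] with t ht
      rw [ht, inner_self_eq_norm_sq_to_K]
      push_cast
      rfl
    rw [h3] at h2
    exact Complex.ofReal_injective (by rw [Complex.ofReal_pow]; exact h2.symm)
  simp_rw [h1]
  rw [← integral_finsetSum]
  -- Bessel's inequality for the row at a fixed `t`; integrating over `t` gives the bound.
  · have h4 : ∀ t, ∑ i ∈ s, ‖inner ℂ (kernelRow m hκ hC t) (v i)‖ ^ 2 ≤ rowBound m C ^ 2 := by
      intro t
      simp_rw [norm_inner_symm (kernelRow m hκ hC t)]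
      refine (hv.sum_sq_inner_le s _).trans ?_
      gcongr
      exact norm_kernelRow_le hκ hC t
    refine (integral_mono_of_nonneg (Eventually.of_forall fun t => by positivity)
      (integrable_const (rowBound m C ^ 2)) (Eventually.of_forall h4)).trans ?_
    rw [integral_const, smul_eq_mul, mul_comm]
  · intro i _
    exact (memLp_two_iff_integrable_sq_norm
      (stronglyMeasurable_inner_kernelRow hκ hC (v i)).aestronglyMeasurable).1
      (memLp_inner_kernelRow hκ hC (v i))

theorem isCompactOperator_kernelOp : IsCompactOperator (kernelOp m hκ hC) :=
  isCompactOperator_of_sum_sq_le _ (rowBound m C ^ 2 * m.real univ) fun s hs => by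
    have := sum_sq_kernelOp_le (m := m) hκ hC (v := (Subtype.val : s → Lp ℂ 2 m))
      ⟨fun i => Or.inr (hs.1 i), hs.2⟩ Finset.univ
    rwa [Finset.sum_coe_sort s (fun v => ‖kernelOp m hκ hC v‖ ^ 2)] at this

/-- Fubini, which applies because the kernel is bounded and L₂ functions are integrable for a finite
measure. -/
theorem inner_kernelOp_symm (hsym : ∀ᵐ z ∂(m.prod m), κ (z.1, z.2) = conj (κ (z.2, z.1)))
    (g h : Lp ℂ 2 m) :
    inner ℂ (kernelOp m hκ hC g) h = inner ℂ g (kernelOp m hκ hC h) := by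
  have hg : Integrable g m := (Lp.memLp g).integrable (by norm_num)
  have hh : Integrable h m := (Lp.memLp h).integrable (by norm_num)
  have e1 : inner ℂ (kernelOp m hκ hC g) h = ∫ t, ∫ s, conj (κ (t, s) * g s) * h t ∂m ∂m := by
    rw [L2.inner_def]
    refine integral_congr_ae ?_
    filter_upwards [coeFn_kernelOp hκ hC g] with t ht
    rw [ht, inner_kernelRow, RCLike.inner_apply, ← integral_conj, ← integral_const_mul]
    simp_rw [mul_comm (h t)]
  have e2 : inner ℂ g (kernelOp m hκ hC h) = ∫ s, ∫ t, conj (g s) * (κ (s, t) * h t) ∂m ∂m := by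
    rw [L2.inner_def]
    refine integral_congr_ae ?_
    filter_upwards [coeFn_kernelOp hκ hC h] with t ht
    rw [ht, inner_kernelRow, RCLike.inner_apply, integral_const_mul, mul_comm]
  rw [e1, e2, integral_integral_swap]
  · refine integral_congr_ae ?_
    filter_upwards [Measure.ae_ae_of_ae_prod hsym] with s hs
    refine integral_congr_ae ?_
    filter_upwards [hs] with t ht
    change κ (s, t) = conj (κ (t, s)) at ht
    rw [ht, map_mul]
    ring
  · have h1 : Integrable (fun z : S × S => h z.1 * conj (g z.2)) (m.prod m) :=
      hh.mul_prod (f := fun t => h t) (g := fun s => conj (g s))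
        ((Complex.conjCLE : ℂ →L[ℝ] ℂ).integrable_comp hg)
    refine (h1.bdd_mul (c := C) (f := fun z => conj (κ z))
      (Complex.continuous_conj.comp_stronglyMeasurable hκ).aestronglyMeasurable
      (Eventually.of_forall fun z => by rw [RCLike.norm_conj]; exact hC z)).congr
      (Eventually.of_forall fun z => ?_)
    simp only [Function.uncurry, map_mul]
    ring

end BoundedKernel

/-! ### The fibers of the partially integral operator -/

variable {Ω : Type*} [MeasurableSpace Ω] {μ : Measure Ω} [IsFiniteMeasure μ]

open Classical in
/-- A version of the kernel that is bounded everywhere. -/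
def boundedKernel (k : Kernel μ m) (z : Ω × S × S) : ℂ := if ‖k z‖ ≤ ‖k‖ then k z else 0

theorem norm_boundedKernel_le (k : Kernel μ m) (z : Ω × S × S) : ‖boundedKernel k z‖ ≤ ‖k‖ := by
  rw [boundedKernel]
  split_ifs with h
  · exact h
  · simp

theorem stronglyMeasurable_boundedKernel (k : Kernel μ m) :
    StronglyMeasurable (boundedKernel k) :=
  StronglyMeasurable.ite ((Lp.stronglyMeasurable k).norm.measurable measurableSet_Iic)
    (Lp.stronglyMeasurable k) stronglyMeasurable_const

theorem boundedKernel_ae_eq (k : Kernel μ m) :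
    ∀ᵐ ω ∂μ, ∀ᵐ t ∂m, ∀ᵐ s ∂m, boundedKernel k (ω, t, s) = k (ω, t, s) := by
  filter_upwards [kernel_bound k] with ω h
  filter_upwards [h] with t h
  filter_upwards [h] with s h
  rw [boundedKernel, if_pos (enorm_le_iff_norm_le.1 h)]

/-- The integral operator on `L₂(S)` with kernel `k(ω, ·, ·)`. -/
def fibOp (k : Kernel μ m) (ω : Ω) : Lp ℂ 2 m →L[ℂ] Lp ℂ 2 m :=
  kernelOp m (κ := fun z => boundedKernel k (ω, z)) (C := ‖k‖)
    ((stronglyMeasurable_boundedKernel k).comp_measurable measurable_prodMk_left)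
    fun _ => norm_boundedKernel_le k _

theorem fib_opKH (k : Kernel μ m) (u : KH μ m) :
    ∀ᵐ ω ∂μ, fib (opKH k u) ω = fibOp k ω (fib u ω) := by
  apply fib_congr (g := fun ω => fibOp k ω (fib u ω))
  filter_upwards [coeFn_integralOp k u.1, coeFn_fib u, boundedKernel_ae_eq k] with ω h1 h2 h3
  filter_upwards [h1, h3, coeFn_kernelOp (m := m) (κ := fun z => boundedKernel k (ω, z))
    ((stronglyMeasurable_boundedKernel k).comp_measurable measurable_prodMk_left)
    (fun _ => norm_boundedKernel_le k _) (fib u ω)] with t g1 g3 g4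
  refine (show (opKH k u).1 (ω, t) = _ from g1).trans ?_
  rw [fibOp, g4, inner_kernelRow]
  refine integral_congr_ae ?_
  filter_upwards [h2, g3] with s a2 a3
  rw [a2, a3]

/-- The point is that `C` does not depend on `ω`: the sums can be integrated over Ω, and the
eigenvalues will be uniformly bounded. -/
theorem sum_sq_fibOp_le (k : Kernel μ m) : ∃ C : ℝ, 0 ≤ C ∧ ∀ (ω : Ω) {ι : Type*}
    {v : ι → Lp ℂ 2 m} (_ : PartialOrthonormal v) (s : Finset ι),
    ∑ i ∈ s, ‖fibOp k ω (v i)‖ ^ 2 ≤ C :=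
  ⟨rowBound m ‖k‖ ^ 2 * m.real univ, by positivity, fun _ _ _ hv s => sum_sq_kernelOp_le _ _ hv s⟩

theorem isCompactOperator_fibOp (k : Kernel μ m) (ω : Ω) : IsCompactOperator (fibOp k ω) :=
  isCompactOperator_kernelOp _ _

/-- Truncation by modulus respects the symmetry, since the two values of the kernel that are
compared have equal modulus. -/
theorem fibOp_symm {k : Kernel μ m} (hk : IsHermitianKernel k) :
    ∀ᵐ ω ∂μ, ∀ g h, inner ℂ (fibOp k ω g) h = inner ℂ g (fibOp k ω h) := by
  filter_upwards [Measure.ae_ae_of_ae_prod hk] with ω h g g'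
  refine inner_kernelOp_symm _ _ ?_ g g'
  filter_upwards [h] with z hz
  rw [boundedKernel, boundedKernel]
  change k (ω, z.1, z.2) = conj (k (ω, z.2, z.1)) at hz
  rw [hz, RCLike.norm_conj]
  split_ifs <;> simp

theorem toKH_op22 (k : Kernel μ m) (f : L22 μ m) : toKH (op22 k f) = opKH k (toKH f) := rfl

/-- The hypothesis tests only elements of `L22`, so `u` is multiplied by a strictly positive
function to land there, and the square of that function is divided out afterwards. The exceptional
null set depends on `u`; positivity is available for one field at a time. -/
theorem inner_fibOp_nonneg {k : Kernel μ m} (hpos : IsPosSemidefKernel k) (u : KH μ m) :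
    ∀ᵐ ω ∂μ, 0 ≤ inner ℂ (fib u ω) (fibOp k ω (fib u ω)) := by
  obtain ⟨a, r, f, hr, ha, hf⟩ := exists_scaled_L22 u
  have h0 := fib_smul a u
  rw [← hf] at h0
  filter_upwards [hpos f, ha, h0, coeFn_fib (toKH f), coeFn_integralOp k f.1, fib_opKH k (toKH f),
    coeFn_fib (opKH k (toKH f))] with ω h1 h2 h3 h4 h5 h6 h7
  have e1 : inner ℂ (fib (toKH f) ω) (fibOp k ω (fib (toKH f) ω)) =
      ∫ t, ∫ s, k (ω, t, s) * f (ω, s) * conj (f (ω, t)) ∂m ∂m := by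
    rw [← h6, L2.inner_def]
    refine integral_congr_ae ?_
    filter_upwards [h4, h5, h7] with t g4 g5 g7
    have g8 : (opKH k (toKH f)).1 (ω, t) = ∫ s, k (ω, t, s) * f (ω, s) ∂m := g5
    rw [g4, g7, g8, RCLike.inner_apply, ← integral_mul_const]
    rfl
  rw [← e1, h3, h2, map_smul, inner_smul_left, inner_smul_right, ← mul_assoc,
    Complex.conj_ofReal, ← Complex.ofReal_mul] at h1
  have h8 : (0 : ℂ) ≤ (((r ω * r ω)⁻¹ : ℝ) : ℂ) := by
    exact_mod_cast (inv_pos.2 (mul_pos (hr ω) (hr ω))).le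
  have h9 := mul_nonneg h8 h1
  rwa [← mul_assoc, ← Complex.ofReal_mul, inv_mul_cancel₀ (mul_pos (hr ω) (hr ω)).ne',
    Complex.ofReal_one, one_mul] at h9

end

end PartInt

namespace PartInt

noncomputable section

variable {Ω S : Type*} [MeasurableSpace Ω] [MeasurableSpace S]
variable {μ : Measure Ω} {m : Measure S} [IsFiniteMeasure μ] [IsFiniteMeasure m]

/-! ### Limits and gluing in the Kaplansky-Hilbert module -/

theorem norm22_sq_norm0 (u : KH μ m) :
    norm22 u ^ 2 = ∫⁻ ω, ENNReal.ofReal (norm0 u ω) ^ 2 ∂μ := by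
  rw [norm22_sq]
  refine lintegral_congr_ae ?_
  filter_upwards [norm0_apply u] with ω h
  rw [h, ofReal_norm]

theorem eLpNorm_norm0 (u : KH μ m) : eLpNorm (norm0 u) 2 μ = norm22 u := by
  rw [← (ENNReal.pow_right_strictMono (n := 2) (by norm_num)).injective.eq_iff]
  rw [norm22_sq, eLpNorm_eq_lintegral_rpow_enorm_toReal (by norm_num) (by norm_num),
    ← ENNReal.rpow_natCast, ← ENNReal.rpow_mul]
  norm_num
  refine lintegral_congr_ae ?_
  filter_upwards [norm0_apply u] with ω h
  rw [h, enorm_norm]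

theorem tendsto_norm22_zero {ι : Type*} [Countable ι] {l : Filter ι} [l.IsCountablyGenerated]
    (u : ι → KH μ m) (b : Ω → ℝ≥0∞) (hb : ∫⁻ ω, b ω ^ 2 ∂μ ≠ ∞)
    (hub : ∀ i, ∀ᵐ ω ∂μ, ‖fib (u i) ω‖ₑ ≤ b ω)
    (hlim : ∀ᵐ ω ∂μ, Tendsto (fun i => fib (u i) ω) l (𝓝 0)) :
    Tendsto (fun i => norm22 (u i)) l (𝓝 0) := by
  have h1 : Tendsto (fun i => ∫⁻ ω, ENNReal.ofReal (norm0 (u i) ω) ^ 2 ∂μ) l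
      (𝓝 (∫⁻ _, 0 ∂μ)) := by
    refine tendsto_lintegral_filter_of_dominated_convergence (fun ω => b ω ^ 2)
      (Eventually.of_forall fun i => ?_) (Eventually.of_forall fun i => ?_) hb ?_
    · exact (norm0 (u i)).measurable.ennreal_ofReal.pow_const 2
    · filter_upwards [norm0_apply (u i), hub i] with ω h2 h3
      rw [h2, ofReal_norm]
      gcongr
    · filter_upwards [hlim, ae_all_iff.2 fun i => norm0_apply (u i)] with ω h2 h3
      simp_rw [h3]
      have h4 := ENNReal.tendsto_ofReal h2.norm
      rw [norm_zero, ENNReal.ofReal_zero] at h4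
      have h5 := ENNReal.Tendsto.pow (n := 2) h4
      rwa [zero_pow (by norm_num)] at h5
  rw [lintegral_zero] at h1
  simp_rw [← norm22_sq_norm0] at h1
  have h2 := h1.ennrpow_const (1 / 2)
  rw [ENNReal.zero_rpow_of_pos (by norm_num)] at h2
  refine h2.congr fun i => ?_
  rw [← ENNReal.rpow_natCast, ← ENNReal.rpow_mul]
  norm_num

theorem tendsto_norm22_zero_of_le {ι : Type*} [Countable ι] {l : Filter ι}
    [l.IsCountablyGenerated] (u : ι → KH μ m) {C : ℝ} (f : L22 μ m)
    (hub : ∀ i, ∀ᵐ ω ∂μ, ‖fib (u i) ω‖ ≤ C * ‖fib (toKH f) ω‖)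
    (hlim : ∀ᵐ ω ∂μ, Tendsto (fun i => fib (u i) ω) l (𝓝 0)) :
    Tendsto (fun i => norm22 (u i)) l (𝓝 0) := by
  refine tendsto_norm22_zero u (fun ω => ENNReal.ofReal C * ‖fib (toKH f) ω‖ₑ) ?_ (fun i => ?_) hlim
  · simp_rw [mul_pow]
    rw [lintegral_const_mul'' _ ((aemeasurable_enorm_fib _).pow_const 2), ← norm22_sq,
      norm22_toKH]
    exact ENNReal.mul_ne_top (by simp) (by simp)
  · filter_upwards [hub i] with ω h
    rw [← ofReal_norm, ← ofReal_norm, ← ENNReal.ofReal_mul' (norm_nonneg _)]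
    exact ENNReal.ofReal_le_ofReal h

theorem toKH_sub (f g : L22 μ m) : toKH (f - g) = toKH f - toKH g := rfl

/-- Dominated convergence over Ω makes the sequence Cauchy in the complete space `L22`, and a
subsequence of an `L22`-convergent sequence converges in almost every fiber. Joint measurability of
the limit thus comes from completeness. -/
theorem exists_limit_of_bounded (f : ℕ → L22 μ m) {C : ℝ}
    (hb : ∀ n, ∀ᵐ ω ∂μ, ‖fib (toKH (f n)) ω‖ ≤ C)
    (h : ∀ᵐ ω ∂μ, ∃ v, Tendsto (fun n => fib (toKH (f n)) ω) atTop (𝓝 v)) :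
    ∃ g : L22 μ m, ∀ᵐ ω ∂μ, Tendsto (fun n => fib (toKH (f n)) ω) atTop (𝓝 (fib (toKH g) ω)) := by
  have h1 : Tendsto (fun p : ℕ × ℕ => norm22 (toKH (f p.1) - toKH (f p.2))) atTop (𝓝 0) := by
    refine tendsto_norm22_zero (l := (atTop : Filter (ℕ × ℕ))) _
      (fun _ => ENNReal.ofReal (C + C)) ?_ (fun p => ?_) ?_
    · rw [lintegral_const]
      exact ENNReal.mul_ne_top (by simp) (measure_ne_top μ univ)
    · filter_upwards [hb p.1, hb p.2, fib_sub (toKH (f p.1)) (toKH (f p.2))] with ω h1 h2 h3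
      rw [h3, ← ofReal_norm]
      exact ENNReal.ofReal_le_ofReal ((norm_sub_le _ _).trans (add_le_add h1 h2))
    · filter_upwards [h, ae_all_iff.2 fun p : ℕ × ℕ => fib_sub (toKH (f p.1)) (toKH (f p.2))]
        with ω ⟨v, hv⟩ h3
      simp_rw [h3]
      have h4 : Tendsto (fun p : ℕ × ℕ => fib (toKH (f p.1)) ω - fib (toKH (f p.2)) ω)
          (atTop ×ˢ atTop) (𝓝 (v - v)) := (hv.comp tendsto_fst).sub (hv.comp tendsto_snd)
      rwa [sub_self, prod_atTop_atTop_eq] at h4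
  have h2 : CauchySeq f := by
    rw [EMetric.cauchySeq_iff']
    intro ε hε
    have h3 := (h1.eventually (gt_mem_nhds hε))
    rw [eventually_atTop] at h3
    obtain ⟨⟨a, b⟩, h3⟩ := h3
    refine ⟨max a b, fun n hn => ?_⟩
    have h4 := h3 (n, max a b) ⟨(le_max_left a b).trans hn, le_max_right a b⟩
    rwa [← toKH_sub, norm22_toKH, ← edist_eq_enorm_sub] at h4
  obtain ⟨g, hg⟩ := cauchySeq_tendsto_of_complete h2
  have h3 : Tendsto (fun n => norm22 (toKH (f n) - toKH g)) atTop (𝓝 0) := by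
    simp_rw [← toKH_sub, norm22_toKH, ← edist_eq_enorm_sub]
    exact tendsto_iff_edist_tendsto_0.1 hg
  have h4 : TendstoInMeasure μ (fun n => ⇑(norm0 (toKH (f n) - toKH g))) atTop (0 : Ω → ℝ) := by
    refine tendstoInMeasure_of_tendsto_eLpNorm (p := 2) (by norm_num)
      (fun n => (norm0 _).aestronglyMeasurable) aestronglyMeasurable_zero ?_
    simp_rw [sub_zero, eLpNorm_norm0]
    exact h3
  obtain ⟨φ, hφ, h5⟩ := h4.exists_seq_tendsto_ae
  refine ⟨g, ?_⟩
  filter_upwards [h, h5, ae_all_iff.2 fun n => norm0_apply (toKH (f n) - toKH g),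
    ae_all_iff.2 fun n => fib_sub (toKH (f n)) (toKH g)] with ω ⟨v, hv⟩ h6 h7 h8
  simp_rw [h7, h8] at h6
  have h9 := tendsto_iff_norm_sub_tendsto_zero.2 h6
  rwa [tendsto_nhds_unique h9 (hv.comp hφ.tendsto_atTop)]

/-- Sequences with convergent fibers have a limit. -/
theorem exists_fib_limit (u : ℕ → KH μ m)
    (h : ∀ᵐ ω ∂μ, ∃ v, Tendsto (fun n => fib (u n) ω) atTop (𝓝 v)) :
    ∃ w : KH μ m, ∀ᵐ ω ∂μ, Tendsto (fun n => fib (u n) ω) atTop (𝓝 (fib w ω)) := by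
  -- Convergent fibers are bounded in norm, so `c` is finite almost everywhere. Scaling by `(1 +
  -- c)⁻¹` reduces to fibers of norm at most one, and the scaling is undone at the end.
  let c : Ω → ℝ≥0∞ := fun ω => ⨆ n, ENNReal.ofReal (norm0 (u n) ω)
  have hc : Measurable c := Measurable.iSup fun n => (norm0 (u n)).measurable.ennreal_ofReal
  let r : Ω → ℝ := fun ω => (1 + (c ω).toReal)⁻¹
  have hr : Measurable r := (hc.ennreal_toReal.const_add 1).inv
  have hr0 : ∀ ω, 0 < r ω := fun ω => by positivity
  have hrc : Measurable fun ω => ((r ω : ℝ) : ℂ) := by fun_prop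
  have hric : Measurable fun ω => (((r ω)⁻¹ : ℝ) : ℂ) := by fun_prop
  have hcb : ∀ᵐ ω ∂μ, ∀ n, ‖fib (u n) ω‖ ≤ (c ω).toReal := by
    filter_upwards [h, ae_all_iff.2 fun n => norm0_apply (u n)] with ω ⟨v, hv⟩ h2 n
    have hbdd : BddAbove (range fun n => ‖fib (u n) ω‖) := hv.norm.bddAbove_range
    obtain ⟨B, hB⟩ := hbdd
    have hfin : c ω ≠ ∞ := by
      refine ((iSup_le fun n => ?_).trans_lt (ENNReal.ofReal_lt_top (r := B))).ne
      rw [h2]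
      exact ENNReal.ofReal_le_ofReal (hB ⟨n, rfl⟩)
    rw [← h2 n]
    refine (ENNReal.ofReal_le_iff_le_toReal hfin).1 ?_
    exact le_iSup (fun n => ENNReal.ofReal (norm0 (u n) ω)) n
  have hb : ∀ n, ∀ᵐ ω ∂μ, ‖fib (toL0 μ _ hrc • u n) ω‖ ≤ 1 := fun n => by
    filter_upwards [hcb, toL0_apply (μ := μ) _ hrc, fib_smul (toL0 μ _ hrc) (u n)] with ω h1 h2 h3
    rw [h3, h2, norm_smul, Complex.norm_real, Real.norm_of_nonneg (hr0 ω).le]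
    simp only [r]
    rw [inv_mul_le_iff₀ (by positivity)]
    linarith [h1 n]
  choose f hf using fun n => exists_L22_of_fib_bounded (hb n)
  have hfib : ∀ᵐ ω ∂μ, ∀ n, fib (toKH (f n)) ω = ((r ω : ℝ) : ℂ) • fib (u n) ω := by
    filter_upwards [toL0_apply (μ := μ) _ hrc,
      ae_all_iff.2 fun n => fib_smul (toL0 μ _ hrc) (u n)] with ω h2 h3 n
    rw [hf, h3, h2]
  obtain ⟨g, hg⟩ := exists_limit_of_bounded f (fun n => by rw [hf]; exact hb n) (by
    filter_upwards [h, hfib] with ω ⟨v, hv⟩ h2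
    simp_rw [h2]
    exact ⟨_, hv.const_smul _⟩)
  refine ⟨toL0 μ _ hric • toKH g, ?_⟩
  filter_upwards [hg, hfib, toL0_apply (μ := μ) _ hric, fib_smul (toL0 μ _ hric) (toKH g)]
    with ω h1 h2 h3 h4
  rw [h4, h3]
  refine (h1.const_smul (((r ω)⁻¹ : ℝ) : ℂ)).congr fun n => ?_
  rw [h2, smul_smul, ← Complex.ofReal_mul, inv_mul_cancel₀ (hr0 ω).ne', Complex.ofReal_one,
    one_smul]

/-- Fibers of a sequence of elements can be selected by a measurable function. -/
theorem exists_glue (N : Ω → ℕ) (hN : Measurable N) (u : ℕ → KH μ m) :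
    ∃ w : KH μ m, ∀ᵐ ω ∂μ, fib w ω = fib (u (N ω)) ω := by
  have h1 : Measurable fun p : Ω × S => (u (N p.1)).1 p := by
    have h2 : Measurable fun q : ℕ × (Ω × S) => (u q.1).1 q.2 :=
      measurable_from_prod_countable_right fun n => (u n).1.measurable
    exact h2.comp ((hN.comp measurable_fst).prodMk measurable_id)
  let F : Ω × S →ₘ[μ.prod m] ℂ := AEEqFun.mk _ h1.aestronglyMeasurable
  have hF : ∀ᵐ ω ∂μ, ∀ᵐ s ∂m, F (ω, s) = (u (N ω)).1 (ω, s) :=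
    Measure.ae_ae_of_ae_prod (AEEqFun.coeFn_mk _ _)
  refine ⟨⟨F, ?_⟩, ?_⟩
  · filter_upwards [hF, ae_all_iff.2 fun n => (u n).2] with ω h2 h3
    exact (memLp_congr_ae h2).2 (h3 (N ω))
  · apply fib_congr (g := fun ω => fib (u (N ω)) ω)
    filter_upwards [hF, ae_all_iff.2 fun n => coeFn_fib (u n)] with ω h2 h3
    filter_upwards [h2, h3 (N ω)] with s h4 h5
    rw [h5]
    exact h4

theorem exists_const_fib (e : Lp ℂ 2 m) : ∃ u : KH μ m, ∀ᵐ ω ∂μ, fib u ω = e := by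
  let F : Ω × S →ₘ[μ.prod m] ℂ :=
    AEEqFun.mk (fun p => e p.2) ((Lp.stronglyMeasurable e).comp_measurable
      measurable_snd).aestronglyMeasurable
  have hF : ∀ᵐ ω ∂μ, ∀ᵐ s ∂m, F (ω, s) = e s :=
    Measure.ae_ae_of_ae_prod (AEEqFun.coeFn_mk _ _)
  refine ⟨⟨F, ?_⟩, fib_congr (g := fun _ => e) hF⟩
  filter_upwards [hF] with ω h2
  exact (memLp_congr_ae h2).2 (Lp.memLp e)

end

end PartInt

namespace PartInt

noncomputable section

variable {Ω S : Type*} [MeasurableSpace Ω] [MeasurableSpace S]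
variable {μ : Measure Ω} {m : Measure S} [IsFiniteMeasure μ] [IsFiniteMeasure m]

/-! ### Eigenfields -/

theorem eq_zero_iff_fib {u : KH μ m} : u = 0 ↔ ∀ᵐ ω ∂μ, fib u ω = 0 := by
  constructor
  · rintro rfl
    exact fib_zero
  · intro h
    apply KH_ext
    filter_upwards [h, fib_zero (μ := μ) (m := m)] with ω h1 h2
    rw [h1, h2]

theorem inner0_eq_zero_iff {x y : KH μ m} :
    inner0 x y = 0 ↔ ∀ᵐ ω ∂μ, inner ℂ (fib y ω) (fib x ω) = 0 := by
  constructor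
  · intro h
    filter_upwards [inner0_apply x y, (AEEqFun.coeFn_zero : ⇑(0 : L0 μ) =ᵐ[μ] 0)] with ω h1 h2
    rw [← h1, h, h2, Pi.zero_apply]
  · intro h
    apply AEEqFun.ext
    filter_upwards [inner0_apply x y, h, (AEEqFun.coeFn_zero : ⇑(0 : L0 μ) =ᵐ[μ] 0)]
      with ω h1 h2 h3
    rw [h1, h2, h3, Pi.zero_apply]

theorem inner0_comm_zero {x y : KH μ m} (h : inner0 x y = 0) : inner0 y x = 0 := by
  rw [inner0_eq_zero_iff] at h ⊢
  filter_upwards [h] with ω h1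
  rw [← inner_conj_symm, h1, map_zero]

theorem inner0_smul_left_zero {x y : KH μ m} (a : L0 μ) (h : inner0 x y = 0) :
    inner0 (a • x) y = 0 := by
  rw [inner0_eq_zero_iff] at h ⊢
  filter_upwards [h, fib_smul a x] with ω h1 h2
  rw [h2, inner_smul_right, h1, mul_zero]

theorem inner0_sub_left_zero {x x' y : KH μ m} (h : inner0 x y = 0) (h' : inner0 x' y = 0) :
    inner0 (x - x') y = 0 := by
  rw [inner0_eq_zero_iff] at h h' ⊢
  filter_upwards [h, h', fib_sub x x'] with ω h1 h2 h3
  rw [h3, inner_sub_right, h1, h2, sub_zero]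

theorem inner0_sum_left_zero {ι : Type*} (s : Finset ι) (x : ι → KH μ m) {y : KH μ m}
    (h : ∀ i ∈ s, inner0 (x i) y = 0) : inner0 (∑ i ∈ s, x i) y = 0 := by
  rw [inner0_eq_zero_iff]
  have h' : ∀ᵐ ω ∂μ, ∀ i ∈ s, inner ℂ (fib y ω) (fib (x i) ω) = 0 :=
    (ae_ball_iff s.countable_toSet).2 fun i hi => inner0_eq_zero_iff.1 (h i hi)
  filter_upwards [h', fib_sum s x] with ω h1 h2
  rw [h2, inner_sum]
  exact Finset.sum_eq_zero h1

theorem eq_zero_of_inner0_self {x : KH μ m} (h : inner0 x x = 0) : x = 0 := by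
  rw [eq_zero_iff_fib]
  filter_upwards [inner0_eq_zero_iff.1 h] with ω h1
  exact inner_self_eq_zero.1 h1

theorem inner0_opKH_left {k : Kernel μ m} (hk : IsHermitianKernel k) (x y : KH μ m) :
    inner0 (opKH k x) y = inner0 x (opKH k y) := by
  apply AEEqFun.ext
  filter_upwards [inner0_apply (opKH k x) y, inner0_apply x (opKH k y), fib_opKH k x,
    fib_opKH k y, fibOp_symm hk] with ω h1 h2 h3 h4 h5
  rw [h1, h2, h3, h4, h5]

theorem fib_opKH_iterate (k : Kernel μ m) (u : KH μ m) :
    ∀ᵐ ω ∂μ, ∀ n, fib ((opKH k)^[n] u) ω = (fibOp k ω)^[n] (fib u ω) := by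
  filter_upwards [ae_all_iff.2 fun n => fib_opKH k ((opKH k)^[n] u)] with ω h n
  induction n with
  | zero => rfl
  | succ n ih => rw [Function.iterate_succ_apply', h, ih, Function.iterate_succ_apply']

/-- The fibers have norm zero or one. -/
def IsPartialUnit (u : KH μ m) : Prop := ∀ᵐ ω ∂μ, ‖fib u ω‖ = 0 ∨ ‖fib u ω‖ = 1

/-- The inverse of the norm, with value zero where the norm vanishes. -/
def invNorm (u : KH μ m) : L0 μ :=
  toL0 μ (fun ω => (((norm0 u ω)⁻¹ : ℝ) : ℂ)) (by
    have := (norm0 u).measurable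
    fun_prop)

theorem fib_invNorm_smul (u : KH μ m) :
    ∀ᵐ ω ∂μ, fib (invNorm u • u) ω = ((‖fib u ω‖⁻¹ : ℝ) : ℂ) • fib u ω := by
  filter_upwards [fib_smul (invNorm u) u, toL0_apply (μ := μ) (fun ω => (((norm0 u ω)⁻¹ : ℝ) : ℂ))
    (by have := (norm0 u).measurable; fun_prop), norm0_apply u] with ω h1 h2 h3
  rw [h1, invNorm, h2, h3]

theorem isPartialUnit_invNorm_smul (u : KH μ m) : IsPartialUnit (invNorm u • u) := by
  filter_upwards [fib_invNorm_smul u] with ω h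
  rw [h, norm_smul, Complex.norm_real, norm_inv, norm_norm]
  by_cases h0 : ‖fib u ω‖ = 0
  · left; rw [h0, mul_zero]
  · right; exact inv_mul_cancel₀ h0

theorem eq_smul_invNorm_smul (u : KH μ m) : ofReal0 (norm0 u) • invNorm u • u = u := by
  apply KH_ext
  filter_upwards [fib_smul (ofReal0 (norm0 u)) (invNorm u • u), fib_invNorm_smul u,
    ofReal0_apply (norm0 u), norm0_apply u] with ω h1 h2 h3 h4
  rw [h1, h2, h3, h4, smul_smul, ← Complex.ofReal_mul]
  by_cases h0 : ‖fib u ω‖ = 0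
  · rw [norm_eq_zero.1 h0, smul_zero]
  · rw [mul_inv_cancel₀ h0, Complex.ofReal_one, one_smul]

/-- If `T f ≠ 0` then the closed `T`-invariant submodule generated by `f` contains an eigenfield. -/
theorem exists_eigenfield {k : Kernel μ m} (hk : IsHermitianKernel k)
    (hpos : IsPosSemidefKernel k) {f : KH μ m} (hf : opKH k f ≠ 0) :
    ∃ (y : KH μ m) (l : L0h μ), y ≠ 0 ∧ IsPartialUnit y ∧ opKH k y = ofReal0 l • y ∧
      ∀ g : KH μ m, (∀ n, inner0 ((opKH k)^[n] f) g = 0) → inner0 y g = 0 := by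
  let u : ℕ → KH μ m := fun n => invNorm ((opKH k)^[2 * n] f) • (opKH k)^[2 * n] f
  have hu : ∀ᵐ ω ∂μ, ∀ n, fib (u n) ω =
      ((‖(fibOp k ω)^[2 * n] (fib f ω)‖⁻¹ : ℝ) : ℂ) • (fibOp k ω)^[2 * n] (fib f ω) := by
    filter_upwards [ae_all_iff.2 fun n => fib_invNorm_smul ((opKH k)^[2 * n] f),
      fib_opKH_iterate k f] with ω h1 h2 n
    rw [h1, h2]
  -- Where `T f` vanishes, all iterates from the first on are zero and the limit is zero. This is
  -- why eigenfields are only partial units.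
  have hlim0 : ∀ᵐ ω ∂μ, fibOp k ω (fib f ω) = 0 → Tendsto (fun n => fib (u n) ω) atTop (𝓝 0) := by
    filter_upwards [hu] with ω h1 h2
    refine tendsto_const_nhds.congr' ?_
    filter_upwards [eventually_ge_atTop 1] with n hn
    obtain ⟨j, rfl⟩ := Nat.exists_eq_add_of_le' hn
    have h3 : (fibOp k ω)^[2 * (j + 1)] (fib f ω) = 0 := by
      rw [show 2 * (j + 1) = (2 * j + 1) + 1 by ring, Function.iterate_succ_apply, h2]
      exact iterate_map_zero _ _
    rw [h1, h3, smul_zero]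
  have hlim1 : ∀ᵐ ω ∂μ, fibOp k ω (fib f ω) ≠ 0 → ∃ r : ℝ, 0 < r ∧ ∃ v, ‖v‖ = 1 ∧
      fibOp k ω (fibOp k ω v) = ((r : ℂ) ^ 2) • v ∧
      Tendsto (fun n => fib (u n) ω) atTop (𝓝 v) := by
    filter_upwards [hu, fibOp_symm hk] with ω h1 h2 h3
    simp_rw [h1]
    exact tendsto_power_iteration h2 (isCompactOperator_fibOp k ω) h3
  obtain ⟨y, hy⟩ := exists_fib_limit u (by
    filter_upwards [hlim0, hlim1] with ω h0 h1
    by_cases h : fibOp k ω (fib f ω) = 0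
    · exact ⟨0, h0 h⟩
    · obtain ⟨r, -, v, -, -, hv⟩ := h1 h
      exact ⟨v, hv⟩)
  have hy0 : ∀ᵐ ω ∂μ, fibOp k ω (fib f ω) = 0 → fib y ω = 0 := by
    filter_upwards [hlim0, hy] with ω h0 h1 h
    exact tendsto_nhds_unique h1 (h0 h)
  have hy1 : ∀ᵐ ω ∂μ, fibOp k ω (fib f ω) ≠ 0 → ‖fib y ω‖ = 1 ∧ ∃ r : ℝ, 0 < r ∧
      fibOp k ω (fibOp k ω (fib y ω)) = ((r : ℂ) ^ 2) • fib y ω := by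
    filter_upwards [hlim1, hy] with ω h0 h1 h
    obtain ⟨r, hr, v, hv1, hv2, hv⟩ := h0 h
    rw [tendsto_nhds_unique h1 hv]
    exact ⟨hv1, r, hr, hv2⟩
  -- The fiberwise number `r` carries no measurability, but `‖T² y‖ = r ^ 2` on unit fibers, so its
  -- square root is a measurable version.
  let l : L0h μ := AEEqFun.comp Real.sqrt Real.continuous_sqrt (norm0 (opKH k (opKH k y)))
  have hl : ∀ᵐ ω ∂μ, l ω = Real.sqrt ‖fibOp k ω (fibOp k ω (fib y ω))‖ := by
    filter_upwards [AEEqFun.coeFn_comp Real.sqrt Real.continuous_sqrt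
      (norm0 (opKH k (opKH k y))), norm0_apply (opKH k (opKH k y)), fib_opKH k (opKH k y),
      fib_opKH k y] with ω h1 h2 h3 h4
    rw [← h4, ← h3, ← h2]
    exact h1
  refine ⟨y, l, fun h => hf ?_, ?_, ?_, fun g hg => ?_⟩
  · rw [eq_zero_iff_fib] at h ⊢
    filter_upwards [h, hy1, fib_opKH k f] with ω h1 h2 h3
    by_contra h4
    rw [h3] at h4
    have := (h2 h4).1
    rw [h1, norm_zero] at this
    exact zero_ne_one this
  · filter_upwards [hy0, hy1] with ω h0 h1
    by_cases h : fibOp k ω (fib f ω) = 0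
    · left; rw [h0 h, norm_zero]
    · exact Or.inr (h1 h).1
  · apply KH_ext
    -- From `T² y = r² y`, the vector `w = T y - r y` satisfies `T w = -r w`. Positivity then gives
    -- `-r ‖w‖² ≥ 0`, so `w = 0`.
    have hw := inner_fibOp_nonneg hpos (opKH k y - ofReal0 l • y)
    filter_upwards [hy0, hy1, hl, hw, fib_sub (opKH k y) (ofReal0 l • y), fib_opKH k y,
      fib_smul (ofReal0 l) y, ofReal0_apply l] with ω h0 h1 h2 h3 h4 h5 h6 h7
    by_cases h : fibOp k ω (fib f ω) = 0
    · rw [h5, h6, h0 h, map_zero, smul_zero]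
    · obtain ⟨hy1, r, hr, hyr⟩ := h1 h
      rw [hyr, norm_smul, hy1, mul_one, norm_pow, Complex.norm_real, Real.sqrt_sq (norm_nonneg _),
        Real.norm_of_nonneg hr.le] at h2
      rw [h4, h6, h7, h2, h5] at h3
      rw [h5, h6, h7, h2]
      have h8 : fibOp k ω (fibOp k ω (fib y ω) - (r : ℂ) • fib y ω) =
          (-r : ℂ) • (fibOp k ω (fib y ω) - (r : ℂ) • fib y ω) := by
        rw [map_sub, hyr, map_smul, smul_sub, smul_smul, neg_smul, sq, neg_mul, neg_smul]
        abel
      rw [h8, inner_smul_right, inner_self_eq_norm_sq_to_K] at h3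
      by_contra hne
      have h9 : 0 < ‖fibOp k ω (fib y ω) - (r : ℂ) • fib y ω‖ :=
        norm_pos_iff.2 (sub_ne_zero.2 hne)
      have h10 : (0 : ℂ) ≤ ((-(r * ‖fibOp k ω (fib y ω) - (r : ℂ) • fib y ω‖ ^ 2) : ℝ) : ℂ) := by
        refine h3.trans (le_of_eq ?_)
        push_cast
        rw [neg_mul]
        rfl
      have h11 : 0 ≤ -(r * ‖fibOp k ω (fib y ω) - (r : ℂ) • fib y ω‖ ^ 2) := by exact_mod_cast h10
      nlinarith [mul_pos hr (pow_pos h9 2)]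
  · rw [inner0_eq_zero_iff]
    filter_upwards [hy, ae_all_iff.2 fun n =>
      inner0_eq_zero_iff.1 (inner0_smul_left_zero (invNorm ((opKH k)^[2 * n] f)) (hg (2 * n)))]
      with ω h1 h2
    refine tendsto_nhds_unique ((tendsto_const_nhds (x := fib g ω)).inner h1) ?_
    refine tendsto_const_nhds.congr fun n => (h2 n).symm

end

end PartInt

namespace PartInt

noncomputable section

variable {Ω S : Type*} [MeasurableSpace Ω] [MeasurableSpace S]
variable {μ : Measure Ω} {m : Measure S} [IsFiniteMeasure μ] [IsFiniteMeasure m]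

/-! ### Maximal orthogonal families -/

/-- Zorn's lemma: an element of `A` orthogonal to the maximal family can be added to it, so it is
already a member and is orthogonal to itself. -/
theorem exists_maximal_orthogonal (A : Set (KH μ m)) :
    ∃ F ⊆ A, F.Pairwise (fun x y => inner0 x y = 0) ∧
      ∀ y ∈ A, (∀ x ∈ F, inner0 x y = 0) → y = 0 := by
  obtain ⟨F, hF⟩ := zorn_subset
    {F : Set (KH μ m) | F ⊆ A ∧ F.Pairwise (fun x y => inner0 x y = 0)} (by
      intro c hc hchain
      refine ⟨⋃₀ c, ⟨sUnion_subset fun s hs => (hc hs).1, ?_⟩, fun s hs => subset_sUnion_of_mem hs⟩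
      exact (pairwise_sUnion hchain.directedOn).2 fun s hs => (hc hs).2)
  refine ⟨F, hF.prop.1, hF.prop.2, fun y hy h => ?_⟩
  have h1 : insert y F ∈ {F : Set (KH μ m) | F ⊆ A ∧ F.Pairwise (fun x y => inner0 x y = 0)} :=
    ⟨insert_subset hy hF.prop.1, hF.prop.2.insert fun x hx _ => ⟨inner0_comm_zero (h x hx), h x hx⟩⟩
  have h2 : y ∈ F := hF.le_of_ge h1 (subset_insert y F) (mem_insert y F)
  exact eq_zero_of_inner0_self (h y h2)

/-- Integrated over Ω, the bounds on finite sums say that the integrals of the `G u` have a finite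
sum, and such a family has countable support. Only finitely many fields are compared at a time, so
null sets cause no trouble even when `F` is uncountable. -/
theorem countable_of_sum_le (F : Set (KH μ m)) (G : KH μ m → Ω → ℝ≥0∞)
    (hG : ∀ u, AEMeasurable (G u) μ) (b : Ω → ℝ≥0∞) (hb : ∫⁻ ω, b ω ∂μ ≠ ∞)
    (h : ∀ s : Finset (KH μ m), (s : Set (KH μ m)) ⊆ F → ∀ᵐ ω ∂μ, ∑ u ∈ s, G u ω ≤ b ω) :
    {u ∈ F | ¬ ∀ᵐ ω ∂μ, G u ω = 0}.Countable := by
  classical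
  have h1 : ∑' u : F, ∫⁻ ω, G u ω ∂μ ≤ ∫⁻ ω, b ω ∂μ := by
    rw [ENNReal.tsum_eq_iSup_sum]
    refine iSup_le fun s => ?_
    rw [← lintegral_finsetSum' s (f := fun u : F => G u) fun u _ => hG u]
    refine lintegral_mono_ae ?_
    filter_upwards [h (s.image Subtype.val) (by
      intro u hu
      obtain ⟨v, -, rfl⟩ := Finset.mem_image.1 (Finset.mem_coe.1 hu)
      exact v.2)] with ω hω
    rwa [Finset.sum_image fun x _ y _ hxy => Subtype.ext hxy] at hω
  have h2 := Summable.countable_support_ennreal (ne_top_of_le_ne_top hb h1)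
  refine (h2.image Subtype.val).mono ?_
  rintro u ⟨hu, hne⟩
  refine ⟨⟨u, hu⟩, fun h0 => hne ?_, rfl⟩
  exact (lintegral_eq_zero_iff' (hG u)).1 h0

theorem ae_partialOrthonormal {ι : Type*} [Countable ι] (y : ι → KH μ m)
    (hy : ∀ i, IsPartialUnit (y i)) (ho : Pairwise fun i j => inner0 (y i) (y j) = 0) :
    ∀ᵐ ω ∂μ, PartialOrthonormal fun i => fib (y i) ω := by
  have h1 : ∀ᵐ ω ∂μ, ∀ i j, i ≠ j → inner ℂ (fib (y i) ω) (fib (y j) ω) = 0 := by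
    rw [ae_all_iff]
    intro i
    rw [ae_all_iff]
    intro j
    by_cases hij : i = j
    · exact Eventually.of_forall fun ω h => absurd hij h
    · filter_upwards [inner0_eq_zero_iff.1 (ho (Ne.symm hij))] with ω hω _
      exact hω
  filter_upwards [h1, ae_all_iff.2 hy] with ω h2 h3
  exact ⟨h3, fun i j hij => h2 i j hij⟩

theorem ae_partialOrthonormal_finset {F : Set (KH μ m)} (hF : ∀ u ∈ F, IsPartialUnit u)
    (ho : F.Pairwise fun x y => inner0 x y = 0) (s : Finset (KH μ m))
    (hs : (s : Set (KH μ m)) ⊆ F) :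
    ∀ᵐ ω ∂μ, PartialOrthonormal fun u : s => fib (u : KH μ m) ω :=
  ae_partialOrthonormal (fun u : s => (u : KH μ m)) (fun u => hF u (hs u.2))
    fun u v huv => ho (hs u.2) (hs v.2) fun h => huv (Subtype.ext h)

/-- There is a countable set of fields whose orthogonal complement is annihilated by `T`. -/
theorem exists_countable_total (k : Kernel μ m) :
    ∃ Z : Set (KH μ m), Z.Countable ∧ (∀ z ∈ Z, IsPartialUnit z) ∧
      ∀ f, (∀ z ∈ Z, inner0 z f = 0) → opKH k f = 0 := by
  -- No member is annihilated by `T`, so the Hilbert–Schmidt bound makes the family countable;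
  -- maximality makes `T` vanish on everything orthogonal to it.
  obtain ⟨F, hFA, hFo, hFm⟩ :=
    exists_maximal_orthogonal {u : KH μ m | IsPartialUnit u ∧ opKH k u ≠ 0}
  refine ⟨F, ?_, fun z hz => (hFA hz).1, fun f hf => ?_⟩
  · obtain ⟨C, hC, hle⟩ := sum_sq_fibOp_le k
    have h1 := countable_of_sum_le F (fun u ω => ‖fib (opKH k u) ω‖ₑ ^ 2)
      (fun u => (aemeasurable_enorm_fib _).pow_const 2) (fun _ => ENNReal.ofReal C) (by
        rw [lintegral_const]
        exact ENNReal.mul_ne_top (by simp) (measure_ne_top μ univ)) (by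
      intro s hs
      filter_upwards [ae_partialOrthonormal_finset (fun u hu => (hFA hu).1) hFo s hs,
        (ae_ball_iff s.countable_toSet).2 fun u _ => fib_opKH k u] with ω h1 h2
      have h3 := hle ω h1 Finset.univ
      rw [Finset.sum_coe_sort s (fun u => ‖fibOp k ω (fib u ω)‖ ^ 2)] at h3
      have h4 : ∑ u ∈ s, ‖fib (opKH k u) ω‖ ^ 2 ≤ C :=
        (Finset.sum_congr rfl fun u hu => by rw [h2 u hu]).trans_le h3
      refine le_trans (le_of_eq ?_) (ENNReal.ofReal_le_ofReal h4)
      rw [ENNReal.ofReal_sum_of_nonneg fun u _ => by positivity]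
      refine Finset.sum_congr rfl fun u _ => ?_
      rw [ENNReal.ofReal_pow (norm_nonneg _), ofReal_norm])
    refine h1.mono ?_
    intro u hu
    refine ⟨hu, fun h0 => (hFA hu).2 ?_⟩
    rw [eq_zero_iff_fib]
    filter_upwards [h0] with ω hω
    simpa using hω
  · by_contra hne
    have h1 := hFm (invNorm f • f) ⟨isPartialUnit_invNorm_smul f, fun h0 => hne ?_⟩
      fun x hx => inner0_comm_zero (inner0_smul_left_zero _ (inner0_comm_zero (hf x hx)))
    · apply hne
      rw [← eq_smul_invNorm_smul f, h1, smul_zero, map_zero]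
    · rw [← eq_smul_invNorm_smul f, map_smul, h0, smul_zero]

theorem countable_not_orthogonal {F : Set (KH μ m)} (hF : ∀ u ∈ F, IsPartialUnit u)
    (ho : F.Pairwise fun x y => inner0 x y = 0) {z : KH μ m} {C : ℝ}
    (hz : ∀ᵐ ω ∂μ, ‖fib z ω‖ ≤ C) : {u ∈ F | inner0 z u ≠ 0}.Countable := by
  have h1 := countable_of_sum_le F (fun u ω => ‖inner0 z u ω‖ₑ ^ 2)
    (fun u => (inner0 z u).measurable.enorm.aemeasurable.pow_const 2)
    (fun _ => ENNReal.ofReal (C ^ 2)) (by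
      rw [lintegral_const]
      exact ENNReal.mul_ne_top (by simp) (measure_ne_top μ univ)) (by
    intro s hs
    filter_upwards [ae_partialOrthonormal_finset hF ho s hs, hz,
      (ae_ball_iff s.countable_toSet).2 fun u _ => inner0_apply z u] with ω h1 h2 h3
    have h4 := h1.sum_sq_inner_le Finset.univ (fib z ω)
    rw [Finset.sum_coe_sort s (fun u => ‖inner ℂ (fib u ω) (fib z ω)‖ ^ 2)] at h4
    have h5 : ‖fib z ω‖ ^ 2 ≤ C ^ 2 := by gcongr
    have h6 : ∑ u ∈ s, ‖inner0 z u ω‖ ^ 2 ≤ C ^ 2 :=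
      ((Finset.sum_congr rfl fun u hu => by rw [h3 u hu]).trans_le h4).trans h5
    refine le_trans (le_of_eq ?_) (ENNReal.ofReal_le_ofReal h6)
    rw [ENNReal.ofReal_sum_of_nonneg fun u _ => by positivity]
    refine Finset.sum_congr rfl fun u _ => ?_
    rw [ENNReal.ofReal_pow (norm_nonneg _), ofReal_norm])
  refine h1.mono ?_
  intro u hu
  refine ⟨hu.1, fun h0 => hu.2 ?_⟩
  apply AEEqFun.ext
  filter_upwards [h0, (AEEqFun.coeFn_zero : ⇑(0 : L0 μ) =ᵐ[μ] 0)] with ω h2 h3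
  rw [h3]
  simpa using h2

theorem exists_enumeration {F : Set (KH μ m)} (hc : F.Countable)
    (ho : F.Pairwise fun x y => inner0 x y = 0) :
    ∃ y : ℕ → KH μ m, (∀ n, y n ∈ F ∨ y n = 0) ∧ (∀ u ∈ F, ∃ n, y n = u) ∧
      Pairwise fun i j => inner0 (y i) (y j) = 0 := by
  have := hc.toEncodable
  let y : ℕ → KH μ m := fun n =>
    match Encodable.decode₂ F n with
    | some u => u
    | none => 0
  have hy : ∀ n, (∃ u : F, Encodable.encode u = n ∧ y n = u) ∨ y n = 0 := fun n => by
    cases h : Encodable.decode₂ F n with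
    | none => right; simp only [y, h]
    | some u =>
      refine Or.inl ⟨u, Encodable.mem_decode₂.1 h, ?_⟩
      simp only [y, h]
  have hz : ∀ u : KH μ m, inner0 0 u = 0 := fun u => by
    rw [inner0_eq_zero_iff]
    filter_upwards [fib_zero (μ := μ) (m := m)] with ω h
    rw [h, inner_zero_right]
  refine ⟨y, fun n => ?_, fun u hu => ⟨Encodable.encode (⟨u, hu⟩ : F), ?_⟩, fun i j hij => ?_⟩
  · rcases hy n with ⟨u, -, h⟩ | h
    · rw [h]; exact Or.inl u.2
    · exact Or.inr h
  · simp only [y, Encodable.encodek₂]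
  · rcases hy i with ⟨u, hu, h⟩ | h
    · rcases hy j with ⟨v, hv, h'⟩ | h'
      · rw [h, h']
        refine ho u.2 v.2 fun huv => hij ?_
        rw [← hu, ← hv, Subtype.ext huv]
      · rw [h']; exact inner0_comm_zero (hz _)
    · rw [h]; exact hz _

/-- A sequence of mutually orthogonal eigenfields that generates, up to elements of the kernel
of `T`, a submodule that contains given constant fields. -/
theorem exists_eigen_sequence {k : Kernel μ m} (hk : IsHermitianKernel k)
    (hpos : IsPosSemidefKernel k) (e : ℕ → KH μ m) {C : ℕ → ℝ}
    (he : ∀ j, ∀ᵐ ω ∂μ, ‖fib (e j) ω‖ ≤ C j) :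
    ∃ (y : ℕ → KH μ m) (l : ℕ → L0h μ), (∀ n, IsPartialUnit (y n)) ∧
      (∀ n, opKH k (y n) = ofReal0 (l n) • y n) ∧
      (Pairwise fun i j => inner0 (y i) (y j) = 0) ∧
      (∀ f, (∀ n, inner0 f (y n) = 0) → opKH k f = 0) ∧
      (∀ n g, (∀ j, inner0 (e j) g = 0) → opKH k g = 0 → inner0 (y n) g = 0) ∧
      ∀ f, (∀ g, (∀ j, inner0 (e j) g = 0) → opKH k g = 0 → inner0 f g = 0) →
        (∀ n, inner0 f (y n) = 0) → f = 0 := by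
  -- The fields orthogonal to every `g` that `T` annihilates and that is orthogonal to all test
  -- fields. `W` contains the test fields and the range of `T`, yet is small enough for orthogonal
  -- families of partial units in it to be countable.
  let W : Set (KH μ m) :=
    {f | ∀ g, (∀ j, inner0 (e j) g = 0) → opKH k g = 0 → inner0 f g = 0}
  have hTW : ∀ f, opKH k f ∈ W := fun f g _ hg => by
    rw [inner0_opKH_left hk, hg]
    rw [inner0_eq_zero_iff]
    filter_upwards [fib_zero (μ := μ) (m := m)] with ω h
    rw [h, inner_zero_left]
  let A : Set (KH μ m) :=
    {y | IsPartialUnit y ∧ y ∈ W ∧ ∃ l : L0h μ, opKH k y = ofReal0 l • y}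
  obtain ⟨F, hFA, hFo, hFm⟩ := exists_maximal_orthogonal A
  obtain ⟨Z, hZ, hZ1, hZ2⟩ := exists_countable_total k
  have hFunit : ∀ u ∈ F, IsPartialUnit u := fun u hu => (hFA hu).1
  have hFc : F.Countable := by
    -- A member orthogonal to all of `Z` and to all `e j` is annihilated by `T`; lying in `W`, it is
    -- then orthogonal to itself. So each nonzero member meets one of countably many fields, and
    -- each of those meets countably many members.
    have h1 : F ⊆ {0} ∪ ((⋃ z ∈ Z, {u ∈ F | inner0 z u ≠ 0}) ∪
        ⋃ j, {u ∈ F | inner0 (e j) u ≠ 0}) := by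
      intro u hu
      by_contra hcon
      simp only [mem_union, mem_iUnion, mem_singleton_iff, not_or, not_exists, mem_ofPred_eq,
        not_and, not_not] at hcon
      obtain ⟨h0, h1, h2⟩ := hcon
      refine h0 (eq_zero_of_inner0_self ((hFA hu).2.1 u (fun j => h2 j hu) ?_))
      exact hZ2 u fun z hz => h1 z hz hu
    refine Countable.mono h1 ((countable_singleton 0).union ((hZ.biUnion fun z hz => ?_).union
      (countable_iUnion fun j => countable_not_orthogonal hFunit hFo (he j))))
    refine countable_not_orthogonal hFunit hFo (C := 1) ?_
    filter_upwards [hZ1 z hz] with ω h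
    rcases h with h | h <;> simp [h]
  obtain ⟨y, hy1, hy2, hy3⟩ := exists_enumeration hFc hFo
  have hp0 : IsPartialUnit (0 : KH μ m) := by
    filter_upwards [fib_zero (μ := μ) (m := m)] with ω h
    left
    rw [h, norm_zero]
  have hl : ∀ n, ∃ l : L0h μ, opKH k (y n) = ofReal0 l • y n := fun n => by
    rcases hy1 n with h | h
    · exact (hFA h).2.2
    · exact ⟨0, by rw [h, map_zero, smul_zero]⟩
  choose l hl using hl
  have hker : ∀ f, (∀ n, inner0 f (y n) = 0) → opKH k f = 0 := by
    intro f hf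
    by_contra hne
    -- The iteration is started at `T f` instead of `f`, so that all iterates lie in the range of
    -- `T`, hence in `W`, and the eigenfield does too.
    have hne2 : opKH k (opKH k f) ≠ 0 := fun h => hne (by
      refine eq_zero_of_inner0_self ?_
      rw [inner0_opKH_left hk, h, inner0_eq_zero_iff]
      filter_upwards [fib_zero (μ := μ) (m := m)] with ω h
      rw [h, inner_zero_left])
    obtain ⟨y', l', h1, h2, h3, h4⟩ := exists_eigenfield hk hpos hne2
    refine h1 (hFm y' ⟨h2, fun g hg hTg => h4 g fun n => ?_, l', h3⟩ fun x hx => ?_)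
    · have h5 : (opKH k)^[n] (opKH k f) = opKH k ((opKH k)^[n] f) := by
        rw [← Function.iterate_succ_apply, Function.iterate_succ_apply']
      rw [h5]
      exact hTW _ g hg hTg
    · obtain ⟨i, rfl⟩ := hy2 x hx
      have h5 : ∀ n, inner0 ((opKH k)^[n] f) (y i) = 0 := fun n => by
        induction n with
        | zero => exact hf i
        | succ n ih =>
          rw [Function.iterate_succ_apply', inner0_opKH_left hk, hl]
          exact inner0_comm_zero (inner0_smul_left_zero _ (inner0_comm_zero ih))
      exact inner0_comm_zero (h4 _ fun n => h5 (n + 1))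
  refine ⟨y, l, fun n => ?_, hl, hy3, hker, fun n g hg hTg => ?_, fun f hfW hf => ?_⟩
  · rcases hy1 n with h | h
    · exact hFunit _ h
    · rw [h]; exact hp0
  · rcases hy1 n with h | h
    · exact (hFA h).2.1 g hg hTg
    · rw [h, inner0_eq_zero_iff]
      filter_upwards [fib_zero (μ := μ) (m := m)] with ω h1
      rw [h1, inner_zero_right]
  · have hTf := hker f hf
    -- Being annihilated by `T`, the normalized `f` is an eigenfield with eigenvalue zero in `W`,
    -- which maximality excludes unless it vanishes.
    have h1 := hFm (invNorm f • f) ⟨isPartialUnit_invNorm_smul f, fun g hg hTg =>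
      inner0_smul_left_zero _ (hfW g hg hTg), 0, ?_⟩ fun x hx => ?_
    · rw [← eq_smul_invNorm_smul f, h1, smul_zero]
    · rw [map_smul, hTf, smul_zero]
      symm
      rw [eq_zero_iff_fib]
      filter_upwards [fib_smul (ofReal0 (0 : L0h μ)) (invNorm f • f), ofReal0_apply (0 : L0h μ),
        (AEEqFun.coeFn_zero : ⇑(0 : L0h μ) =ᵐ[μ] 0)] with ω h2 h3 h4
      rw [h2, h3, h4, Pi.zero_apply, Complex.ofReal_zero, zero_smul]
    · obtain ⟨i, rfl⟩ := hy2 x hx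
      exact inner0_comm_zero (inner0_smul_left_zero _ (hf i))

end

end PartInt

/-! ### The orthonormal eigenbasis: compressing partial units to unit fibers. -/

namespace PartInt

noncomputable section

variable {Ω S : Type*} [MeasurableSpace Ω] [MeasurableSpace S]
variable {μ : Measure Ω} {m : Measure S} [IsFiniteMeasure μ] [IsFiniteMeasure m]

/-- In the separable case a dense sequence works, since a finite-dimensional span would be closed
and hence everything. Otherwise any linearly independent sequence does, and density is not claimed.
-/
theorem exists_test_sequence {H : Type*} [NormedAddCommGroup H] [InnerProductSpace ℂ H]
    (hH : ¬ FiniteDimensional ℂ H) :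
    ∃ e : ℕ → H, ¬ FiniteDimensional ℂ (Submodule.span ℂ (range e)) ∧
      (TopologicalSpace.SeparableSpace H → DenseRange e) := by
  by_cases hs : TopologicalSpace.SeparableSpace H
  · refine ⟨TopologicalSpace.denseSeq H, fun h => hH ?_, fun _ =>
      TopologicalSpace.denseRange_denseSeq H⟩
    have h1 : IsClosed (Submodule.span ℂ (range (TopologicalSpace.denseSeq H)) : Set H) :=
      Submodule.closed_of_finiteDimensional _
    have h2 : Submodule.span ℂ (range (TopologicalSpace.denseSeq H)) = ⊤ := by
      rw [eq_top_iff]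
      intro x _
      have h3 := h1.closure_subset_iff.2 Submodule.subset_span
      exact h3 (TopologicalSpace.denseRange_denseSeq H x)
    rw [h2] at h
    exact (Submodule.topEquiv (R := ℂ) (M := H)).finiteDimensional
  · let b := Module.Basis.ofVectorSpace ℂ H
    have hinf : Infinite (Module.Basis.ofVectorSpaceIndex ℂ H) := by
      by_contra h
      rw [not_infinite_iff_finite] at h
      exact hH (Module.Finite.of_basis b)
    let g := Infinite.natEmbedding (Module.Basis.ofVectorSpaceIndex ℂ H)
    refine ⟨fun n => b (g n), fun h => ?_, fun h => absurd h hs⟩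
    have h1 : LinearIndependent ℂ fun n => b (g n) := b.linearIndependent.comp g g.injective
    have h2 := (Module.Basis.span h1).linearIndependent
    exact not_finite_iff_infinite.2 inferInstance (LinearIndependent.finite h2)

/-- Let `A` be the set where all `y n` with `n ≥ N` vanish. Subtracting from a test field its
components along the first `N` fields and cutting down to `A` leaves a field orthogonal to all `y
n`, hence zero by `htot`. If `A` were not null, all `e j` would then lie in the span of `N` vectors.
-/
theorem ae_frequently_ne_zero {y : ℕ → KH μ m} (hy : ∀ n, IsPartialUnit (y n))
    (ho : Pairwise fun i j => inner0 (y i) (y j) = 0) {e : ℕ → Lp ℂ 2 m}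
    (he : ¬ FiniteDimensional ℂ (Submodule.span ℂ (range e))) {E : ℕ → KH μ m}
    (hE : ∀ j, ∀ᵐ ω ∂μ, fib (E j) ω = e j) {k : Kernel μ m}
    (hyE : ∀ n g, (∀ j, inner0 (E j) g = 0) → opKH k g = 0 → inner0 (y n) g = 0)
    (htot : ∀ f, (∀ g, (∀ j, inner0 (E j) g = 0) → opKH k g = 0 → inner0 f g = 0) →
      (∀ n, inner0 f (y n) = 0) → f = 0) :
    ∀ᵐ ω ∂μ, ∀ N, ∃ n ≥ N, norm0 (y n) ω ≠ 0 := by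
  rw [ae_all_iff]
  intro N
  let A : Set Ω := {ω | ∀ n ≥ N, norm0 (y n) ω = 0}
  have hA : MeasurableSet A := by
    have : A = ⋂ n, ⋂ (_ : n ≥ N), {ω | norm0 (y n) ω = 0} := by ext; simp [A]
    rw [this]
    exact MeasurableSet.iInter fun n => MeasurableSet.iInter fun _ =>
      (norm0 (y n)).measurable (measurableSet_singleton 0)
  let f : ℕ → KH μ m := fun j =>
    chi μ A hA • (E j - ∑ n ∈ Finset.range N, inner0 (E j) (y n) • y n)
  have hort := ae_partialOrthonormal y hy ho
  have hfib : ∀ j, ∀ᵐ ω ∂μ, fib (f j) ω = A.indicator 1 ω •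
      (e j - ∑ n ∈ Finset.range N, inner ℂ (fib (y n) ω) (e j) • fib (y n) ω) := fun j => by
    filter_upwards [fib_smul (chi μ A hA) (E j - ∑ n ∈ Finset.range N, inner0 (E j) (y n) • y n),
      chi_apply (μ := μ) A hA, fib_sub (E j) (∑ n ∈ Finset.range N, inner0 (E j) (y n) • y n),
      fib_sum (Finset.range N) (fun n => inner0 (E j) (y n) • y n),
      ae_all_iff.2 fun n => fib_smul (inner0 (E j) (y n)) (y n),
      ae_all_iff.2 fun n => inner0_apply (E j) (y n), hE j] with ω h1 h2 h3 h4 h5 h6 h7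
    rw [h1, h2, h3, h4, h7]
    congr 2
    refine Finset.sum_congr rfl fun n _ => ?_
    rw [h5, h6, h7]
  have hf0 : ∀ j, f j = 0 := fun j => by
    refine htot (f j) (fun g hg hTg => inner0_smul_left_zero _ (inner0_sub_left_zero (hg j)
      (inner0_sum_left_zero _ _ fun n _ => inner0_smul_left_zero _ (hyE n g hg hTg)))) fun i => ?_
    rw [inner0_eq_zero_iff]
    filter_upwards [hfib j, hort, norm0_apply (y i)] with ω h1 h2 h3
    rw [h1]
    by_cases hω : ω ∈ A
    · rw [indicator_of_mem hω, Pi.one_apply, one_smul]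
      by_cases hi : i < N
      · rw [inner_sub_right, inner_sum, Finset.sum_eq_single i]
        · rw [inner_smul_right, inner_self_eq_norm_sq_to_K]
          rcases h2.norm_eq i with h4 | h4
          · rw [norm_eq_zero.1 h4]; simp
          · rw [h4]; simp
        · intro n _ hn
          rw [inner_smul_right, h2.inner_eq hn.symm, mul_zero]
        · exact fun h => absurd (Finset.mem_range.2 hi) h
      · have h4 : fib (y i) ω = 0 := by
          rw [← norm_eq_zero, ← h3]
          exact hω i (not_lt.1 hi)
        rw [h4, inner_zero_left]
    · rw [indicator_of_notMem hω, zero_smul, inner_zero_right]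
  filter_upwards [ae_all_iff.2 hfib, ae_all_iff.2 fun j => eq_zero_iff_fib.1 (hf0 j)] with ω h1 h2
  by_contra! hcon
  have hω : ω ∈ A := hcon
  let V : Submodule ℂ (Lp ℂ 2 m) :=
    Submodule.span ℂ ((fun n => fib (y n) ω) '' (Finset.range N : Set ℕ))
  have hV : FiniteDimensional ℂ V :=
    FiniteDimensional.span_of_finite ℂ ((Finset.range N).finite_toSet.image _)
  refine he (Submodule.finiteDimensional_of_le (S₂ := V) (Submodule.span_le.2 ?_))
  rintro _ ⟨j, rfl⟩
  have h3 := h1 j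
  rw [h2 j, indicator_of_mem hω, Pi.one_apply, one_smul] at h3
  rw [sub_eq_zero.1 h3.symm]
  exact Submodule.sum_mem _ fun n hn => Submodule.smul_mem _ _
    (Submodule.subset_span ⟨n, hn, rfl⟩)

open Classical in
theorem measurable_count {p : Ω → ℕ → Prop} (hp : ∀ i, MeasurableSet {ω | p ω i}) (n : ℕ) :
    Measurable fun ω => Nat.count (p ω) n := by
  induction n with
  | zero => simp
  | succ n ih =>
    simp_rw [Nat.count_succ]
    exact ih.add (Measurable.ite (hp n) measurable_const measurable_const)

-- The n-th index equals `i` exactly when `i` qualifies and precisely `n` smaller indices do; counts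
-- are measurable by induction.
open Classical in
theorem measurable_nth {p : Ω → ℕ → Prop} (hp : ∀ i, MeasurableSet {ω | p ω i})
    (hinf : ∀ ω, {i | p ω i}.Infinite) (n : ℕ) : Measurable fun ω => Nat.nth (p ω) n := by
  refine measurable_to_countable' fun i => ?_
  have h1 : (fun ω => Nat.nth (p ω) n) ⁻¹' {i} =
      {ω | p ω i} ∩ (fun ω => Nat.count (p ω) i) ⁻¹' {n} := by
    ext ω
    simp only [mem_preimage, mem_singleton_iff, mem_inter_iff, mem_ofPred_eq]
    constructor
    · rintro rfl
      exact ⟨Nat.nth_mem_of_infinite (hinf ω) n, Nat.count_nth_of_infinite (hinf ω) n⟩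
    · rintro ⟨h2, rfl⟩
      exact Nat.nth_count h2
  rw [h1]
  exact (hp i).inter (measurable_count hp i (measurableSet_singleton n))

/-- At `ω` the n-th basis vector is the n-th nonzero fiber among the orthogonal partial units, with
the eigenvalue carried along. Every nonzero fiber is reached, so orthogonality to the new system is
orthogonality to the old one. With dense test fields, a field orthogonal to all of them is zero, so
nothing is left outside `W`. -/
theorem exists_eigen_basis {k : Kernel μ m} (hm : ¬ FiniteDimensional ℂ (Lp ℂ 2 m))
    (hk : IsHermitianKernel k) (hpos : IsPosSemidefKernel k) :
    ∃ (lam : ℕ → L0h μ) (x : ℕ → KH μ m), (∀ n, opKH k (x n) = ofReal0 (lam n) • x n) ∧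
      (∀ i j, inner0 (x i) (x j) = if i = j then 1 else 0) ∧
      (∀ f, (∀ n, inner0 f (x n) = 0) → opKH k f = 0) ∧
      (TopologicalSpace.SeparableSpace (Lp ℂ 2 m) →
        ∀ f, (∀ n, inner0 f (x n) = 0) → f = 0) := by
  classical
  obtain ⟨e, he1, he2⟩ := exists_test_sequence hm
  choose E hE using fun j => exists_const_fib (μ := μ) (e j)
  obtain ⟨y, l, hy1, hy2, hy3, hy4, hy5, hy6⟩ := exists_eigen_sequence hk hpos E
    (C := fun j => ‖e j‖) fun j => by filter_upwards [hE j] with ω h; rw [h]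
  have hfreq := ae_frequently_ne_zero hy1 hy3 he1 hE hy5 hy6
  have hort := ae_partialOrthonormal y hy1 hy3
  let G : Ω → Prop := fun ω => ∀ N, ∃ n ≥ N, norm0 (y n) ω ≠ 0
  -- On the null set where `G` fails every index is accepted, so that infinitely many indices
  -- qualify at every `ω` and `Nat.nth` is never at its default value.
  let p : Ω → ℕ → Prop := fun ω i => norm0 (y i) ω ≠ 0 ∨ ¬ G ω
  have hne : ∀ n, MeasurableSet {ω | norm0 (y n) ω ≠ 0} := fun n =>
    ((norm0 (y n)).measurable (measurableSet_singleton 0)).compl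
  have hG : MeasurableSet {ω | G ω} := by
    have : {ω | G ω} = ⋂ N, ⋃ n, ⋃ (_ : n ≥ N), {ω | norm0 (y n) ω ≠ 0} := by ext; simp [G]
    rw [this]
    exact MeasurableSet.iInter fun N => MeasurableSet.iUnion fun n =>
      MeasurableSet.iUnion fun _ => hne n
  have hp : ∀ i, MeasurableSet {ω | p ω i} := fun i => (hne i).union hG.compl
  have hinf : ∀ ω, {i | p ω i}.Infinite := fun ω => by
    by_cases h : G ω
    · refine Set.infinite_of_not_bddAbove fun ⟨B, hB⟩ => ?_
      obtain ⟨n, hn, hn'⟩ := h (B + 1)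
      have : n ≤ B := hB (Or.inl hn')
      omega
    · have : {i | p ω i} = univ := by ext; simp [p, h]
      rw [this]
      exact Set.infinite_univ
  let N : ℕ → Ω → ℕ := fun n ω => Nat.nth (p ω) n
  have hN : ∀ n, Measurable (N n) := measurable_nth hp hinf
  choose x hx using fun n => exists_glue (N n) (hN n) y
  have hlm : ∀ n, Measurable fun ω => l (N n ω) ω := fun n =>
    (measurable_from_prod_countable_right fun i => (l i).measurable :
      Measurable fun q : ℕ × Ω => l q.1 q.2).comp ((hN n).prodMk measurable_id)
  let lam : ℕ → L0h μ := fun n => AEEqFun.mk _ (hlm n).aestronglyMeasurable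
  have hlam : ∀ᵐ ω ∂μ, ∀ n, lam n ω = l (N n ω) ω :=
    ae_all_iff.2 fun n => AEEqFun.coeFn_mk _ _
  have hx' := ae_all_iff.2 hx
  have hnorm : ∀ᵐ ω ∂μ, ∀ n, ‖fib (y (N n ω)) ω‖ = 1 := by
    filter_upwards [hfreq, hort, ae_all_iff.2 fun n => norm0_apply (y n)] with ω h1 h2 h3 n
    have h4 : p ω (N n ω) := Nat.nth_mem_of_infinite (hinf ω) n
    rcases h4 with h4 | h4
    · rw [h3] at h4
      exact (h2.norm_eq _).resolve_left h4
    · exact absurd h1 h4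
  have hperp : ∀ f : KH μ m, (∀ n, inner0 f (x n) = 0) → ∀ i, inner0 f (y i) = 0 := by
    intro f hf i
    rw [inner0_eq_zero_iff]
    filter_upwards [hx', ae_all_iff.2 fun n => inner0_eq_zero_iff.1 (hf n), norm0_apply (y i)]
      with ω h1 h2 h3
    by_cases h4 : norm0 (y i) ω = 0
    · rw [h3, norm_eq_zero] at h4
      rw [h4, inner_zero_left]
    · have h5 : N (Nat.count (p ω) i) ω = i := Nat.nth_count (Or.inl h4)
      have h6 := h2 (Nat.count (p ω) i)
      rwa [h1, h5] at h6
  refine ⟨lam, x, fun n => ?_, fun i j => ?_, fun f hf => hy4 f (hperp f hf), fun hs f hf => ?_⟩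
  · apply KH_ext
    filter_upwards [fib_opKH k (x n), fib_smul (ofReal0 (lam n)) (x n), ofReal0_apply (lam n),
      hlam, hx', ae_all_iff.2 fun i => fib_opKH k (y i),
      ae_all_iff.2 fun i => fib_smul (ofReal0 (l i)) (y i),
      ae_all_iff.2 fun i => ofReal0_apply (l i)] with ω h1 h2 h3 h4 h5 h6 h7 h8
    rw [h1, h2, h3, h4, h5, ← h6, hy2, h7, h8]
  · apply AEEqFun.ext
    have hR : ∀ᵐ ω ∂μ, (if i = j then 1 else 0 : L0 μ) ω = if i = j then 1 else 0 := by
      split_ifs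
      · exact AEEqFun.coeFn_one
      · exact AEEqFun.coeFn_zero
    filter_upwards [inner0_apply (x i) (x j), hx', hnorm, hort, hR] with ω h1 h2 h3 h4 h5
    rw [h1, h2, h2, h5]
    split_ifs with hij
    · rw [hij, inner_self_eq_norm_sq_to_K, h3]
      simp
    · refine h4.inner_eq fun h => hij ?_
      exact (Nat.nth_injective (hinf ω) h).symm
  · refine hy6 f (fun g hg _ => ?_) (hperp f hf)
    have hg0 : g = 0 := by
      rw [eq_zero_iff_fib]
      filter_upwards [ae_all_iff.2 fun j => inner0_eq_zero_iff.1 (hg j), ae_all_iff.2 hE]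
        with ω h1 h2
      exact (he2 hs).eq_zero_of_inner_left ℂ fun j => by rw [← h2 j]; exact h1 j
    rw [inner0_eq_zero_iff, hg0]
    filter_upwards [fib_zero (μ := μ) (m := m)] with ω h
    rw [h, inner_zero_left]

end

end PartInt

namespace PartInt

noncomputable section

variable {Ω S : Type*} [MeasurableSpace Ω] [MeasurableSpace S]
variable {μ : Measure Ω} {m : Measure S} [IsFiniteMeasure μ] [IsFiniteMeasure m]

/-! ### Diagonal operators -/

section DiagonalOperators

variable {x : ℕ → KH μ m}

theorem ae_orthonormal_fib (hx : ∀ i j, inner0 (x i) (x j) = if i = j then 1 else 0) :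
    ∀ᵐ ω ∂μ, Orthonormal ℂ fun n => fib (x n) ω := by
  have h1 : ∀ᵐ ω ∂μ, ∀ i j, inner ℂ (fib (x j) ω) (fib (x i) ω) = if i = j then 1 else 0 := by
    rw [ae_all_iff]
    intro i
    rw [ae_all_iff]
    intro j
    have hR : ∀ᵐ ω ∂μ, (if i = j then 1 else 0 : L0 μ) ω = if i = j then 1 else 0 := by
      split_ifs
      · exact AEEqFun.coeFn_one
      · exact AEEqFun.coeFn_zero
    filter_upwards [inner0_apply (x i) (x j), hR] with ω h1 h2
    rw [← h1, hx, h2]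
  filter_upwards [h1] with ω h
  rw [orthonormal_iff_ite]
  intro i j
  rw [h]
  simp only [eq_comm]

/-- The partial sums of the expansion of a diagonal operator on the module. -/
def diagSumKH (x : ℕ → KH μ m) (a : ℕ → L0 μ) (c : L0 μ) (u : KH μ m) (N : ℕ) : KH μ m :=
  (∑ n ∈ Finset.range N, a n • inner0 u (x n) • x n) +
    c • (u - ∑ n ∈ Finset.range N, inner0 u (x n) • x n)

theorem fib_diagSumKH (x : ℕ → KH μ m) (a : ℕ → L0 μ) (c : L0 μ) (u : KH μ m) :
    ∀ᵐ ω ∂μ, ∀ N, fib (diagSumKH x a c u N) ω =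
      diagSum (fun n => fib (x n) ω) (fun n => a n ω) (c ω) (fib u ω) N := by
  rw [ae_all_iff]
  intro N
  filter_upwards [fib_add (∑ n ∈ Finset.range N, a n • inner0 u (x n) • x n)
      (c • (u - ∑ n ∈ Finset.range N, inner0 u (x n) • x n)),
    fib_sum (Finset.range N) fun n => a n • inner0 u (x n) • x n,
    fib_smul c (u - ∑ n ∈ Finset.range N, inner0 u (x n) • x n),
    fib_sub u (∑ n ∈ Finset.range N, inner0 u (x n) • x n),
    fib_sum (Finset.range N) fun n => inner0 u (x n) • x n,
    ae_all_iff.2 fun n => fib_smul (a n) (inner0 u (x n) • x n),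
    ae_all_iff.2 fun n => fib_smul (inner0 u (x n)) (x n),
    ae_all_iff.2 fun n => inner0_apply u (x n)] with ω h1 h2 h3 h4 h5 h6 h7 h8
  rw [diagSumKH, h1, h2, h3, h4, h5, diagSum]
  simp_rw [h6, h7, h8, smul_smul]

/-- The bound on the coefficients may depend on `ω`: on the module a bound at each point suffices,
and inverses of `T - l` need this. A uniform bound is required only to stay within `L22`. -/
theorem exists_diag (hx : ∀ i j, inner0 (x i) (x j) = if i = j then 1 else 0) {a : ℕ → L0 μ}
    (c : L0 μ) (ha : ∀ᵐ ω ∂μ, ∃ B, ∀ n, ‖a n ω‖ ≤ B) (u : KH μ m) :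
    ∃ w : KH μ m, ∀ᵐ ω ∂μ,
      IsDiag (fun n => fib (x n) ω) (fun n => a n ω) (c ω) (fib u ω) (fib w ω) := by
  obtain ⟨w, hw⟩ := exists_fib_limit (diagSumKH x a c u) (by
    filter_upwards [fib_diagSumKH x a c u, ae_orthonormal_fib hx, ha] with ω h1 h2 ⟨B, h3⟩
    obtain ⟨y, -, hy⟩ := exists_tendsto_diagSum h2 h3 (c ω) (fib u ω)
    exact ⟨y, hy.congr fun N => (h1 N).symm⟩)
  refine ⟨w, ?_⟩
  filter_upwards [fib_diagSumKH x a c u, ae_orthonormal_fib hx, ha, hw] with ω h1 h2 ⟨B, h3⟩ h4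
  obtain ⟨y, hy1, hy⟩ := exists_tendsto_diagSum h2 h3 (c ω) (fib u ω)
  rwa [tendsto_nhds_unique h4 (hy.congr fun N => (h1 N).symm)]

/-- Linearity over `L0` needs no formula: `IsDiag` is compatible with sums and multiples, and its
solutions are unique. -/
theorem exists_diagKH (hx : ∀ i j, inner0 (x i) (x j) = if i = j then 1 else 0) {a : ℕ → L0 μ}
    (c : L0 μ) (ha : ∀ᵐ ω ∂μ, ∃ B, ∀ n, ‖a n ω‖ ≤ B) :
    ∃ D : KH μ m →ₗ[L0 μ] KH μ m, ∀ u, ∀ᵐ ω ∂μ,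
      IsDiag (fun n => fib (x n) ω) (fun n => a n ω) (c ω) (fib u ω) (fib (D u) ω) := by
  choose D hD using exists_diag hx c ha
  refine ⟨⟨⟨D, fun u v => ?_⟩, fun b u => ?_⟩, hD⟩
  · apply KH_ext
    filter_upwards [hD u, hD v, hD (u + v), fib_add u v, fib_add (D u) (D v)] with ω h1 h2 h3 h4 h5
    rw [h4] at h3
    rw [h5]
    exact h3.unique (h1.add h2)
  · apply KH_ext
    filter_upwards [hD u, hD (b • u), fib_smul b u, fib_smul b (D u)] with ω h1 h2 h3 h4
    rw [h3] at h2
    rw [RingHom.id_apply, h4]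
    exact h2.unique (h1.smul _)

theorem toKH_injective : Function.Injective (toKH : L22 μ m → KH μ m) := fun _ _ h =>
  Subtype.ext (congrArg (fun u : KH μ m => (u : Ω × S →ₘ[μ.prod m] ℂ)) h)

theorem toKH_add (f g : L22 μ m) : toKH (f + g) = toKH f + toKH g := rfl

theorem fib_toKH_smul (z : ℂ) (f : L22 μ m) :
    ∀ᵐ ω ∂μ, fib (toKH (z • f)) ω = z • fib (toKH f) ω := by
  apply fib_congr (g := fun ω => z • fib (toKH f) ω)
  filter_upwards [Measure.ae_ae_of_ae_prod (Lp.coeFn_smul z f), coeFn_fib (toKH f)] with ω h1 h2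
  filter_upwards [h1, h2, Lp.coeFn_smul z (fib (toKH f) ω)] with s g1 g2 g3
  rw [g3, Pi.smul_apply, g2]
  exact g1

theorem norm_le_of_fib_le {f g : L22 μ m} {C : ℝ} (hC : 0 ≤ C)
    (h : ∀ᵐ ω ∂μ, ‖fib (toKH f) ω‖ ≤ C * ‖fib (toKH g) ω‖) : ‖f‖ ≤ C * ‖g‖ := by
  have h1 := norm22_le_of_fib_le hC h
  rw [norm22_toKH, norm22_toKH, ← ofReal_norm, ← ofReal_norm, ← ENNReal.ofReal_mul hC] at h1
  exact (ENNReal.ofReal_le_ofReal_iff (by positivity)).1 h1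

theorem exists_diag22 (hx : ∀ i j, inner0 (x i) (x j) = if i = j then 1 else 0) {a : ℕ → L0 μ}
    {c : L0 μ} {C : ℝ} (ha : ∀ᵐ ω ∂μ, ∀ n, ‖a n ω‖ ≤ C) (hc : ∀ᵐ ω ∂μ, ‖c ω‖ ≤ C)
    (hC : 0 ≤ C) :
    ∃ D : L22 μ m →L[ℂ] L22 μ m, ∀ f, ∀ᵐ ω ∂μ, IsDiag (fun n => fib (x n) ω) (fun n => a n ω)
      (c ω) (fib (toKH f) ω) (fib (toKH (D f)) ω) := by
  have h1 : ∀ f : L22 μ m, ∃ g : L22 μ m, ∀ᵐ ω ∂μ, IsDiag (fun n => fib (x n) ω)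
      (fun n => a n ω) (c ω) (fib (toKH f) ω) (fib (toKH g) ω) := fun f => by
    obtain ⟨w, hw⟩ := exists_diag hx c (by filter_upwards [ha] with ω h; exact ⟨C, h⟩) (toKH f)
    obtain ⟨g, hg⟩ := exists_L22_of_fib_le (u := w) hC f (by
      filter_upwards [hw, ae_orthonormal_fib hx, ha, hc] with ω h1 h2 h3 h4
      exact h1.norm_le h2 h3 h4)
    exact ⟨g, by rwa [hg]⟩
  choose D hD using h1
  refine ⟨LinearMap.mkContinuous ⟨⟨D, fun f g => ?_⟩, fun z f => ?_⟩ C fun f => ?_, hD⟩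
  · apply toKH_injective
    apply KH_ext
    filter_upwards [hD f, hD g, hD (f + g), fib_add (toKH f) (toKH g),
      fib_add (toKH (D f)) (toKH (D g))] with ω h1 h2 h3 h4 h5
    rw [toKH_add, h4] at h3
    rw [toKH_add, h5]
    exact h3.unique (h1.add h2)
  · apply toKH_injective
    apply KH_ext
    filter_upwards [hD f, hD (z • f), fib_toKH_smul z f, fib_toKH_smul z (D f)] with ω h1 h2 h3 h4
    rw [h3] at h2
    rw [RingHom.id_apply, h4]
    exact h2.unique (h1.smul _)
  · refine norm_le_of_fib_le hC ?_
    filter_upwards [hD f, ae_orthonormal_fib hx, ha, hc] with ω h1 h2 h3 h4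
    exact h1.norm_le h2 h3 h4

theorem tendsto_norm22_sub_diagSumKH
    (hx : ∀ i j, inner0 (x i) (x j) = if i = j then 1 else 0) {a : ℕ → L0 μ}
    {c : L0 μ} {C : ℝ} (ha : ∀ᵐ ω ∂μ, ∀ n, ‖a n ω‖ ≤ C) (hc : ∀ᵐ ω ∂μ, ‖c ω‖ ≤ C)
    {f : L22 μ m} {w : KH μ m} (hw : ∀ᵐ ω ∂μ, IsDiag (fun n => fib (x n) ω) (fun n => a n ω)
      (c ω) (fib (toKH f) ω) (fib w ω)) :
    Tendsto (fun N => norm22 (w - diagSumKH x a c (toKH f) N)) atTop (𝓝 0) := by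
  refine tendsto_norm22_zero_of_le _ (C := C + C) f (fun N => ?_) ?_
  · filter_upwards [fib_sub w (diagSumKH x a c (toKH f) N), fib_diagSumKH x a c (toKH f), hw,
      ae_orthonormal_fib hx, ha, hc] with ω h1 h2 h3 h4 h5 h6
    rw [h1, h2, add_mul]
    exact (norm_sub_le _ _).trans (add_le_add (h3.norm_le h4 h5 h6)
      (norm_diagSum_le h4 h5 h6 _ _))
  · filter_upwards [ae_all_iff.2 fun N => fib_sub w (diagSumKH x a c (toKH f) N),
      fib_diagSumKH x a c (toKH f), hw, ae_orthonormal_fib hx, ha] with ω h1 h2 h3 h4 h5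
    simp_rw [h1, h2]
    have := (h3.tendsto h4 h5).const_sub (fib w ω)
    rwa [sub_self] at this

theorem inner_L22 (f g : L22 μ m) :
    inner ℂ f g = ∫ ω, inner ℂ (fib (toKH f) ω) (fib (toKH g) ω) ∂μ := by
  rw [L2.inner_def, integral_prod _ (L2.integrable_inner f g)]
  refine integral_congr_ae ?_
  filter_upwards [coeFn_fib (toKH f), coeFn_fib (toKH g)] with ω h1 h2
  rw [L2.inner_def]
  refine integral_congr_ae ?_
  filter_upwards [h1, h2] with s h3 h4
  rw [h3, h4]
  rfl

theorem isStarProjection_of_diag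
    (hx : ∀ i j, inner0 (x i) (x j) = if i = j then 1 else 0) {a : ℕ → L0 μ}
    {c : L0 μ} (ha : ∀ᵐ ω ∂μ, ∀ n, a n ω = 0 ∨ a n ω = 1) (hc : ∀ᵐ ω ∂μ, c ω = 0 ∨ c ω = 1)
    {D : L22 μ m →L[ℂ] L22 μ m} (hD : ∀ f, ∀ᵐ ω ∂μ, IsDiag (fun n => fib (x n) ω)
      (fun n => a n ω) (c ω) (fib (toKH f) ω) (fib (toKH (D f)) ω)) : IsStarProjection D := by
  constructor
  · refine ContinuousLinearMap.ext fun f => toKH_injective (KH_ext ?_)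
    filter_upwards [hD f, hD (D f), ha, hc] with ω h1 h2 h3 h4
    refine IsDiag.unique ((h1.comp h2).congr (fun n => ?_) ?_) h1
    · rcases h3 n with h | h <;> simp [h]
    · rcases h4 with h | h <;> simp [h]
  · rw [ContinuousLinearMap.isSelfAdjoint_iff_isSymmetric]
    intro f g
    change inner ℂ (D f) g = inner ℂ f (D g)
    rw [inner_L22, inner_L22]
    refine integral_congr_ae ?_
    filter_upwards [hD f, hD g, ha, hc, ae_orthonormal_fib hx] with ω h1 h2 h3 h4 h5
    refine h2.inner_symm h5 (C := 1) (fun n => ?_) (h1.congr (fun n => ?_) ?_)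
    · rcases h3 n with h | h <;> simp [h]
    · rcases h3 n with h | h <;> simp [h]
    · rcases h4 with h | h <;> simp [h]

theorem chiLe_apply (a b : L0h μ) : ∀ᵐ ω ∂μ, chiLe a b ω = if a ω ≤ b ω then 1 else 0 := by
  filter_upwards [chi_apply (μ := μ) {ω | a ω ≤ b ω}
    (measurableSet_le a.measurable b.measurable)] with ω h
  rw [chiLe, h, indicator_apply]
  rfl

theorem exists_spectralFamily (hx : ∀ i j, inner0 (x i) (x j) = if i = j then 1 else 0)
    (lam : ℕ → L0h μ) : ∃ E : L0h μ → L22 μ m →L[ℂ] L22 μ m, IsSpectralFamily lam x E ∧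
      ∀ l f, ∀ᵐ ω ∂μ, IsDiag (fun n => fib (x n) ω) (fun n => if lam n ω ≤ l ω then 1 else 0)
        (if 0 ≤ l ω then 1 else 0) (fib (toKH f) ω) (fib (toKH (E l f)) ω) := by
  have h0 : ∀ l, ∀ᵐ ω ∂μ, ∀ n, chiLe (lam n) l ω = if lam n ω ≤ l ω then 1 else 0 := fun l =>
    ae_all_iff.2 fun n => chiLe_apply _ _
  have h0' : ∀ l : L0h μ, ∀ᵐ ω ∂μ, chiLe 0 l ω = if 0 ≤ l ω then 1 else 0 := fun l => by
    filter_upwards [chiLe_apply 0 l, (AEEqFun.coeFn_zero : ⇑(0 : L0h μ) =ᵐ[μ] 0)] with ω h1 h2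
    rw [h1, h2, Pi.zero_apply]
  have h1 : ∀ l, ∀ᵐ ω ∂μ, ∀ n, chiLe (lam n) l ω = 0 ∨ chiLe (lam n) l ω = 1 := fun l => by
    filter_upwards [h0 l] with ω h n
    rw [h]
    split_ifs <;> simp
  have h1' : ∀ l : L0h μ, ∀ᵐ ω ∂μ, chiLe 0 l ω = 0 ∨ chiLe 0 l ω = 1 := fun l => by
    filter_upwards [h0' l] with ω h
    rw [h]
    split_ifs <;> simp
  have h2 : ∀ l, ∀ᵐ ω ∂μ, ∀ n, ‖chiLe (lam n) l ω‖ ≤ 1 := fun l => by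
    filter_upwards [h1 l] with ω h n
    rcases h n with h | h <;> simp [h]
  have h2' : ∀ l : L0h μ, ∀ᵐ ω ∂μ, ‖chiLe 0 l ω‖ ≤ 1 := fun l => by
    filter_upwards [h1' l] with ω h
    rcases h with h | h <;> simp [h]
  choose E hE using fun l : L0h μ => exists_diag22 hx (h2 l) (h2' l) zero_le_one
  refine ⟨E, fun l => ⟨isStarProjection_of_diag hx (h1 l) (h1' l) (hE l), fun f =>
    tendsto_norm22_sub_diagSumKH hx (h2 l) (h2' l) (hE l f)⟩, fun l f => ?_⟩
  filter_upwards [hE l f, h0 l, h0' l] with ω g1 g2 g3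
  exact g1.congr g2 g3

end DiagonalOperators

/-! ### The expansion in eigenfunctions -/

/-- An orthonormal system of eigenfunctions whose orthogonal complement is annihilated by `T`. -/
structure IsEigenBasis (k : Kernel μ m) (lam : ℕ → L0h μ) (x : ℕ → KH μ m) : Prop where
  eigen : ∀ n, opKH k (x n) = ofReal0 (lam n) • x n
  orthonormal : ∀ i j, inner0 (x i) (x j) = if i = j then 1 else 0
  ker : ∀ f, (∀ n, inner0 f (x n) = 0) → opKH k f = 0

namespace IsEigenBasis

variable {k : Kernel μ m} {lam : ℕ → L0h μ} {x : ℕ → KH μ m}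

theorem fibOp_eq (h : IsEigenBasis k lam x) :
    ∀ᵐ ω ∂μ, ∀ n, fibOp k ω (fib (x n) ω) = (lam n ω : ℂ) • fib (x n) ω := by
  rw [ae_all_iff]
  intro n
  filter_upwards [fib_opKH k (x n), fib_smul (ofReal0 (lam n)) (x n), ofReal0_apply (lam n)]
    with ω h1 h2 h3
  rw [← h1, h.eigen, h2, h3]

/-- The Hilbert–Schmidt bound on the orthonormal fibers. It yields both the convergence of the
eigenvalues to zero and their uniform boundedness. -/
theorem exists_sum_sq_le (h : IsEigenBasis k lam x) :
    ∃ C : ℝ, ∀ᵐ ω ∂μ, ∀ s : Finset ℕ, ∑ n ∈ s, |lam n ω| ^ 2 ≤ C := by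
  obtain ⟨C, -, hC⟩ := sum_sq_fibOp_le k
  refine ⟨C, ?_⟩
  filter_upwards [h.fibOp_eq, ae_orthonormal_fib h.orthonormal] with ω h1 h2 s
  have h3 := hC ω (v := fun n => fib (x n) ω) ⟨fun n => Or.inr (h2.1 n), h2.2⟩ s
  simp_rw [h1, norm_smul, h2.1, mul_one, Complex.norm_real, Real.norm_eq_abs] at h3
  exact h3

theorem tendsto (h : IsEigenBasis k lam x) :
    ∀ᵐ ω ∂μ, Tendsto (fun n => lam n ω) atTop (𝓝 0) := by
  obtain ⟨C, hC⟩ := h.exists_sum_sq_le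
  filter_upwards [hC] with ω hω
  have h1 : Summable fun n => |lam n ω| ^ 2 := summable_of_sum_le (fun n => by positivity) hω
  have h2 := h1.tendsto_atTop_zero.sqrt
  simp_rw [Real.sqrt_sq (abs_nonneg _), Real.sqrt_zero] at h2
  exact (tendsto_zero_iff_abs_tendsto_zero _).2 h2

theorem exists_bound (h : IsEigenBasis k lam x) :
    ∃ C : ℝ, 0 ≤ C ∧ ∀ᵐ ω ∂μ, ∀ n, |lam n ω| ≤ C := by
  obtain ⟨C, hC⟩ := h.exists_sum_sq_le
  refine ⟨Real.sqrt C, Real.sqrt_nonneg _, ?_⟩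
  filter_upwards [hC] with ω hω n
  have h1 := hω {n}
  rw [Finset.sum_singleton] at h1
  exact Real.le_sqrt_of_sq_le h1

theorem lam_nonneg (h : IsEigenBasis k lam x) (hpos : IsPosSemidefKernel k) :
    ∀ᵐ ω ∂μ, ∀ n, 0 ≤ lam n ω := by
  filter_upwards [h.fibOp_eq, ae_orthonormal_fib h.orthonormal,
    ae_all_iff.2 fun n => inner_fibOp_nonneg hpos (x n)] with ω h1 h2 h3 n
  have h4 := h3 n
  rw [h1, inner_smul_right, inner_self_eq_norm_sq_to_K, h2.1] at h4
  simpa using h4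

/-- Let `P` be the component of `u` in the closed span of the system. `T` annihilates `u - P`, and
on `P` continuity of the fiber operator moves it inside the expansion. -/
theorem isDiag_opKH (h : IsEigenBasis k lam x) (u : KH μ m) :
    ∀ᵐ ω ∂μ, IsDiag (fun n => fib (x n) ω) (fun n => (lam n ω : ℂ)) 0 (fib u ω)
      (fib (opKH k u) ω) := by
  obtain ⟨C, -, hC⟩ := h.exists_bound
  have h1' : ∀ᵐ ω ∂μ, ∀ n : ℕ, ((fun _ => 1 : ℕ → L0 μ) n) ω = 1 := by
    filter_upwards [(AEEqFun.coeFn_one : ⇑(1 : L0 μ) =ᵐ[μ] 1)] with ω h1 n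
    exact h1
  have h0' : ∀ᵐ ω ∂μ, (0 : L0 μ) ω = 0 := AEEqFun.coeFn_zero
  obtain ⟨P, hP⟩ := exists_diag h.orthonormal (a := fun _ => 1) 0
    (by filter_upwards [h1'] with ω h1; exact ⟨1, fun n => by rw [h1 n, norm_one]⟩) u
  have hker : opKH k (u - P) = 0 := h.ker _ fun n => by
    rw [inner0_eq_zero_iff]
    filter_upwards [hP, fib_sub u P, h1'] with ω h1 h2 h3
    rw [h2, inner_sub_right, h1.inner_eq, h3 n, one_mul, sub_self]
  have hTP : opKH k u = opKH k P := by rwa [map_sub, sub_eq_zero] at hker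
  rw [hTP]
  filter_upwards [hP, h1', h0', hC, h.fibOp_eq, fib_opKH k P, ae_orthonormal_fib h.orthonormal]
    with ω h1 h2 h3 h4 h5 h6 h7
  have h8 : ∀ n, ‖(lam n ω : ℂ)‖ ≤ C := fun n => by
    rw [Complex.norm_real]
    exact h4 n
  obtain ⟨y, hy1, hy2⟩ := exists_tendsto_diagSum h7 h8 0 (fib u ω)
  have h9 := ((fibOp k ω).continuous.tendsto _).comp
    (h1.tendsto h7 (C := 1) fun n => by rw [h2 n, norm_one])
  rw [h6, tendsto_nhds_unique h9 (hy2.congr fun N => ?_)]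
  · exact hy1
  · simp only [Function.comp_apply, diagSum, h3, zero_smul, add_zero, map_sum, map_smul, h5,
      smul_smul]
    refine Finset.sum_congr rfl fun n _ => ?_
    rw [show (1 : L0 μ) ω = 1 from h2 0, one_mul, mul_comm]

theorem hasEigenExpansion (h : IsEigenBasis k lam x) : HasEigenExpansion k lam x := by
  intro f
  obtain ⟨C, hC0, hC⟩ := h.exists_bound
  have hl := ae_all_iff.2 fun n => ofReal0_apply (lam n)
  have h0' : ∀ᵐ ω ∂μ, (0 : L0 μ) ω = 0 := AEEqFun.coeFn_zero
  have h1 := tendsto_norm22_sub_diagSumKH h.orthonormal (a := fun n => ofReal0 (lam n)) (c := 0)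
    (C := C) (by
      filter_upwards [hC, hl] with ω h1 h2 n
      rw [h2, Complex.norm_real]
      exact h1 n) (by filter_upwards [h0'] with ω h1; rw [h1, norm_zero]; exact hC0)
    (f := f) (w := opKH k (toKH f)) (by
      filter_upwards [h.isDiag_opKH (toKH f), hl, h0'] with ω h1 h2 h3
      exact h1.congr (fun n => (h2 n).symm) h3.symm)
  simp_rw [diagSumKH, zero_smul, add_zero] at h1
  exact h1

theorem isCompleteSystem (h : IsEigenBasis k lam x)
    (hcomp : ∀ f, (∀ n, inner0 f (x n) = 0) → f = 0) : IsCompleteSystem x := by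
  intro f
  have h1' : ∀ᵐ ω ∂μ, ∀ n : ℕ, ((fun _ => 1 : ℕ → L0 μ) n) ω = 1 := by
    filter_upwards [(AEEqFun.coeFn_one : ⇑(1 : L0 μ) =ᵐ[μ] 1)] with ω h1 n
    exact h1
  have h0' : ∀ᵐ ω ∂μ, (0 : L0 μ) ω = 0 := AEEqFun.coeFn_zero
  obtain ⟨P, hP⟩ := exists_diag h.orthonormal (a := fun _ => 1) 0
    (by filter_upwards [h1'] with ω h1; exact ⟨1, fun n => by rw [h1 n, norm_one]⟩) (toKH f)
  have hfP : toKH f = P := by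
    refine sub_eq_zero.1 (hcomp _ fun n => ?_)
    rw [inner0_eq_zero_iff]
    filter_upwards [hP, fib_sub (toKH f) P, h1'] with ω h1 h2 h3
    rw [h2, inner_sub_right, h1.inner_eq, h3 n, one_mul, sub_self]
  have h1 := tendsto_norm22_sub_diagSumKH h.orthonormal (a := fun _ => 1) (c := 0)
    (C := 1) (by filter_upwards [h1'] with ω h1 n; rw [h1 n, norm_one])
    (by filter_upwards [h0'] with ω h1; rw [h1, norm_zero]; exact zero_le_one) hP
  rw [← hfP] at h1
  simp_rw [diagSumKH, zero_smul, add_zero, one_smul] at h1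
  exact h1

end IsEigenBasis

end

end PartInt

namespace PartInt

noncomputable section

variable {Ω S : Type*} [MeasurableSpace Ω] [MeasurableSpace S]
variable {μ : Measure Ω} {m : Measure S} [IsFiniteMeasure μ] [IsFiniteMeasure m]

/-! ### The bounds of the numerical range -/

namespace IsEigenBasis

variable {k : Kernel μ m} {lam : ℕ → L0h μ} {x : ℕ → KH μ m}

theorem lam_mem_numericalRange (h : IsEigenBasis k lam x) (n : ℕ) :
    lam n ∈ numericalRange k := by
  refine ⟨x n, ?_, ?_⟩
  · apply AEEqFun.ext
    filter_upwards [norm0_apply (x n), ae_orthonormal_fib h.orthonormal,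
      (AEEqFun.coeFn_one : ⇑(1 : L0h μ) =ᵐ[μ] 1)] with ω h1 h2 h3
    rw [h1, h2.1, h3, Pi.one_apply]
  · apply AEEqFun.ext
    filter_upwards [inner0_apply (opKH k (x n)) (x n), ae_orthonormal_fib h.orthonormal,
      ofReal0_apply (lam n), h.fibOp_eq, fib_opKH k (x n)] with ω h1 h2 h3 h4 h5
    rw [h1, h3, h5, h4, inner_smul_right, inner_self_eq_norm_sq_to_K, h2.1]
    simp

/-- The eigenvalues belong to the numerical range and tend to zero pointwise, so no lower bound is
positive anywhere. -/
theorem isGLB_numericalRange (h : IsEigenBasis k lam x) (hpos : IsPosSemidefKernel k) :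
    IsGLB (numericalRange k) 0 := by
  constructor
  · rintro a ⟨u, -, hu⟩
    rw [← AEEqFun.coeFn_le]
    filter_upwards [inner0_apply (opKH k u) u, inner_fibOp_nonneg hpos u, fib_opKH k u,
      ofReal0_apply a, (AEEqFun.coeFn_zero : ⇑(0 : L0h μ) =ᵐ[μ] 0)] with ω h1 h2 h3 h4 h5
    rw [← hu, h3, h4] at h1
    rw [← h1] at h2
    rw [h5]
    exact_mod_cast h2
  · intro c hc
    rw [← AEEqFun.coeFn_le]
    filter_upwards [h.tendsto, ae_all_iff.2 fun n =>
      AEEqFun.coeFn_le.2 (hc (h.lam_mem_numericalRange n)),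
      (AEEqFun.coeFn_zero : ⇑(0 : L0h μ) =ᵐ[μ] 0)] with ω h1 h2 h3
    rw [h3]
    exact ge_of_tendsto' h1 h2

/-- The supremum is the pointwise supremum of the eigenvalues: these are attained values, and the
diagonal norm bound with Cauchy–Schwarz shows that nothing exceeds it. -/
theorem exists_isLUB_numericalRange (h : IsEigenBasis k lam x) (hpos : IsPosSemidefKernel k) :
    ∃ (b : L0h μ) (C : ℝ), IsLUB (numericalRange k) b ∧ (∀ᵐ ω ∂μ, ∀ n, lam n ω ≤ b ω) ∧
      ∀ᵐ ω ∂μ, b ω ≤ C := by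
  obtain ⟨C, -, hC⟩ := h.exists_bound
  have hmeas : Measurable fun ω => ⨆ n, lam n ω := Measurable.iSup fun n => (lam n).measurable
  let b : L0h μ := AEEqFun.mk _ hmeas.aestronglyMeasurable
  have hb : ∀ᵐ ω ∂μ, b ω = ⨆ n, lam n ω := AEEqFun.coeFn_mk _ _
  have hle : ∀ᵐ ω ∂μ, ∀ n, lam n ω ≤ b ω := by
    filter_upwards [hb, hC] with ω h1 h2 n
    rw [h1]
    exact le_ciSup (f := fun n => lam n ω)
      ⟨C, by rintro _ ⟨i, rfl⟩; exact (le_abs_self _).trans (h2 i)⟩ n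
  have hbC : ∀ᵐ ω ∂μ, b ω ≤ C := by
    filter_upwards [hb, hC] with ω h1 h2
    rw [h1]
    exact ciSup_le fun n => (le_abs_self _).trans (h2 n)
  refine ⟨b, C, ⟨?_, fun c hc => ?_⟩, hle, hbC⟩
  · rintro a ⟨u, hu1, hu⟩
    rw [← AEEqFun.coeFn_le]
    have hn := norm0_apply u
    rw [hu1] at hn
    filter_upwards [inner0_apply (opKH k u) u, hn, hle, h.lam_nonneg hpos,
      ofReal0_apply a, (AEEqFun.coeFn_one : ⇑(1 : L0h μ) =ᵐ[μ] 1), h.isDiag_opKH u,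
      ae_orthonormal_fib h.orthonormal] with ω h1 h2 h3 h4 h5 h6 h7 h8
    rw [h6, Pi.one_apply] at h2
    have h9 := h7.norm_le h8 (C := b ω) (fun n => by
      rw [Complex.norm_real, Real.norm_of_nonneg (h4 n)]
      exact h3 n) (by rw [norm_zero]; exact (h4 0).trans (h3 0))
    rw [← h2, mul_one] at h9
    rw [← hu, h5] at h1
    have h10 := norm_inner_le_norm (𝕜 := ℂ) (fib u ω) (fib (opKH k u) ω)
    rw [← h1, ← h2, one_mul, Complex.norm_real] at h10
    exact (le_abs_self _).trans (h10.trans h9)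
  · rw [← AEEqFun.coeFn_le]
    filter_upwards [hb, ae_all_iff.2 fun n =>
      AEEqFun.coeFn_le.2 (hc (h.lam_mem_numericalRange n))] with ω h1 h2
    rw [h1]
    exact ciSup_le h2

end IsEigenBasis

/-! ### Functional calculus -/

/-- `β` is the essential supremum. The last clause serves to find a single point at which `b` is
almost `β` and a given almost-everywhere property holds. -/
theorem exists_essential_bound (hμ : μ ≠ 0) {b : Ω → ℝ} {C : ℝ} (h0 : ∀ᵐ ω ∂μ, 0 ≤ b ω)
    (hC : ∀ᵐ ω ∂μ, b ω ≤ C) :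
    ∃ β : ℝ, 0 ≤ β ∧ (∀ᵐ ω ∂μ, b ω ≤ β) ∧ ∀ r < β, ∃ᵐ ω ∂μ, r < b ω := by
  have : (ae μ).NeBot := ae_neBot.2 hμ
  let A : Set ℝ := {r | ∀ᵐ ω ∂μ, b ω ≤ r}
  have hA0 : ∀ r ∈ A, 0 ≤ r := fun r hr => by
    obtain ⟨ω, h1, h2⟩ := (h0.and hr).exists
    exact h1.trans h2
  have hne : A.Nonempty := ⟨C, hC⟩
  have hbd : BddBelow A := ⟨0, hA0⟩
  refine ⟨sInf A, le_csInf hne hA0, ?_, fun r hr => ?_⟩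
  · have h1 : ∀ n : ℕ, ∀ᵐ ω ∂μ, b ω ≤ sInf A + 1 / ((n : ℝ) + 1) := fun n => by
      obtain ⟨r, hr, hlt⟩ := exists_lt_of_csInf_lt hne
        (show sInf A < sInf A + 1 / ((n : ℝ) + 1) from lt_add_of_pos_right _ (by positivity))
      filter_upwards [hr] with ω hω
      exact hω.trans hlt.le
    filter_upwards [ae_all_iff.2 h1] with ω hω
    have h2 := tendsto_one_div_add_atTop_nhds_zero_nat (𝕜 := ℝ) |>.const_add (sInf A)
    rw [add_zero] at h2
    exact ge_of_tendsto' h2 hω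
  · intro hcon
    refine absurd (csInf_le hbd (show r ∈ A from ?_)) (not_le.2 hr)
    filter_upwards [hcon] with ω hω
    exact not_lt.1 hω

theorem exists_complex_polynomial_near {F : ℝ → ℂ} (hF : Continuous F) (c : ℝ) {η : ℝ}
    (hη : 0 < η) : ∃ P : Polynomial ℂ, ∀ t ∈ Icc 0 c, ‖P.eval (t : ℂ) - F t‖ ≤ η := by
  obtain ⟨p, hp⟩ := exists_polynomial_near_of_continuousOn 0 c (fun t => (F t).re)
    (Complex.continuous_re.comp hF).continuousOn (η / 2) (half_pos hη)
  obtain ⟨q, hq⟩ := exists_polynomial_near_of_continuousOn 0 c (fun t => (F t).im)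
    (Complex.continuous_im.comp hF).continuousOn (η / 2) (half_pos hη)
  refine ⟨p.map Complex.ofRealHom + Polynomial.C Complex.I * q.map Complex.ofRealHom,
    fun t ht => ?_⟩
  have h1 : ∀ r : Polynomial ℝ, (r.map Complex.ofRealHom).eval (t : ℂ) = ((r.eval t : ℝ) : ℂ) :=
    fun r => Polynomial.eval_map_apply (f := Complex.ofRealHom) t
  rw [Polynomial.eval_add, Polynomial.eval_mul, Polynomial.eval_C, h1, h1]
  have h2 : ((p.eval t : ℝ) : ℂ) + Complex.I * ((q.eval t : ℝ) : ℂ) - F t =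
      ((p.eval t - (F t).re : ℝ) : ℂ) + Complex.I * ((q.eval t - (F t).im : ℝ) : ℂ) := by
    apply Complex.ext <;> simp
  rw [h2]
  refine (norm_add_le _ _).trans ?_
  rw [norm_mul, Complex.norm_I, one_mul, Complex.norm_real, Complex.norm_real, Real.norm_eq_abs,
    Real.norm_eq_abs]
  linarith [hp t ht, hq t ht]

namespace IsEigenBasis

variable {k : Kernel μ m} {lam : ℕ → L0h μ} {x : ℕ → KH μ m}

theorem isDiag_pow_op22 (h : IsEigenBasis k lam x) (j : ℕ) (g : L22 μ m) :
    ∀ᵐ ω ∂μ, IsDiag (fun n => fib (x n) ω) (fun n => (lam n ω : ℂ) ^ j) (0 ^ j)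
      (fib (toKH g) ω) (fib (toKH ((op22 k ^ j) g)) ω) := by
  induction j with
  | zero =>
    refine Eventually.of_forall fun ω => ?_
    have h1 := isDiag_self (v := fun n => fib (x n) ω) (h := fib (toKH g) ω) 1
    rw [one_smul] at h1
    exact h1.congr (fun n => (pow_zero _).symm) (pow_zero _).symm
  | succ j ih =>
    filter_upwards [ih, h.isDiag_opKH (toKH ((op22 k ^ j) g))] with ω h1 h2
    rw [pow_succ' (op22 k)]
    exact (h1.comp h2).congr (fun n => (pow_succ' _ _).symm) (pow_succ' _ _).symm

theorem isDiag_aeval_op22 (h : IsEigenBasis k lam x) (P : Polynomial ℂ) (g : L22 μ m) :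
    ∀ᵐ ω ∂μ, IsDiag (fun n => fib (x n) ω) (fun n => P.eval (lam n ω : ℂ)) (P.eval 0)
      (fib (toKH g) ω) (fib (toKH (Polynomial.aeval (op22 k) P g)) ω) := by
  induction P using Polynomial.induction_on' with
  | add p q hp hq =>
    filter_upwards [hp, hq, fib_add (toKH (Polynomial.aeval (op22 k) p g))
      (toKH (Polynomial.aeval (op22 k) q g))] with ω h1 h2 h3
    rw [map_add, add_apply, toKH_add, h3]
    exact (h1.add_coeff h2).congr (fun n => Polynomial.eval_add.symm) Polynomial.eval_add.symm
  | monomial j z =>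
    filter_upwards [h.isDiag_pow_op22 j g, fib_toKH_smul z ((op22 k ^ j) g)] with ω h1 h2
    rw [Polynomial.aeval_monomial, Algebra.algebraMap_eq_smul_one, smul_one_mul,
      smul_apply, h2]
    exact (h1.smul_coeff z).congr (fun n => (Polynomial.eval_monomial).symm)
      Polynomial.eval_monomial.symm

theorem isSelfAdjoint_op22 (hk : IsHermitianKernel k) : IsSelfAdjoint (op22 k) := by
  rw [ContinuousLinearMap.isSelfAdjoint_iff_isSymmetric]
  intro f g
  change inner ℂ (op22 k f) g = inner ℂ f (op22 k g)
  rw [inner_L22, inner_L22]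
  refine integral_congr_ae ?_
  filter_upwards [fibOp_symm hk, fib_opKH k (toKH f), fib_opKH k (toKH g)] with ω h1 h2 h3
  rw [toKH_op22, toKH_op22, h2, h3, h1]

theorem op22_nonneg (hk : IsHermitianKernel k) (hpos : IsPosSemidefKernel k) : 0 ≤ op22 k := by
  rw [ContinuousLinearMap.nonneg_iff_isPositive, ContinuousLinearMap.isPositive_iff]
  have hsym := ContinuousLinearMap.isSelfAdjoint_iff_isSymmetric.1 (isSelfAdjoint_op22 hk)
  refine ⟨hsym, fun f => ?_⟩
  rw [show inner ℂ (op22 k f) f = inner ℂ f (op22 k f) from hsym f f, inner_L22]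
  have h1 : ∀ᵐ ω ∂μ, inner ℂ (fib (toKH f) ω) (fib (toKH (op22 k f)) ω) =
      ((inner ℂ (fib (toKH f) ω) (fib (toKH (op22 k f)) ω) : ℂ).re : ℂ) ∧
      0 ≤ (inner ℂ (fib (toKH f) ω) (fib (toKH (op22 k f)) ω) : ℂ).re := by
    filter_upwards [inner_fibOp_nonneg hpos (toKH f), fib_opKH k (toKH f)] with ω h1 h2
    rw [toKH_op22, h2]
    exact ⟨Complex.ext rfl (Complex.le_def.1 h1).2.symm, (Complex.le_def.1 h1).1⟩
  rw [integral_congr_ae (h1.mono fun ω h => h.1), integral_complex_ofReal]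
  exact_mod_cast integral_nonneg_of_ae (h1.mono fun ω h => h.2)

theorem norm_op22_le (h : IsEigenBasis k lam x) {β : ℝ} (hβ : 0 ≤ β)
    (hle : ∀ᵐ ω ∂μ, ∀ n, |lam n ω| ≤ β) : ‖op22 k‖ ≤ β := by
  refine ContinuousLinearMap.opNorm_le_bound _ hβ fun f => norm_le_of_fib_le hβ ?_
  filter_upwards [h.isDiag_opKH (toKH f), ae_orthonormal_fib h.orthonormal, hle] with ω h1 h2 h3
  exact h1.norm_le h2 (fun n => by rw [Complex.norm_real]; exact h3 n)
    (by rw [norm_zero]; exact hβ)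

/-- Positivity makes spectral values real and nonnegative, and their modulus is at most the operator
norm. So continuity of `f` on `[0, β]` is enough for the functional calculus. -/
theorem spectrum_op22 (h : IsEigenBasis k lam x) (hk : IsHermitianKernel k)
    (hpos : IsPosSemidefKernel k) {β : ℝ} (hβ : 0 ≤ β)
    (hle : ∀ᵐ ω ∂μ, ∀ n, |lam n ω| ≤ β) {z : ℂ} (hz : z ∈ spectrum ℂ (op22 k)) :
    (z.re : ℂ) = z ∧ z.re ∈ Icc 0 β := by
  have h1 := spectrum_nonneg_of_nonneg (op22_nonneg hk hpos) hz
  have h2 : (z.re : ℂ) = z := by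
    rw [Complex.le_def] at h1
    exact Complex.ext rfl h1.2
  refine ⟨h2, (Complex.le_def.1 h1).1, ?_⟩
  refine (Complex.re_le_norm z).trans ((spectrum.norm_le_norm_mul_of_mem hz).trans ?_)
  exact (mul_le_of_le_one_right (norm_nonneg _) ContinuousLinearMap.norm_id_le).trans
    (h.norm_op22_le hβ hle)

end IsEigenBasis

end

end PartInt

namespace PartInt

noncomputable section

variable {Ω S : Type*} [MeasurableSpace Ω] [MeasurableSpace S]
variable {μ : Measure Ω} {m : Measure S} [IsFiniteMeasure μ] [IsFiniteMeasure m]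

/-! ### Riemann-Stieltjes sums -/

theorem IsTaggedPartition.ae {a b : L0h μ} {δ : ℝ} {n : ℕ} {p ξ : ℕ → L0h μ}
    (h : IsTaggedPartition a b δ n p ξ) : ∀ᵐ ω ∂μ, p 0 ω = a ω ∧ p n ω = b ω ∧
      ∀ i < n, p i ω ≤ ξ i ω ∧ ξ i ω ≤ p (i + 1) ω ∧ p (i + 1) ω ≤ p i ω + δ := by
  obtain ⟨h0, hn, h⟩ := h
  have h1 : ∀ᵐ ω ∂μ, ∀ i, i < n → p i ω ≤ ξ i ω ∧ ξ i ω ≤ p (i + 1) ω ∧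
      p (i + 1) ω ≤ p i ω + δ := by
    rw [ae_all_iff]
    intro i
    by_cases hi : i < n
    · obtain ⟨g1, g2, g3⟩ := h i hi
      filter_upwards [AEEqFun.coeFn_le.2 g1, AEEqFun.coeFn_le.2 g2, AEEqFun.coeFn_le.2 g3,
        AEEqFun.coeFn_add (p i) (AEEqFun.const Ω δ), AEEqFun.coeFn_const (μ := μ) Ω δ]
        with ω g4 g5 g6 g7 g8 _
      rw [g7, Pi.add_apply, g8] at g6
      exact ⟨g4, g5, g6⟩
    · exact Eventually.of_forall fun ω hlt => absurd hlt hi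
  filter_upwards [h1] with ω h1
  exact ⟨by rw [h0], by rw [hn], h1⟩

theorem le_of_step {n : ℕ} {p ξ : ℕ → ℝ} (h : ∀ i < n, p i ≤ ξ i ∧ ξ i ≤ p (i + 1)) :
    ∀ i ≤ n, p 0 ≤ p i := by
  intro i
  induction i with
  | zero => exact fun _ => le_rfl
  | succ i ih =>
    intro hi
    obtain ⟨h1, h2⟩ := h i (by omega)
    exact (ih (by omega)).trans (h1.trans h2)

section StepSum

variable (F : ℝ → ℂ) (hF : Continuous F) (E : L0h μ → L22 μ m →L[ℂ] L22 μ m) (n : ℕ)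
  (p ξ : ℕ → L0h μ) (g : L22 μ m)

/-- The Riemann-Stieltjes sum of a continuous function as an element of the module. -/
def stepSum : KH μ m :=
  AEEqFun.comp F hF (p 0) • toKH (E (p 0) g) +
    ∑ i ∈ Finset.range n, AEEqFun.comp F hF (ξ i) • (toKH (E (p (i + 1)) g) - toKH (E (p i) g))

theorem coeFn_KH_sum {ι : Type*} (s : Finset ι) (a : ι → L0 μ) (u : ι → KH μ m) :
    ∀ᵐ z ∂(μ.prod m), (∑ i ∈ s, a i • u i : KH μ m).1 z = ∑ i ∈ s, a i z.1 * (u i).1 z := by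
  classical
  induction s using Finset.induction_on with
  | empty =>
    filter_upwards [(AEEqFun.coeFn_zero : ⇑(0 : Ω × S →ₘ[μ.prod m] ℂ) =ᵐ[μ.prod m] 0)] with z hz
    simpa using hz
  | insert j s hj ih =>
    filter_upwards [ih, AEEqFun.coeFn_add (a j • (u j).1) (∑ i ∈ s, a i • u i : KH μ m).1,
      coeFn_L0_smul (a j) (u j).1] with z h1 h2 h3
    rw [Finset.sum_insert hj, Finset.sum_insert hj, ← h1, ← h3]
    exact h2

theorem coeFn_stepSum : ∀ᵐ z ∂(μ.prod m), (stepSum F hF E n p ξ g).1 z =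
    stieltjesSum F E n p ξ g z := by
  have h0 : ∀ q : L0h μ, ∀ᵐ z ∂(μ.prod m), AEEqFun.comp F hF q z.1 = F (q z.1) := fun q =>
    Measure.quasiMeasurePreserving_fst.ae (AEEqFun.coeFn_comp F hF q)
  filter_upwards [AEEqFun.coeFn_add (AEEqFun.comp F hF (p 0) • (toKH (E (p 0) g)).1)
      (∑ i ∈ Finset.range n, AEEqFun.comp F hF (ξ i) •
        (toKH (E (p (i + 1)) g) - toKH (E (p i) g)) : KH μ m).1,
    coeFn_KH_sum (Finset.range n) (fun i => AEEqFun.comp F hF (ξ i))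
      (fun i => toKH (E (p (i + 1)) g) - toKH (E (p i) g)),
    coeFn_L0_smul (AEEqFun.comp F hF (p 0)) (toKH (E (p 0) g)).1, h0 (p 0),
    ae_all_iff.2 fun i => h0 (ξ i)] with z h1 h2 h3 h4 h5
  refine h1.trans ?_
  rw [Pi.add_apply, h2, h3, h4]
  simp_rw [h5]
  rfl

variable {lam : ℕ → L0h μ} {x : ℕ → KH μ m}

theorem isDiag_stepSum (hE : ∀ l f, ∀ᵐ ω ∂μ, IsDiag (fun j => fib (x j) ω)
      (fun j => if lam j ω ≤ l ω then 1 else 0) (if 0 ≤ l ω then 1 else 0) (fib (toKH f) ω)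
      (fib (toKH (E l f)) ω)) :
    ∀ᵐ ω ∂μ, IsDiag (fun j => fib (x j) ω)
      (fun j => F (p 0 ω) * (if lam j ω ≤ p 0 ω then 1 else 0) + ∑ i ∈ Finset.range n,
        F (ξ i ω) * ((if lam j ω ≤ p (i + 1) ω then 1 else 0) - (if lam j ω ≤ p i ω then 1 else 0)))
      (F (p 0 ω) * (if 0 ≤ p 0 ω then 1 else 0) + ∑ i ∈ Finset.range n,
        F (ξ i ω) * ((if 0 ≤ p (i + 1) ω then 1 else 0) - (if 0 ≤ p i ω then 1 else 0)))
      (fib (toKH g) ω) (fib (stepSum F hF E n p ξ g) ω) := by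
  filter_upwards [ae_all_iff.2 fun i => hE (p i) g,
    fib_add (AEEqFun.comp F hF (p 0) • toKH (E (p 0) g)) (∑ i ∈ Finset.range n,
      AEEqFun.comp F hF (ξ i) • (toKH (E (p (i + 1)) g) - toKH (E (p i) g))),
    fib_sum (Finset.range n) fun i => AEEqFun.comp F hF (ξ i) •
      (toKH (E (p (i + 1)) g) - toKH (E (p i) g)),
    fib_smul (AEEqFun.comp F hF (p 0)) (toKH (E (p 0) g)),
    ae_all_iff.2 fun i => fib_smul (AEEqFun.comp F hF (ξ i))
      (toKH (E (p (i + 1)) g) - toKH (E (p i) g)),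
    ae_all_iff.2 fun i => fib_sub (toKH (E (p (i + 1)) g)) (toKH (E (p i) g)),
    AEEqFun.coeFn_comp F hF (p 0), ae_all_iff.2 fun i => AEEqFun.coeFn_comp F hF (ξ i)]
    with ω h1 h2 h3 h4 h5 h6 h7 h8
  rw [stepSum, h2, h3, h4, h7]
  simp_rw [h5, h6, h8]
  exact ((h1 0).smul_coeff _).add_coeff
    (isDiag_sum _ _ _ _ fun i _ => ((h1 (i + 1)).sub_coeff (h1 i)).smul_coeff _)

end StepSum

/-- Where a cell begins above zero and above all eigenvalues, the projections no longer increase, so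
the value of `f` at the tag is multiplied by zero. This permits replacing `f`, which is uncontrolled
at such tags, by a continuous function. -/
theorem stieltjesSum_congr {lam : ℕ → L0h μ} {x : ℕ → KH μ m}
    {E : L0h μ → L22 μ m →L[ℂ] L22 μ m} (hE : ∀ l f, ∀ᵐ ω ∂μ, IsDiag (fun j => fib (x j) ω)
      (fun j => if lam j ω ≤ l ω then 1 else 0) (if 0 ≤ l ω then 1 else 0) (fib (toKH f) ω)
      (fib (toKH (E l f)) ω)) {f F : ℝ → ℂ} {n : ℕ} {p ξ : ℕ → L0h μ}
    (h : ∀ᵐ ω ∂μ, f (p 0 ω) = F (p 0 ω) ∧ ∀ i < n, p i ω ≤ p (i + 1) ω ∧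
      (f (ξ i ω) = F (ξ i ω) ∨ 0 ≤ p i ω ∧ ∀ j, lam j ω ≤ p i ω)) (g : L22 μ m) :
    ∀ᵐ z ∂(μ.prod m), stieltjesSum f E n p ξ g z = stieltjesSum F E n p ξ g z := by
  have h1 : ∀ᵐ z ∂(μ.prod m), ∀ i, (p i z.1 ≤ p (i + 1) z.1 ∧ 0 ≤ p i z.1 ∧
      ∀ j, lam j z.1 ≤ p i z.1) → (E (p (i + 1)) g - E (p i) g : L22 μ m) z = 0 := by
    rw [ae_all_iff]
    intro i
    refine (Measure.ae_prod_iff_ae_ae (p := fun z : Ω × S => (p i z.1 ≤ p (i + 1) z.1 ∧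
      0 ≤ p i z.1 ∧ ∀ j, lam j z.1 ≤ p i z.1) → (E (p (i + 1)) g - E (p i) g : L22 μ m) z = 0)
      ?_).2 ?_
    · have hm1 : ∀ q : L0h μ, Measurable fun z : Ω × S => q z.1 := fun q =>
        q.measurable.comp measurable_fst
      have hset : MeasurableSet {z : Ω × S | p i z.1 ≤ p (i + 1) z.1 ∧
          0 ≤ p i z.1 ∧ ∀ j, lam j z.1 ≤ p i z.1} :=
        (measurableSet_le (hm1 _) (hm1 _)).inter ((measurableSet_le measurable_const (hm1 _)).inter
          (by
            change MeasurableSet {z : Ω × S | ∀ j, lam j z.1 ≤ p i z.1}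
            rw [ofPred_forall]
            exact MeasurableSet.iInter fun j => measurableSet_le (hm1 _) (hm1 _)))
      have hset' : MeasurableSet {z : Ω × S | (E (p (i + 1)) g - E (p i) g : L22 μ m) z = 0} :=
        measurableSet_eq_fun (AEEqFun.measurable _) measurable_const
      exact hset.imp hset'
    · filter_upwards [hE (p i) g, hE (p (i + 1)) g, fib_sub (toKH (E (p (i + 1)) g))
        (toKH (E (p i) g)), coeFn_fib (toKH (E (p (i + 1)) g - E (p i) g))] with ω h1 h2 h3 h4
      by_cases hc : p i ω ≤ p (i + 1) ω ∧ 0 ≤ p i ω ∧ ∀ j, lam j ω ≤ p i ω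
      · obtain ⟨c1, c2, c3⟩ := hc
        have h5 := h2.unique (h1.congr (fun j => by rw [if_pos (c3 j), if_pos ((c3 j).trans c1)])
          (by rw [if_pos c2, if_pos (c2.trans c1)]))
        rw [h5, sub_self, ← toKH_sub] at h3
        rw [h3] at h4
        filter_upwards [h4, Lp.coeFn_zero ℂ 2 m] with s h6 h7 _
        rw [h7] at h6
        exact h6.symm
      · exact Eventually.of_forall fun s hcon => absurd hcon hc
  filter_upwards [h1, Measure.quasiMeasurePreserving_fst.ae h] with z h1 ⟨h2, h3⟩
  rw [stieltjesSum, stieltjesSum, h2]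
  congr 1
  refine Finset.sum_congr rfl fun i hi => ?_
  obtain ⟨h4, h5⟩ := h3 i (Finset.mem_range.1 hi)
  rcases h5 with h5 | h5
  · rw [h5]
  · rw [h1 i ⟨h4, h5⟩, mul_zero, mul_zero]

/-! ### Spectral integrals -/

namespace IsEigenBasis

variable {k : Kernel μ m} {lam : ℕ → L0h μ} {x : ℕ → KH μ m}

theorem norm_aeval_sub_cfc_le (h : IsEigenBasis k lam x) (hk : IsHermitianKernel k)
    (hpos : IsPosSemidefKernel k) {β : ℝ} (hβ : 0 ≤ β) (hle : ∀ᵐ ω ∂μ, ∀ n, |lam n ω| ≤ β)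
    {f : ℝ → ℂ} (hf : ContinuousOn f (Icc 0 β)) {P : Polynomial ℂ} {η : ℝ} (hη : 0 ≤ η)
    (hP : ∀ t ∈ Icc 0 β, ‖P.eval (t : ℂ) - f t‖ ≤ η) :
    ‖Polynomial.aeval (op22 k) P - cfc (fun z : ℂ => f z.re) (op22 k)‖ ≤ η := by
  have hn : IsStarNormal (op22 k) := (isSelfAdjoint_op22 hk).isStarNormal
  have hc : ContinuousOn (fun z : ℂ => f z.re) (spectrum ℂ (op22 k)) :=
    hf.comp Complex.continuous_re.continuousOn fun z hz => (h.spectrum_op22 hk hpos hβ hle hz).2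
  rw [← cfc_polynomial P (op22 k) hn, ← cfc_sub _ _ _ P.continuous.continuousOn hc]
  refine norm_cfc_le hη fun z hz => ?_
  obtain ⟨h1, h2⟩ := h.spectrum_op22 hk hpos hβ hle hz
  have h3 := hP _ h2
  rwa [h1] at h3

theorem hasSpectralIntegral_cfc (h : IsEigenBasis k lam x) (hμ : μ ≠ 0)
    (hk : IsHermitianKernel k) (hpos : IsPosSemidefKernel k) {b : L0h μ} {C : ℝ}
    (hb : ∀ᵐ ω ∂μ, ∀ n, lam n ω ≤ b ω) (hC : ∀ᵐ ω ∂μ, b ω ≤ C)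
    {E : L0h μ → L22 μ m →L[ℂ] L22 μ m} (hE : ∀ l f, ∀ᵐ ω ∂μ, IsDiag (fun j => fib (x j) ω)
      (fun j => if lam j ω ≤ l ω then 1 else 0) (if 0 ≤ l ω then 1 else 0) (fib (toKH f) ω)
      (fib (toKH (E l f)) ω)) {ε : ℝ} (hε : 0 < ε) {f : ℝ → ℂ}
    (hf : ∀ᵐ ω ∂μ, ContinuousOn f (Icc 0 (b ω + ε))) :
    HasSpectralIntegral f E 0 (b + AEEqFun.const Ω ε)
      (cfc (fun z : ℂ => f z.re) (op22 k)) := by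
  have hlam := h.lam_nonneg hpos
  have hb0 : ∀ᵐ ω ∂μ, 0 ≤ b ω := by
    filter_upwards [hlam, hb] with ω h1 h2
    exact (h1 0).trans (h2 0)
  obtain ⟨β, hβ, hbβ, hess⟩ := exists_essential_bound hμ hb0 hC
  have hle : ∀ᵐ ω ∂μ, ∀ n, |lam n ω| ≤ β := by
    filter_upwards [hlam, hb, hbβ] with ω h1 h2 h3 n
    rw [abs_of_nonneg (h1 n)]
    exact (h2 n).trans h3
  -- Continuity at one well-chosen point gives a fixed interval `[0, c]` with `c ≥ β + ε / 2`, valid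
  -- for all fibers. The margin `ε` in the upper limit of integration is what makes this possible.
  obtain ⟨ω₀, hω₀, hc⟩ := ((hess (β - ε / 2) (by linarith)).and_eventually hf).exists
  set c := b ω₀ + ε with hcdef
  have hβc : β + ε / 2 ≤ c := by linarith
  have hc0 : 0 ≤ c := by linarith
  -- a bounded uniformly continuous extension of `f`
  let F : ℝ → ℂ := IccExtend hc0 (fun t : Icc (0 : ℝ) c => f t)
  have hFf : ∀ t ∈ Icc 0 c, F t = f t := fun t ht => IccExtend_of_mem hc0 _ ht
  have hFc0 : Continuous fun t : Icc (0 : ℝ) c => f t := hc.domRestrict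
  have hFc : Continuous F := hFc0.Icc_extend'
  have hFu : UniformContinuous F := (CompactSpace.uniformContinuous_of_continuous hFc0).comp
    (LipschitzWith.projIcc hc0).uniformContinuous
  intro g η hη
  -- Three tolerances: from the sum to `F`, from `F` to the polynomial, and from the polynomial in
  -- `T` to `f(T)`. The `+ 1` covers `g = 0`.
  set η' := η / (3 * (‖g‖ + 1)) with hη'def
  have hη' : 0 < η' := by positivity
  obtain ⟨δ₀, hδ₀, hFδ⟩ := Metric.uniformContinuous_iff.1 hFu η' hη'
  obtain ⟨P, hP⟩ := exists_complex_polynomial_near hFc c hη'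
  -- The first bound serves uniform continuity of `F`. The second ensures that a cell whose tag
  -- exceeds `c` starts above `β`, where `stieltjesSum_congr` lets `f` be ignored.
  refine ⟨min (δ₀ / 2) (ε / 2), by positivity, fun n p ξ hpart => ?_⟩
  set δ := min (δ₀ / 2) (ε / 2)
  have hδ : 0 ≤ δ := by positivity
  have hFδ' : ∀ s t, |s - t| ≤ δ → ‖F s - F t‖ ≤ η' := fun s t hst => by
    rw [← dist_eq_norm]
    refine (hFδ ?_).le
    rw [Real.dist_eq]
    linarith [min_le_left (δ₀ / 2) (ε / 2)]
  have hstep : ∀ᵐ ω ∂μ, p 0 ω = 0 ∧ p n ω = b ω + ε ∧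
      ∀ i < n, p i ω ≤ ξ i ω ∧ ξ i ω ≤ p (i + 1) ω ∧ p (i + 1) ω ≤ p i ω + δ := by
    filter_upwards [hpart.ae, AEEqFun.coeFn_add b (AEEqFun.const Ω ε),
      AEEqFun.coeFn_const (μ := μ) Ω ε, (AEEqFun.coeFn_zero : ⇑(0 : L0h μ) =ᵐ[μ] 0)]
      with ω h1 h2 h3 h4
    refine ⟨h1.1.trans h4, h1.2.1.trans ?_, h1.2.2⟩
    rw [h2, Pi.add_apply, h3, Function.const_apply]
  have hsum : ∀ᵐ z ∂(μ.prod m), stieltjesSum f E n p ξ g z = stieltjesSum F E n p ξ g z := by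
    refine stieltjesSum_congr hE ?_ g
    filter_upwards [hstep, hb, hbβ] with ω ⟨h0, _, h1⟩ h2 h3
    refine ⟨by rw [h0, hFf 0 ⟨le_rfl, hc0⟩], fun i hi => ?_⟩
    have hpi : 0 ≤ p i ω := by
      rw [← h0]
      exact le_of_step (p := fun i => p i ω) (ξ := fun i => ξ i ω)
        (fun i hi => ⟨(h1 i hi).1, (h1 i hi).2.1⟩) i hi.le
    obtain ⟨g1, g2, g3⟩ := h1 i hi
    refine ⟨g1.trans g2, ?_⟩
    rcases le_or_gt (ξ i ω) c with g4 | g4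
    · exact Or.inl (hFf _ ⟨hpi.trans g1, g4⟩).symm
    · refine Or.inr ⟨hpi, fun j => (h2 j).trans ?_⟩
      linarith [min_le_right (δ₀ / 2) (ε / 2)]
  -- the sum differs from the polynomial by at most twice the tolerance
  have hfib : ∀ᵐ ω ∂μ, ‖fib (stepSum F hFc E n p ξ g -
      toKH (Polynomial.aeval (op22 k) P g)) ω‖ ≤ (2 * η') * ‖fib (toKH g) ω‖ := by
    filter_upwards [isDiag_stepSum F hFc E n p ξ g hE, h.isDiag_aeval_op22 P g,
      fib_sub (stepSum F hFc E n p ξ g) (toKH (Polynomial.aeval (op22 k) P g)), hstep, hlam, hb,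
      hbβ, ae_orthonormal_fib h.orthonormal] with ω h1 h2 h3 ⟨h40, h4n, h4⟩ h5 h6 h7 h8
    rw [h3]
    have key : ∀ t : ℝ, 0 ≤ t → t ≤ b ω → ‖(F (p 0 ω) * (if t ≤ p 0 ω then 1 else 0) +
        ∑ i ∈ Finset.range n, F (ξ i ω) * ((if t ≤ p (i + 1) ω then 1 else 0) -
          (if t ≤ p i ω then 1 else 0))) - P.eval (t : ℂ)‖ ≤ 2 * η' := fun t ht0 htb => by
      have g1 := norm_step_sub_le F hFδ' hδ n (fun i => p i ω) (fun i => ξ i ω) h4 t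
        (h40.le.trans ht0) (by linarith)
      have g2 := hP t ⟨ht0, by linarith⟩
      rw [norm_sub_rev] at g2
      refine (norm_sub_le_norm_sub_add_norm_sub _ (F t) _).trans ?_
      linarith
    refine (h1.sub_coeff h2).norm_le h8 (fun j => key _ (h5 j) (h6 j)) ?_
    have g3 := key 0 le_rfl ((h5 0).trans (h6 0))
    rwa [Complex.ofReal_zero] at g3
  obtain ⟨w, hw⟩ := exists_L22_of_fib_le (by positivity) g hfib
  have hwn : ‖w‖ ≤ (2 * η') * ‖g‖ := norm_le_of_fib_le (by positivity) (by rwa [hw])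
  have hPA := h.norm_aeval_sub_cfc_le hk hpos hβ hle
    (hc.mono (Icc_subset_Icc_right (by linarith))) hη'.le (P := P) fun t ht => by
      rw [← hFf t ⟨ht.1, by linarith [ht.2]⟩]
      exact hP t ⟨ht.1, by linarith [ht.2]⟩
  set A := cfc (fun z : ℂ => f z.re) (op22 k)
  set Q := Polynomial.aeval (op22 k) P
  have hfinal : eLpNorm (fun z => stieltjesSum f E n p ξ g z - A g z) 2 (μ.prod m) =
      ‖w + (Q g - A g)‖ₑ := by
    rw [Lp.enorm_def]
    refine eLpNorm_congr_ae ?_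
    have hw' : w.1 = (stepSum F hFc E n p ξ g).1 - (Q g).1 :=
      congrArg (fun u : KH μ m => (u : Ω × S →ₘ[μ.prod m] ℂ)) hw
    have hw'' : (w + (Q g - A g)).1 = (stepSum F hFc E n p ξ g).1 - (A g).1 := by
      change w.1 + ((Q g).1 - (A g).1) = _
      rw [hw']
      abel
    filter_upwards [hsum, coeFn_stepSum F hFc E n p ξ g,
      AEEqFun.coeFn_sub (stepSum F hFc E n p ξ g).1 (A g).1] with z h1 h2 h3
    rw [h1, ← h2, hw'']
    exact h3.symm
  rw [hfinal, ← ofReal_norm]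
  refine ENNReal.ofReal_le_ofReal ((norm_add_le _ _).trans ?_)
  have h1 : ‖Q g - A g‖ ≤ η' * ‖g‖ := (Q - A).le_of_opNorm_le hPA g
  have h2 : 3 * η' * (‖g‖ + 1) = η := by
    rw [hη'def]
    field_simp
  nlinarith

theorem cfc_re_op22 (h : IsEigenBasis k lam x) (hk : IsHermitianKernel k)
    (hpos : IsPosSemidefKernel k) : cfc (fun z : ℂ => (z.re : ℂ)) (op22 k) = op22 k := by
  obtain ⟨C, hC0, hC⟩ := h.exists_bound
  have hn : IsStarNormal (op22 k) := (isSelfAdjoint_op22 hk).isStarNormal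
  conv_rhs => rw [← cfc_id' ℂ (op22 k) hn]
  exact cfc_congr fun z hz => (h.spectrum_op22 hk hpos hC0 hC hz).1

end IsEigenBasis

end

end PartInt

namespace PartInt

noncomputable section

/-! ### Eigenvectors of a diagonal operator for a nonzero eigenvalue. -/

section Hilbert

variable {H : Type*} [NormedAddCommGroup H] [InnerProductSpace ℂ H]
variable {v : ℕ → H} {a : ℕ → ℂ} {h : H} {l : ℂ}

theorem IsDiag.inner_eq_zero_of_ne (hy : IsDiag v a 0 h (l • h)) {n : ℕ} (hn : a n ≠ l) :
    inner ℂ (v n) h = 0 := by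
  have h1 := hy.inner_eq n
  rw [inner_smul_right] at h1
  exact (mul_eq_mul_right_iff.1 h1).resolve_left hn.symm

/-- Coordinates with `a n ≠ l` vanish, so the remainder `d` is orthogonal to all `v n`. There the
operator is zero while `h` has eigenvalue `l ≠ 0`, so `d` is orthogonal to `h` too, and hence to
itself. -/
theorem IsDiag.eq_sum_of_eigenvector (hv : Orthonormal ℂ v) (hy : IsDiag v a 0 h (l • h))
    (hl : l ≠ 0) {N : ℕ} (hN : ∀ n, N ≤ n → a n ≠ l) :
    h = ∑ n ∈ Finset.range N, inner ℂ (v n) h • v n := by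
  set d := h - ∑ n ∈ Finset.range N, inner ℂ (v n) h • v n with hd
  have h1 : ∀ n, inner ℂ (v n) d = 0 := fun n => by
    rw [hd, inner_sub_right, inner_sum]
    simp_rw [inner_smul_right, orthonormal_iff_ite.1 hv n]
    by_cases hn : n < N
    · simp [hn]
    · simp [hn, hy.inner_eq_zero_of_ne (hN n (not_lt.1 hn))]
  have h2 : inner ℂ d h = 0 := by
    have h3 := hy.inner_perp d h1
    rw [zero_mul, inner_smul_right] at h3
    exact (mul_eq_zero.1 h3).resolve_left hl
  have h4 : inner ℂ d d = 0 := by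
    nth_rw 2 [hd]
    rw [inner_sub_right, h2, inner_sum, Finset.sum_eq_zero, sub_zero]
    intro n _
    rw [inner_smul_right, inner_eq_zero_symm.1 (h1 n), mul_zero]
  exact sub_eq_zero.1 (inner_self_eq_zero.1 h4)

end Hilbert

variable {Ω S : Type*} [MeasurableSpace Ω] [MeasurableSpace S]
variable {μ : Measure Ω} {m : Measure S} [IsFiniteMeasure μ] [IsFiniteMeasure m]

/-! ### Mixings of the eigenvalues -/

theorem tsum_indicator_of_mem {α : Type*} {A : ℕ → Set α} (hA : Pairwise (Function.onFun Disjoint A))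
    (v : ℕ → α → ℂ) {ω : α} {n : ℕ} (hω : ω ∈ A n) :
    ∑' i, (A i).indicator (v i) ω = v n ω := by
  rw [tsum_eq_single n, indicator_of_mem hω]
  exact fun i hi => indicator_of_notMem (fun hmem => disjoint_left.1 (hA hi) hmem hω) _

/-- Points outside all sets of a disjoint sum give the value `0`, which is why `v 0 = 0` is needed.
Conversely, assigning each point to its first admissible index writes `l` as a single disjoint sum,
so the trivial partition suffices for the mixing. -/
theorem mem_mix_disjointSums {v : ℕ → L0 μ} (hv : v 0 = 0) {l : L0 μ} :
    l ∈ mix (disjointSums v) ↔ ∀ᵐ ω ∂μ, ∃ n, l ω = v n ω := by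
  constructor
  · rintro ⟨A, u, hA, hu, hl⟩
    choose B hBm hB hBu using hu
    filter_upwards [ae_all_iff.2 hl, ae_all_iff.2 hBu, (AEEqFun.coeFn_zero : ⇑(0 : L0 μ) =ᵐ[μ] 0)]
      with ω h1 h2 h3
    obtain ⟨n, hn⟩ := mem_iUnion.1 (hA.cover.ge (mem_univ ω))
    rw [h1 n hn, h2 n]
    by_cases h4 : ∃ i, ω ∈ B n i
    · obtain ⟨i, hi⟩ := h4
      exact ⟨i, tsum_indicator_of_mem (hB n) (fun i => v i) hi⟩
    · refine ⟨0, ?_⟩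
      rw [hv, h3]
      exact (tsum_congr fun i => indicator_of_notMem (fun hi => h4 ⟨i, hi⟩) _).trans tsum_zero
  · intro hl
    let A : ℕ → Set Ω := disjointed fun n => {ω | l ω = v n ω}
    have hAm : ∀ n, MeasurableSet (A n) := fun n =>
      MeasurableSet.disjointed (fun n => measurableSet_eq_fun l.measurable (v n).measurable) n
    have hAd : Pairwise (Function.onFun Disjoint A) := disjoint_disjointed _
    refine ⟨fun n => if n = 0 then univ else ∅, fun _ => l, ⟨fun n => ?_, fun i j hij => ?_, ?_⟩,
      fun _ => ⟨A, hAm, hAd, ?_⟩, fun n => Eventually.of_forall fun ω _ => rfl⟩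
    · split_ifs
      exacts [MeasurableSet.univ, MeasurableSet.empty]
    · change Disjoint (if i = 0 then univ else ∅) (if j = 0 then univ else ∅ : Set Ω)
      split_ifs
      · omega
      all_goals simp
    · exact eq_univ_of_forall fun ω => mem_iUnion.2 ⟨0, by simp⟩
    · filter_upwards [hl] with ω ⟨n, hn⟩
      have h1 : ω ∈ ⋃ n, A n := by
        rw [iUnion_disjointed]
        exact mem_iUnion.2 ⟨n, hn⟩
      obtain ⟨i, hi⟩ := mem_iUnion.1 h1
      rw [tsum_indicator_of_mem hAd (fun i => v i) hi]
      exact disjointed_subset _ i hi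

/-! ### The cyclic modular spectrum -/

theorem ae_eq_zero_or_one {π : L0 μ} (hπ : IsIdempotentElem π) :
    ∀ᵐ ω ∂μ, π ω = 0 ∨ π ω = 1 := by
  filter_upwards [AEEqFun.coeFn_mul π π] with ω h
  rw [show π * π = π from hπ] at h
  exact IsIdempotentElem.iff_eq_zero_or_one.1 (h.symm : π ω * π ω = π ω)

theorem isIdempotentElem_chi (A : Set Ω) (hA : MeasurableSet A) :
    IsIdempotentElem (chi μ A hA) := by
  apply AEEqFun.ext
  filter_upwards [AEEqFun.coeFn_mul (chi μ A hA) (chi μ A hA), chi_apply (μ := μ) A hA]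
    with ω h1 h2
  rw [h1, Pi.mul_apply, h2]
  by_cases h : ω ∈ A <;> simp [h]

/-- A diagonal operator is `L₀`-bounded. -/
theorem isL0Bounded_of_isDiag {x : ℕ → KH μ m}
    (hx : ∀ i j, inner0 (x i) (x j) = if i = j then 1 else 0) {a : ℕ → L0 μ} {c : L0 μ}
    (ha : ∀ᵐ ω ∂μ, ∃ B, ∀ n, ‖a n ω‖ ≤ B) {D : KH μ m →ₗ[L0 μ] KH μ m}
    (hD : ∀ u, ∀ᵐ ω ∂μ,
      IsDiag (fun n => fib (x n) ω) (fun n => a n ω) (c ω) (fib u ω) (fib (D u) ω)) :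
    IsL0Bounded D := by
  have hmeas : Measurable fun ω => max (⨆ n, ‖a n ω‖) ‖c ω‖ :=
    (Measurable.iSup fun n => (a n).measurable.norm).max c.measurable.norm
  refine ⟨AEEqFun.mk _ hmeas.aestronglyMeasurable, fun u => ?_⟩
  rw [← AEEqFun.coeFn_le]
  filter_upwards [AEEqFun.coeFn_mul (AEEqFun.mk _ hmeas.aestronglyMeasurable) (norm0 u),
    AEEqFun.coeFn_mk _ hmeas.aestronglyMeasurable, norm0_apply u, norm0_apply (D u), hD u, ha,
    ae_orthonormal_fib hx] with ω h1 h2 h3 h4 h5 ⟨B, h6⟩ h7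
  rw [h1, Pi.mul_apply, h2, h3, h4]
  refine h5.norm_le h7 (fun n => ?_) (le_max_right _ _)
  exact (le_ciSup (f := fun n => ‖a n ω‖) ⟨B, by rintro _ ⟨i, rfl⟩; exact h6 i⟩ n).trans
    (le_max_left _ _)

namespace IsEigenBasis

variable {k : Kernel μ m} {lam : ℕ → L0h μ} {x : ℕ → KH μ m}

theorem isDiag_opKH_sub (h : IsEigenBasis k lam x) (l : L0 μ) (u : KH μ m) :
    ∀ᵐ ω ∂μ, IsDiag (fun n => fib (x n) ω) (fun n => (lam n ω : ℂ) - l ω) (0 - l ω) (fib u ω)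
      (fib ((opKH k - l • LinearMap.id : KH μ m →ₗ[L0 μ] KH μ m) u) ω) := by
  filter_upwards [h.isDiag_opKH u, fib_sub (opKH k u) (l • u), fib_smul l u] with ω h1 h2 h3
  have h4 : fib ((opKH k - l • LinearMap.id : KH μ m →ₗ[L0 μ] KH μ m) u) ω =
      fib (opKH k u) ω - l ω • fib u ω := by
    rw [← h3, ← h2]
    rfl
  rw [h4]
  exact h1.sub_coeff (isDiag_self _)

/-- Off the eigenvalues and zero, `T - l` has a bounded inverse. -/
theorem isInvertibleOn_chi (h : IsEigenBasis k lam x) (l : L0 μ) {A : Set Ω}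
    (hA : MeasurableSet A) (hl : ∀ ω ∈ A, l ω ≠ 0 ∧ ∀ n, l ω ≠ lam n ω) :
    IsInvertibleOn (chi μ A hA) (opKH k - l • LinearMap.id) := by
  have hma : ∀ n, Measurable (A.indicator fun ω => ((lam n ω : ℂ) - l ω)⁻¹) := fun n =>
    ((Complex.measurable_ofReal.comp (lam n).measurable).sub l.measurable).inv.indicator hA
  have hmc : Measurable (A.indicator fun ω => (0 - l ω)⁻¹) :=
    (measurable_const.sub l.measurable).inv.indicator hA
  let a : ℕ → L0 μ := fun n => toL0 μ _ (hma n)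
  let c : L0 μ := toL0 μ _ hmc
  have ha : ∀ᵐ ω ∂μ, ∀ n, a n ω = A.indicator (fun ω => ((lam n ω : ℂ) - l ω)⁻¹) ω :=
    ae_all_iff.2 fun n => toL0_apply _ _
  have hc : ∀ᵐ ω ∂μ, c ω = A.indicator (fun ω => (0 - l ω)⁻¹) ω := toL0_apply _ _
  -- The coefficients converge to `(0 - l ω)⁻¹`, which is where `l ω ≠ 0` enters; a convergent
  -- sequence is bounded, with a bound depending on `ω`.
  have hbd : ∀ᵐ ω ∂μ, ∃ B, ∀ n, ‖a n ω‖ ≤ B := by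
    filter_upwards [ha, h.tendsto] with ω h1 h2
    by_cases hω : ω ∈ A
    · have h3 : Tendsto (fun n => ((lam n ω : ℂ) - l ω)⁻¹) atTop (𝓝 ((0 - l ω)⁻¹)) := by
        refine Tendsto.inv₀ (Tendsto.sub_const ?_ _) ?_
        · exact (Complex.continuous_ofReal.tendsto 0).comp h2
        · rw [zero_sub]
          exact neg_ne_zero.2 (hl ω hω).1
      obtain ⟨B, hB⟩ := h3.norm.bddAbove_range
      refine ⟨B, fun n => ?_⟩
      rw [h1 n, indicator_of_mem hω]
      exact hB ⟨n, rfl⟩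
    · refine ⟨0, fun n => ?_⟩
      rw [h1 n, indicator_of_notMem hω, norm_zero]
  obtain ⟨D, hD⟩ := exists_diagKH h.orthonormal c hbd
  set T := (opKH k - l • LinearMap.id : KH μ m →ₗ[L0 μ] KH μ m) with hT
  refine ⟨D, isL0Bounded_of_isDiag h.orthonormal hbd hD, ?_, ?_⟩
  · refine LinearMap.ext fun u => KH_ext ?_
    have hcomp : ((chi μ A hA • T) ∘ₗ (chi μ A hA • D)) u =
        chi μ A hA • chi μ A hA • T (D u) := by
      simp
    rw [hcomp, LinearMap.smul_apply, LinearMap.id_apply, smul_smul, (isIdempotentElem_chi A hA).eq]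
    filter_upwards [fib_smul (chi μ A hA) (T (D u)), fib_smul (chi μ A hA) u, hD u,
      h.isDiag_opKH_sub l (D u), ha, hc, chi_apply (μ := μ) A hA] with ω h1 h2 h3 h4 h5 h6 h7
    rw [h1, h2, h7]
    by_cases hω : ω ∈ A
    · have h8 := isDiag_self (v := fun n => fib (x n) ω) (h := fib u ω) 1
      rw [one_smul] at h8
      rw [h8.unique ((h3.comp h4).congr (fun n => ?_) ?_)]
      · rw [h6, indicator_of_mem hω, mul_inv_cancel₀ (sub_ne_zero.2 (hl ω hω).1.symm)]
      · rw [h5 n, indicator_of_mem hω, mul_inv_cancel₀ (sub_ne_zero.2 ((hl ω hω).2 n).symm)]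
    · rw [indicator_of_notMem hω, zero_smul, zero_smul]
  · refine LinearMap.ext fun u => KH_ext ?_
    have hcomp : ((chi μ A hA • D) ∘ₗ (chi μ A hA • T)) u =
        chi μ A hA • chi μ A hA • D (T u) := by
      simp
    rw [hcomp, LinearMap.smul_apply, LinearMap.id_apply, smul_smul, (isIdempotentElem_chi A hA).eq]
    filter_upwards [fib_smul (chi μ A hA) (D (T u)), fib_smul (chi μ A hA) u, hD (T u),
      h.isDiag_opKH_sub l u, ha, hc, chi_apply (μ := μ) A hA] with ω h1 h2 h3 h4 h5 h6 h7
    rw [h1, h2, h7]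
    by_cases hω : ω ∈ A
    · have h8 := isDiag_self (v := fun n => fib (x n) ω) (h := fib u ω) 1
      rw [one_smul] at h8
      rw [h8.unique ((h4.comp h3).congr (fun n => ?_) ?_)]
      · rw [h6, indicator_of_mem hω, inv_mul_cancel₀ (sub_ne_zero.2 (hl ω hω).1.symm)]
      · rw [h5 n, indicator_of_mem hω, inv_mul_cancel₀ (sub_ne_zero.2 ((hl ω hω).2 n).symm)]
    · rw [indicator_of_notMem hω, zero_smul, zero_smul]

/-- A left inverse already leads to a contradiction at points of `π`. Where `l = lam n`, the unit
vector `x n` is annihilated. Where `l = 0`, boundedness by `c` gives `1 ≤ |lam n| * c` for all `n`,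
although `lam n → 0`. -/
theorem not_isInvertibleOn (h : IsEigenBasis k lam x) {l : L0 μ}
    (hl : ∀ᵐ ω ∂μ, l ω = 0 ∨ ∃ n, l ω = lam n ω) {π : L0 μ} (hπ : IsIdempotentElem π)
    (hπ0 : π ≠ 0) : ¬ IsInvertibleOn π (opKH k - l • LinearMap.id) := by
  rintro ⟨R, ⟨c, hc⟩, -, hR⟩
  have hRx : ∀ n, π • (ofReal0 (lam n) - l) • R (x n) = π • x n := fun n => by
    have h1 := LinearMap.congr_fun hR (x n)
    have h2 : (opKH k - l • LinearMap.id : KH μ m →ₗ[L0 μ] KH μ m) (x n) =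
        (ofReal0 (lam n) - l) • x n := by
      change opKH k (x n) - l • x n = _
      rw [h.eigen]
      exact (sub_smul _ _ _).symm
    rw [LinearMap.comp_apply, LinearMap.smul_apply, LinearMap.smul_apply, h2, map_smul, map_smul,
      smul_smul π π, hπ.eq] at h1
    exact h1
  refine hπ0 (AEEqFun.ext ?_)
  filter_upwards [(AEEqFun.coeFn_zero : ⇑(0 : L0 μ) =ᵐ[μ] 0), ae_eq_zero_or_one hπ, hl, h.tendsto,
    ae_orthonormal_fib h.orthonormal,
    ae_all_iff.2 fun n => fib_smul π ((ofReal0 (lam n) - l) • R (x n)),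
    ae_all_iff.2 fun n => fib_smul π (x n),
    ae_all_iff.2 fun n => fib_smul (ofReal0 (lam n) - l) (R (x n)),
    ae_all_iff.2 fun n => AEEqFun.coeFn_sub (ofReal0 (lam n)) l,
    ae_all_iff.2 fun n => ofReal0_apply (lam n),
    ae_all_iff.2 fun n => AEEqFun.coeFn_le.2 (hc (x n)),
    ae_all_iff.2 fun n => AEEqFun.coeFn_mul c (norm0 (x n)),
    ae_all_iff.2 fun n => norm0_apply (x n), ae_all_iff.2 fun n => norm0_apply (R (x n))]
    with ω h0 h1 h2 h3 h4 h5 h6 h7 h8 h9 h10 h11 h12 h13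
  rw [h0, Pi.zero_apply]
  refine h1.resolve_right fun hone => ?_
  have hnorm : ∀ n, ‖fib (x n) ω‖ = 1 := h4.1
  have key : ∀ n, ((lam n ω : ℂ) - l ω) • fib (R (x n)) ω = fib (x n) ω := fun n => by
    have g1 := h5 n
    rw [hRx, h6, h7, hone, one_smul, one_smul, h8, Pi.sub_apply, h9] at g1
    exact g1.symm
  rcases h2 with h2 | ⟨n, h2⟩
  · have g2 : ∀ n, 1 ≤ |lam n ω| * c ω := fun n => by
      have g3 := h10 n
      rw [h11, Pi.mul_apply, h12, h13, hnorm, mul_one] at g3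
      rw [← hnorm n, ← key n, h2, sub_zero, norm_smul, Complex.norm_real, Real.norm_eq_abs]
      gcongr
    have g4 := (h3.abs).mul_const (c ω)
    rw [abs_zero, zero_mul] at g4
    exact absurd (ge_of_tendsto' g4 g2) (by norm_num)
  · have g5 := key n
    rw [h2, sub_self, zero_smul] at g5
    have g6 := hnorm n
    rw [← g5, norm_zero] at g6
    exact zero_ne_one g6

/-- If `l` avoided zero and all eigenvalues on a set of positive measure, the indicator of that set
would be a nonzero idempotent on which `T - l` is invertible. In the other direction `μ ≠ 0` makes
`1` a nonzero idempotent. -/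
theorem mem_cyclicSpectrum_iff (h : IsEigenBasis k lam x) (hμ : μ ≠ 0) (l : L0 μ) :
    l ∈ cyclicSpectrum (opKH k) ↔ ∀ᵐ ω ∂μ, l ω = 0 ∨ ∃ n, l ω = lam n ω := by
  constructor
  · rintro ⟨-, hl⟩
    have hA : MeasurableSet {ω | l ω ≠ 0 ∧ ∀ n, l ω ≠ lam n ω} := by
      refine (measurableSet_eq_fun l.measurable measurable_const).compl.inter ?_
      change MeasurableSet {ω | ∀ n, l ω ≠ lam n ω}
      rw [ofPred_forall]
      exact MeasurableSet.iInter fun n => (measurableSet_eq_fun l.measurable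
        (Complex.measurable_ofReal.comp (lam n).measurable)).compl
    by_contra hcon
    refine hl _ (isIdempotentElem_chi _ hA) (fun h0 => hcon ?_)
      (h.isInvertibleOn_chi l hA fun ω hω => hω)
    filter_upwards [chi_apply (μ := μ) _ hA, (AEEqFun.coeFn_zero : ⇑(0 : L0 μ) =ᵐ[μ] 0)]
      with ω h1 h2
    rw [h0, h2] at h1
    by_contra hω
    push Not at hω
    rw [indicator_of_mem (show ω ∈ {ω | l ω ≠ 0 ∧ ∀ n, l ω ≠ lam n ω} from hω)] at h1
    exact zero_ne_one h1
  · intro hl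
    refine ⟨h.not_isInvertibleOn hl (IsIdempotentElem.one) fun h1 => ?_, fun π hπ hπ0 =>
      h.not_isInvertibleOn hl hπ hπ0⟩
    have : (ae μ).NeBot := ae_neBot.2 hμ
    have h2 : ∀ᵐ ω ∂μ, (1 : ℂ) = 0 := by
      filter_upwards [(AEEqFun.coeFn_zero : ⇑(0 : L0 μ) =ᵐ[μ] 0),
        (AEEqFun.coeFn_one : ⇑(1 : L0 μ) =ᵐ[μ] 1)] with ω g1 g2
      rw [h1, g1] at g2
      exact g2.symm
    obtain ⟨ω, hω⟩ := h2.exists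
    exact one_ne_zero hω

theorem cyclicSpectrum_eq (h : IsEigenBasis k lam x) (hμ : μ ≠ 0) :
    cyclicSpectrum (opKH k) = mix (disjointSums (withZero lam)) := by
  ext l
  rw [h.mem_cyclicSpectrum_iff hμ, mem_mix_disjointSums rfl]
  refine eventually_congr ?_
  filter_upwards [(AEEqFun.coeFn_zero : ⇑(0 : L0 μ) =ᵐ[μ] 0),
    ae_all_iff.2 fun n => ofReal0_apply (lam n)] with ω h1 h2
  constructor
  · rintro (h3 | ⟨n, h3⟩)
    · exact ⟨0, h3.trans h1.symm⟩
    · exact ⟨n + 1, h3.trans (h2 n).symm⟩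
  · rintro ⟨_ | n, h3⟩
    · exact Or.inl (h3.trans h1)
    · exact Or.inr ⟨n, h3.trans (h2 n)⟩

/-! ### Eigenmodules -/

/-- As `lam n ω → 0 ≠ l ω`, only finitely many indices satisfy `lam n ω = l ω`. Ω is split by the
least `N` beyond which there are none; on that piece the fields `x n` with `n < N`, cut down to the
set where `lam n = l`, generate the eigenmodule. -/
theorem isSigmaFG_ker (h : IsEigenBasis k lam x) {l : L0 μ} (hl : ∀ᵐ ω ∂μ, l ω ≠ 0) :
    IsSigmaFG (LinearMap.ker (l • LinearMap.id - opKH k)) := by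
  let B : ℕ → Set Ω := fun N => {ω | ∀ n, N ≤ n → (lam n ω : ℂ) ≠ l ω}
  have hm : ∀ n, MeasurableSet {ω | (lam n ω : ℂ) = l ω} := fun n =>
    measurableSet_eq_fun (Complex.measurable_ofReal.comp (lam n).measurable) l.measurable
  have hB : ∀ N, MeasurableSet (B N) := fun N => by
    have h1 : B N = ⋂ n, ⋂ (_ : N ≤ n), {ω | (lam n ω : ℂ) = l ω}ᶜ := by
      ext ω
      simp [B]
    rw [h1]
    exact MeasurableSet.iInter fun n => MeasurableSet.iInter fun _ => (hm n).compl
  -- The complement of the union is null; including it makes the sets cover every point of Ω, as a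
  -- partition must.
  let A : ℕ → Set Ω := disjointed fun N => B N ∪ (⋃ n, B n)ᶜ
  have hA : IsPartition A := by
    refine ⟨fun N => MeasurableSet.disjointed (fun N => (hB N).union
      (MeasurableSet.iUnion hB).compl) N, disjoint_disjointed _, ?_⟩
    rw [iUnion_disjointed, ← iUnion_union, union_compl_self]
  have hAB : ∀ᵐ ω ∂μ, ∀ N, ω ∈ A N → ∀ n, N ≤ n → (lam n ω : ℂ) ≠ l ω := by
    filter_upwards [hl, h.tendsto] with ω h1 h2 N hN
    refine (disjointed_subset _ N hN).resolve_right fun hcon => hcon ?_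
    have h3 : Tendsto (fun n => (lam n ω : ℂ)) atTop (𝓝 0) :=
      (Complex.continuous_ofReal.tendsto 0).comp h2
    obtain ⟨M, hM⟩ := eventually_atTop.1 (h3.eventually_ne h1.symm)
    exact mem_iUnion.2 ⟨M, hM⟩
  refine ⟨A, hA, fun N => ?_⟩
  have hD : ∀ n, MeasurableSet (A N ∩ {ω | (lam n ω : ℂ) = l ω}) := fun n =>
    (hA.measurable N).inter (hm n)
  rw [Submodule.fg_def]
  refine ⟨(fun n => chi μ _ (hD n) • x n) '' Iio N, (finite_Iio N).image _, le_antisymm ?_ ?_⟩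
  · rw [Submodule.span_le]
    rintro _ ⟨n, -, rfl⟩
    refine ⟨chi μ _ (hD n) • x n, ?_, ?_⟩
    · rw [SetLike.mem_coe, LinearMap.mem_ker]
      change l • chi μ _ (hD n) • x n - opKH k (chi μ _ (hD n) • x n) = 0
      rw [map_smul, h.eigen, smul_smul, smul_smul, ← sub_smul]
      convert zero_smul (L0 μ) (x n)
      apply AEEqFun.ext
      filter_upwards [AEEqFun.coeFn_sub (l * chi μ _ (hD n)) (chi μ _ (hD n) * ofReal0 (lam n)),
        AEEqFun.coeFn_mul l (chi μ _ (hD n)), AEEqFun.coeFn_mul (chi μ _ (hD n)) (ofReal0 (lam n)),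
        ofReal0_apply (lam n), chi_apply (μ := μ) _ (hD n),
        (AEEqFun.coeFn_zero : ⇑(0 : L0 μ) =ᵐ[μ] 0)] with ω h1 h2 h3 h4 h5 h6
      rw [h1, Pi.sub_apply, h2, h3, Pi.mul_apply, Pi.mul_apply, h4, h5, h6]
      by_cases hω : ω ∈ A N ∩ {ω | (lam n ω : ℂ) = l ω}
      · rw [indicator_of_mem hω, show (lam n ω : ℂ) = l ω from hω.2]
        simp
      · rw [indicator_of_notMem hω]
        simp
    · change chi μ (A N) _ • chi μ _ (hD n) • x n = chi μ _ (hD n) • x n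
      rw [smul_smul]
      congr 1
      apply AEEqFun.ext
      filter_upwards [AEEqFun.coeFn_mul (chi μ (A N) (hA.measurable N)) (chi μ _ (hD n)),
        chi_apply (μ := μ) _ (hD n), chi_apply (μ := μ) _ (hA.measurable N)] with ω h1 h2 h3
      rw [h1, Pi.mul_apply, h2, h3]
      by_cases hω : ω ∈ A N ∩ {ω | (lam n ω : ℂ) = l ω}
      · rw [indicator_of_mem hω, indicator_of_mem hω.1, Pi.one_apply, one_mul]
      · rw [indicator_of_notMem hω, mul_zero]
  · rintro _ ⟨u, hu, rfl⟩
    have hu' : opKH k u = l • u := (sub_eq_zero.1 (LinearMap.mem_ker.1 hu)).symm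
    have hsum : chi μ (A N) (hA.measurable N) • u =
        ∑ n ∈ Finset.range N, inner0 u (x n) • chi μ _ (hD n) • x n := by
      apply KH_ext
      filter_upwards [fib_smul (chi μ (A N) (hA.measurable N)) u,
        fib_sum (Finset.range N) fun n => inner0 u (x n) • chi μ _ (hD n) • x n,
        ae_all_iff.2 fun n => fib_smul (inner0 u (x n)) (chi μ _ (hD n) • x n),
        ae_all_iff.2 fun n => fib_smul (chi μ _ (hD n)) (x n),
        ae_all_iff.2 fun n => inner0_apply u (x n),
        ae_all_iff.2 fun n => chi_apply (μ := μ) _ (hD n),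
        chi_apply (μ := μ) _ (hA.measurable N), h.isDiag_opKH u, fib_smul l u, hl, hAB,
        ae_orthonormal_fib h.orthonormal] with ω h1 h2 h3 h4 h5 h6 h7 h8 h9 h10 h11 h12
      rw [hu', h9] at h8
      rw [h1, h2, h7]
      simp_rw [h3, h4, h5, h6]
      by_cases hω : ω ∈ A N
      · rw [indicator_of_mem hω, Pi.one_apply, one_smul]
        refine (h8.eq_sum_of_eigenvector h12 h10 (h11 N hω)).trans
          (Finset.sum_congr rfl fun n _ => ?_)
        by_cases hn : (lam n ω : ℂ) = l ω
        · rw [indicator_of_mem (mem_inter hω hn), Pi.one_apply, one_smul]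
        · rw [h8.inner_eq_zero_of_ne hn, zero_smul, zero_smul]
      · rw [indicator_of_notMem hω, zero_smul]
        refine (Finset.sum_eq_zero fun n _ => ?_).symm
        rw [indicator_of_notMem fun hcon => hω hcon.1, zero_smul, smul_zero]
    change chi μ (A N) (hA.measurable N) • u ∈ _
    rw [hsum]
    exact Submodule.sum_mem _ fun n hn => Submodule.smul_mem _ _
      (Submodule.subset_span
        (mem_image_of_mem (fun n => chi μ _ (hD n) • x n) (Finset.mem_range.1 hn)))

end IsEigenBasis

end

end PartInt

/-! ### The main theorem. -/

open MeasureTheory Filter Topology Set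
open scoped ENNReal ComplexOrder ComplexConjugate
theorem mainTheorem1 {Ω S : Type*} [MeasurableSpace Ω] [MeasurableSpace S]
    (μ : MeasureTheory.Measure Ω) (m : MeasureTheory.Measure S)
    [MeasureTheory.IsFiniteMeasure μ] [MeasureTheory.IsFiniteMeasure m]
    (hμ : μ ≠ 0) (hm : ¬ FiniteDimensional ℂ (MeasureTheory.Lp ℂ 2 m))
    (k : PartInt.Kernel μ m)
    (hk : PartInt.IsHermitianKernel k) (hpos : PartInt.IsPosSemidefKernel k) :
    ∃ (lam : ℕ → PartInt.L0h μ) (x : ℕ → PartInt.KH μ m),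
      -- (1) expansion in eigenfunctions, a basis whenever `L₂(S)` is separable
      (PartInt.IsEigenSystem k lam x ∧ PartInt.HasEigenExpansion k lam x ∧
        (TopologicalSpace.SeparableSpace (MeasureTheory.Lp ℂ 2 m) →
          PartInt.IsCompleteSystem x)) ∧
      -- (2), (3) spectral integrals
      (∃ (E : PartInt.L0h μ → PartInt.L22 μ m →L[ℂ] PartInt.L22 μ m) (a b : PartInt.L0h μ),
        PartInt.IsSpectralFamily lam x E ∧
        IsGLB (PartInt.numericalRange k) a ∧ IsLUB (PartInt.numericalRange k) b ∧
        ∀ ε : ℝ, 0 < ε →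
          PartInt.HasSpectralIntegral (fun r => (r : ℂ)) E a
            (b + MeasureTheory.AEEqFun.const Ω ε) (PartInt.op22 k) ∧
          ∀ f : ℝ → ℂ, (∀ᵐ ω ∂μ, ContinuousOn f (Set.Icc (a ω) (b ω + ε))) →
            PartInt.HasSpectralIntegral f E a (b + MeasureTheory.AEEqFun.const Ω ε)
              (cfc (fun z : ℂ => f z.re) (PartInt.op22 k))) ∧
      -- (4) eigenmodules
      (∀ l ∈ PartInt.discreteCyclicSpectrum (PartInt.opKH k),
        PartInt.IsSigmaFG (LinearMap.ker (l • LinearMap.id - PartInt.opKH k))) ∧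
      -- (5) the cyclic modular spectrum
      PartInt.cyclicSpectrum (PartInt.opKH k) =
        PartInt.mix (PartInt.disjointSums (PartInt.withZero lam)) := by
  obtain ⟨lam, x, h1, h2, h3, h4⟩ := PartInt.exists_eigen_basis hm hk hpos
  have h : PartInt.IsEigenBasis k lam x := ⟨h1, h2, h3⟩
  obtain ⟨E, hE, hEd⟩ := PartInt.exists_spectralFamily h2 lam
  obtain ⟨b, C, hb, hlb, hbC⟩ := h.exists_isLUB_numericalRange hpos
  refine ⟨lam, x, ⟨⟨h1, h2, h.tendsto⟩, h.hasEigenExpansion, fun hs =>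
    h.isCompleteSystem (h4 hs)⟩, ⟨E, 0, b, hE, h.isGLB_numericalRange hpos, hb, fun ε hε => ⟨?_,
    fun f hf => ?_⟩⟩, fun l hl => h.isSigmaFG_ker hl.2, h.cyclicSpectrum_eq hμ⟩
  -- The integral for `T` itself is the case of the identity function, since the spectrum of `T` is
  -- real.
  · have h5 := h.hasSpectralIntegral_cfc hμ hk hpos hlb hbC hEd hε (f := fun r => (r : ℂ))
      (Filter.Eventually.of_forall fun ω => Complex.continuous_ofReal.continuousOn)
    rwa [h.cfc_re_op22 hk hpos] at h5
  · refine h.hasSpectralIntegral_cfc hμ hk hpos hlb hbC hEd hε ?_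
    filter_upwards [hf, (MeasureTheory.AEEqFun.coeFn_zero : ⇑(0 : PartInt.L0h μ) =ᵐ[μ] 0)]
      with ω h6 h7
    rwa [h7] at h6
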